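/- Conventions. Let $q$ be a prime power and $n\ge 1$. A subgroup of $\mathrm{GL}(n,q)$ is homogeneous if $\mathbb F_q^n$ is, as a module for it, a direct sum of pairwise isomorphic irreducible submodules; a subgroup $G\le \mathrm{GL}(n,q)$ is weakly quasiprimitive if every characteristic subgroup of $G$ is homogeneous. For $e\mid n$, an $\mathbb F_q$-linear isomorphism $\mathbb F_q^n\cong \mathbb F_{q^e}^{\,n/e}$ embeds $\mathrm{GL}(n/e,q^e)$, and the group $\Gamma\mathrm{L}(n/e,q^e)$ of all $\mathbb F_q$-linear, $\mathbb F_{q^e}$-semilinear bijections, into $\mathrm{GL}(n,q)$; the images are determined up to conjugacy. A subdirect subgroup of a direct product is a subgroup that projects onto each direct factor. Lemma. Let $G\le \mathrm{GL}(n,q)$ be weakly quasiprimitive. Then there is a divisor $e\ge 1$ of $n$ such that, for a suitable such isomorphism, $G\le \Gamma\mathrm{L}(n/e,q^e)$ and $K:=G\cap \mathrm{GL}(n/e,q^e)$ has the following properties. 1. $|G:K|$ divides $e$, and $K$ is normal or 2-step subnormal in $G$ with all associated quotients cyclic; that is, there is $M$ with $K\trianglelefteq M\trianglelefteq G$ and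 $G/M$, $M/K$ cyclic. 2. $Z(K)=K\cap Z(\mathrm{GL}(n/e,q^e))$, and $K/Z(K)$ is isomorphic to a subdirect subgroup of a direct product $K_1\times\cdots\times K_u$ ($u\ge 0$), where each $K_i$ satisfies one of the following: (a) $K_i$ has a normal elementary abelian subgroup $N$ of order $r_i^{2m_i}$, with $m_i\ge 1$ and $r_i$ a prime dividing $q^e-1$, and $K_i/N\cong S$ for a completely reducible subgroup $S$ of $\mathrm{Sp}(2m_i,r_i)$, such that the conjugation action of $K_i$ on $N\cong\mathbb F_{r_i}^{2m_i}$ is the natural action of $S$; or (b) there are integers $s_i\ge 2$, $t_i\ge 1$, a finite nonabelian simple group $S$ with an absolutely irreducible projective representation $\rho$ of dimension $s_i$ over $\mathbb F_{q^e}$, and a subgroup $A$ with $S\cong\mathrm{Inn}\,S\le A\le \mathrm{Aut}\,S$ contained in the stabilizer of (the equivalence class of) $\rho$ in $\mathrm{Aut}\,S$, such that $K_i$ is isomorphic to a subgroup of $A\wr \mathrm{Sym}(t_i)$ containing $S^{t_i}=(\mathrm{Inn}\,S)^{t_i}$. Moreover, with $f(K_i):=r_i^{m_i}$ in case (a) and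 $f(K_i):=s_i^{t_i}$ in case (b), the product $\prod_{i=1}^u f(K_i)$ divides $n/e$. Finally, for each prime $r$ there is at most one $i$ such that $K_i$ is as in (a) with $r_i=r$. -/

import Mathlib

open scoped MatrixGroups Matrix SemidirectProduct

universe u

namespace LinearGroups

noncomputable section

/-- The natural representation on column vectors attached to a homomorphism into a matrix
algebra. -/
def natRep {G ι R : Type*} [Monoid G] [Fintype ι] [DecidableEq ι] [CommRing R]
    (f : G →* Matrix ι ι R) : Representation R G (ι → R) :=
  (Matrix.toLinAlgEquiv' : Matrix ι ι R ≃ₐ[R] ((ι → R) →ₗ[R] (ι → R))).toMulEquiv.toMonoidHom.comp f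

theorem natRep_apply {G ι R : Type*} [Monoid G] [Fintype ι] [DecidableEq ι] [CommRing R]
    (f : G →* Matrix ι ι R) (g : G) (v : ι → R) : natRep f g v = f g *ᵥ v := rfl

/-- The natural representation of a subgroup of `GL ι R`. -/
def glRep {ι R : Type*} [Fintype ι] [DecidableEq ι] [CommRing R] (H : Subgroup (GL ι R)) :
    Representation R H (ι → R) :=
  natRep ((Units.coeHom (Matrix ι ι R)).comp H.subtype)

/-- A linear group is homogeneous if its natural module is a direct sum of pairwise isomorphic
irreducible submodules, that is, if it is semisimple and all its simple submodules are
isomorphic. -/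
def IsHomogeneous {ι F : Type*} [Fintype ι] [DecidableEq ι] [Field F]
    (H : Subgroup (GL ι F)) : Prop :=
  IsSemisimpleModule (MonoidAlgebra F H) (glRep H).asModule ∧
    IsIsotypic (MonoidAlgebra F H) (glRep H).asModule

/-- A linear group is weakly quasiprimitive if all its characteristic subgroups are
homogeneous. -/
def IsWeaklyQuasiprimitive {ι F : Type*} [Fintype ι] [DecidableEq ι] [Field F]
    (G : Subgroup (GL ι F)) : Prop :=
  ∀ C : Subgroup G, C.Characteristic → IsHomogeneous (C.map G.subtype)

section Embedding

variable {F E : Type*} [Field F] [Field E] [Algebra F E] {n d : ℕ}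

/-- The embedding of `GL(d, E)` into `GL(n, F)` obtained by regarding `E ^ d` as an `F`-space and
identifying it with `F ^ n` along an `F`-linear isomorphism `φ`. -/
def glEmb (φ : (Fin n → F) ≃ₗ[F] (Fin d → E)) : GL (Fin d) E →* GL (Fin n) F where
  toFun g := Matrix.GeneralLinearGroup.toLin.symm
    ((LinearMap.GeneralLinearGroup.generalLinearEquiv F (Fin n → F)).symm
      (φ ≪≫ₗ (LinearMap.GeneralLinearGroup.toLinearEquiv
        (Matrix.GeneralLinearGroup.toLin g)).restrictScalars F ≪≫ₗ φ.symm))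
  map_one' := by
    rw [MulEquiv.map_eq_one_iff, MulEquiv.map_eq_one_iff]
    ext v : 1
    simp
  map_mul' g h := by
    rw [← map_mul, ← map_mul]
    congr 2
    ext v : 1
    simp

/-- The embedding is characterised by `φ (glEmb φ g • v) = g • φ v`. -/
theorem glEmb_mulVec (φ : (Fin n → F) ≃ₗ[F] (Fin d → E)) (g : GL (Fin d) E) (v : Fin n → F) :
    φ ((glEmb φ g).val *ᵥ v) = g.val *ᵥ φ v := by
  have h : (Matrix.GeneralLinearGroup.toLin (glEmb φ g)).val v = φ.symm (g.val *ᵥ φ v) := by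
    have h' : Matrix.GeneralLinearGroup.toLin (glEmb φ g) =
        (LinearMap.GeneralLinearGroup.generalLinearEquiv F (Fin n → F)).symm
          (φ ≪≫ₗ (LinearMap.GeneralLinearGroup.toLinearEquiv
            (Matrix.GeneralLinearGroup.toLin g)).restrictScalars F ≪≫ₗ φ.symm) :=
      MulEquiv.apply_symm_apply _ _
    rw [h']
    rfl
  exact (congrArg φ h).trans (φ.apply_symm_apply _)

/-- The image in `GL(n, F)` of the group of all `E`-semilinear bijections of `E ^ d` that are
`F`-linear, under the identification `φ` of `F ^ n` with `E ^ d`. -/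
def gammaL (φ : (Fin n → F) ≃ₗ[F] (Fin d → E)) : Subgroup (GL (Fin n) F) where
  carrier := {g | ∃ σ : E ≃ₐ[F] E, ∀ (c : E) (w : Fin d → E),
    φ (g.val *ᵥ φ.symm (c • w)) = σ c • φ (g.val *ᵥ φ.symm w)}
  one_mem' := ⟨1, fun c w => by simp⟩
  mul_mem' := by
    rintro a b ⟨σ, ha⟩ ⟨τ, hb⟩
    refine ⟨σ * τ, fun c w => ?_⟩
    have h1 : b.val *ᵥ φ.symm (c • w) = φ.symm (τ c • φ (b.val *ᵥ φ.symm w)) := by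
      rw [← hb, LinearEquiv.symm_apply_apply]
    rw [Units.val_mul, ← Matrix.mulVec_mulVec, h1, ha, LinearEquiv.symm_apply_apply,
      Matrix.mulVec_mulVec]
    rfl
  inv_mem' := by
    rintro a ⟨σ, ha⟩
    refine ⟨σ⁻¹, fun c w => ?_⟩
    have hinv : ∀ v, a.val *ᵥ (a⁻¹.val *ᵥ v) = v := fun v => by
      rw [Matrix.mulVec_mulVec, ← Units.val_mul, mul_inv_cancel, Units.val_one, Matrix.one_mulVec]
    have hinv' : ∀ v, a⁻¹.val *ᵥ (a.val *ᵥ v) = v := fun v => by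
      rw [Matrix.mulVec_mulVec, ← Units.val_mul, inv_mul_cancel, Units.val_one, Matrix.one_mulVec]
    have h1 := ha (σ⁻¹ c) (φ (a⁻¹.val *ᵥ φ.symm w))
    have h2 : σ (σ⁻¹ c) = c := σ.apply_symm_apply c
    rw [LinearEquiv.symm_apply_apply, hinv, LinearEquiv.apply_symm_apply, h2] at h1
    rw [← h1, LinearEquiv.symm_apply_apply, hinv', LinearEquiv.apply_symm_apply]

end Embedding

/-- A subgroup of the symplectic group over `ℤ/r` acts completely reducibly on the natural
module. -/
def IsCompletelyReducible {r m : ℕ} (S : Subgroup (Matrix.symplecticGroup (Fin m) (ZMod r))) :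
    Prop :=
  IsSemisimpleModule (MonoidAlgebra (ZMod r) S)
    (natRep ((Matrix.symplecticGroup (Fin m) (ZMod r)).subtype.comp S.subtype)).asModule

/-- `H` has shape `N.S` where `N` is an elementary abelian normal subgroup of order `r ^ (2 * m)`,
`r` is a prime dividing `|E| - 1`, and `H / N ≅ S` for a completely reducible subgroup `S` of
`Sp(2m, r)`, such that the conjugation action of `H` on `N` is the natural action of `S` on
`(ℤ/r) ^ (2m)`. -/
def IsSymplecticShape (E H : Type*) [Field E] [Group H] (r m : ℕ) : Prop :=
  r.Prime ∧ r ∣ Nat.card E - 1 ∧ 1 ≤ m ∧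
  ∃ (N : Subgroup H) (hN : N.Normal) (S : Subgroup (Matrix.symplecticGroup (Fin m) (ZMod r)))
    (π : H →* S) (ν : Additive N ≃+ (Fin m ⊕ Fin m → ZMod r)),
    IsCompletelyReducible S ∧ Function.Surjective π ∧ π.ker = N ∧
    ∀ (g : H) (x : N),
      ν (Additive.ofMul ⟨g * x * g⁻¹, hN.conj_mem x x.2 g⟩) =
        ((π g : Matrix.symplecticGroup (Fin m) (ZMod r)) : Matrix _ _ (ZMod r)) *ᵥ
          ν (Additive.ofMul x)

/-- A projective representation `ρ : S → PGL(s, E)` is absolutely irreducible if over every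
extension field `L` of `E` the full preimage of its image in `GL(s, E)` acts irreducibly
on `L ^ s`. -/
def IsAbsIrreducibleProj {E S : Type u} [Field E] [Group S] {s : ℕ} (ρ : S →* PGL(s, E)) :
    Prop :=
  ∀ (L : Type u) [Field L] [Algebra E L],
    (glRep ((ρ.range.comap Matrix.ProjGenLinGroup.mk).map
      (Matrix.GeneralLinearGroup.map (n := Fin s) (algebraMap E L)))).IsIrreducible

/-- The stabilizer in `Aut S` of (the equivalence class of) a projective representation `ρ`. -/
def projStabilizer {E S : Type*} [Field E] [Group S] {s : ℕ} (ρ : S →* PGL(s, E)) :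
    Subgroup (MulAut S) where
  carrier := {α | ∃ P : PGL(s, E), ∀ x, ρ (α x) = P * ρ x * P⁻¹}
  one_mem' := ⟨1, fun x => by simp⟩
  mul_mem' := by
    rintro α β ⟨P, hP⟩ ⟨Q, hQ⟩
    refine ⟨P * Q, fun x => ?_⟩
    rw [MulAut.mul_apply, hP, hQ]
    group
  inv_mem' := by
    rintro α ⟨P, hP⟩
    refine ⟨P⁻¹, fun x => ?_⟩
    have h := hP (α⁻¹ x)
    rw [MulAut.apply_inv_self] at h
    rw [h]
    group

/-- The wreath product `A ≀ Sym(t)`, with base group `A ^ t` permuted by `Sym(t)`. -/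
abbrev WreathSym (A : Type*) [Group A] (t : ℕ) : Type _ :=
  (Fin t → A) ⋊[mulAutArrow] Equiv.Perm (Fin t)

/-- There is a finite nonabelian simple group `S` with an absolutely irreducible projective
representation `ρ` of dimension `s ≥ 2` over `E` and a subgroup `A` of the stabilizer of `ρ` in
`Aut S` containing `Inn S ≅ S`, such that `H` is isomorphic to a subgroup of `A ≀ Sym(t)`
containing `(Inn S) ^ t ≅ S ^ t`. -/
def IsWreathShape (E H : Type u) [Field E] [Group H] (s t : ℕ) : Prop :=
  2 ≤ s ∧ 1 ≤ t ∧
  ∃ (S : Type u) (_ : Group S) (ρ : S →* PGL(s, E)) (A : Subgroup (MulAut S))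
    (B : Subgroup (WreathSym A t)),
    Finite S ∧ IsSimpleGroup S ∧ (∃ x y : S, x * y ≠ y * x) ∧
    IsAbsIrreducibleProj ρ ∧ A ≤ projStabilizer ρ ∧
    (MulAut.conj : S →* MulAut S).range ≤ A ∧
    (∀ a : Fin t → A, (∀ i, (a i : MulAut S) ∈ (MulAut.conj : S →* MulAut S).range) →
      SemidirectProduct.inl a ∈ B) ∧
    Nonempty (H ≃* B)

/-- The two kinds of factors, with their numerical parameters. -/
inductive FactorKind : Type
  | symplectic (r m : ℕ)
  | wreath (s t : ℕ)

/-- The degree attached to a factor. -/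
def FactorKind.degree : FactorKind → ℕ
  | .symplectic r m => r ^ m
  | .wreath s t => s ^ t

/-- The group `H` is a factor of the given kind (relative to the field `E`). -/
def IsFactorOfKind (E H : Type u) [Field E] [Group H] : FactorKind → Prop
  | .symplectic r m => IsSymplecticShape E H r m
  | .wreath s t => IsWreathShape E H s t

end

end LinearGroups

/-! Choose a maximal commutative characteristic subgroup `Z` of `G` and put `M = C_G(Z)`. Every
commutative characteristic subgroup of `M` is central in `M`, and whatever centralizes `Z(M)` lies
in `M` (`exists_characteristic_centralizer`). Let `N` be the preimage in `M` of the socle of `Q = M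
/ Z(M)`; then `C_M(N) = Z(M)` (`centralizer_socleOverCenter`). Since `N` is characteristic in `G`,
it is homogeneous, so the center of its enveloping algebra is a finite field `E`
(`IsHomogeneousAlg.exists_field`). The group `G` normalizes this algebra and acts on `E` by Galois
automorphisms. Hence `G` is semilinear over `E`, and the kernel `K` of the action is the `E`-linear
part of `G`. As `Gal(E/F)` is cyclic of order `e`, the quotient `G / K` is cyclic of order dividing
`e`. Both `N ≤ K ≤ M` hold: `N` commutes with the center of its own envelope, and `Z(M)` acts by
scalars of `E`, so that `K` centralizes it. Therefore `K / Z(K)` embeds in `Q` as a normal subgroup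
containing the socle.

The socle is generated by blocks: one elementary abelian `r`-group for each relevant prime `r`, and
the nonabelian simple factors. Preimages in `K` of distinct blocks commute exactly, not only modulo
the center (`commute_comap_socleBlocks`). So the envelope of each block is a direct factor, up to
commuting complements, of a homogeneous algebra with center `E`; it is simple with center `E`, and
by Wedderburn it is a matrix algebra over `E` (`IsHomogeneousAlg.exists_algEquiv_matrix`). Commuting
matrix algebras on one space have degrees whose product divides its dimension `n / e`
(`prod_dvd_finrank`).

Let `K` act by conjugation on the preimage of an abelian block, or of a `K`-orbit of simple factors.
The images are the factors `K_i`, and the common kernel centralizes `N`, hence is `Z(K)`; this is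
the subdirect embedding. On an abelian block the commutator is a nondegenerate symplectic form, and
its envelope has dimension equal to the order of the block, which gives degree `r ^ m`. On an orbit
of `t` simple factors the action is of wreath type. Conjugation by `K` induces automorphisms of the
envelope of one factor, and Skolem and Noether show that these stabilize its projective
representation of degree `s`; the `t` factors together contribute `s ^ t`. -/

namespace LinearGroups

/-! ### Minimal invariant subgroups and the structure of the socle. -/

section Socle

variable {Q : Type*} [Group Q]

/-- `T` is invariant under conjugation by the elements of `H`. -/
def ConjInvariant (H T : Subgroup Q) : Prop := ∀ h ∈ H, ∀ t ∈ T, h * t * h⁻¹ ∈ T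

/-- `T` is minimal among the nontrivial subgroups invariant under conjugation by `H`. -/
structure IsMinInv (H T : Subgroup Q) : Prop where
  ne_bot : T ≠ ⊥
  inv : ConjInvariant H T
  eq_of_le : ∀ U ≤ T, ConjInvariant H U → U ≠ ⊥ → U = T

/-- The conjugate of a subgroup. -/
def conjBy (g : Q) (T : Subgroup Q) : Subgroup Q := T.map (MulAut.conj g).toMonoidHom

theorem mem_conjBy {g x : Q} {T : Subgroup Q} : x ∈ conjBy g T ↔ g⁻¹ * x * g ∈ T := by
  constructor
  · rintro ⟨t, ht, rfl⟩
    simpa [mul_assoc] using ht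
  · intro h
    exact ⟨_, h, by simp [mul_assoc]⟩

theorem conj_mem_conjBy {g x : Q} {T : Subgroup Q} (hx : x ∈ T) : g * x * g⁻¹ ∈ conjBy g T :=
  mem_conjBy.2 (by simpa [mul_assoc] using hx)

theorem conjBy_one (T : Subgroup Q) : conjBy 1 T = T := by
  ext x; simp [mem_conjBy]

theorem conjBy_mul (g h : Q) (T : Subgroup Q) : conjBy (g * h) T = conjBy g (conjBy h T) := by
  ext x; simp [mem_conjBy, mul_assoc]

theorem ConjInvariant.conjBy_eq {H T : Subgroup Q} (h : ConjInvariant H T) {g : Q} (hg : g ∈ H) :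
    conjBy g T = T := by
  ext x
  rw [mem_conjBy]
  constructor
  · intro hx
    simpa [mul_assoc] using h g hg _ hx
  · intro hx
    simpa [mul_assoc] using h g⁻¹ (inv_mem hg) _ hx

theorem ConjInvariant.mono {H H' T : Subgroup Q} (h : ConjInvariant H T) (hH : H' ≤ H) :
    ConjInvariant H' T := fun x hx => h x (hH hx)

theorem conjInvariant_self (H : Subgroup Q) : ConjInvariant H H := fun _ hh _ ht =>
  mul_mem (mul_mem hh ht) (inv_mem hh)

theorem ConjInvariant.normal {T : Subgroup Q} (h : ConjInvariant ⊤ T) : T.Normal :=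
  ⟨fun t ht g => h g trivial t ht⟩

theorem conjInvariant_of_normal (H T : Subgroup Q) [hT : T.Normal] : ConjInvariant H T :=
  fun g _ t ht => hT.conj_mem t ht g

theorem conjInvariant_sSup {H : Subgroup Q} {S : Set (Subgroup Q)}
    (h : ∀ T ∈ S, ConjInvariant H T) : ConjInvariant H (sSup S) := by
  intro g hg t ht
  have : (sSup S) ≤ conjBy g⁻¹ (sSup S) := by
    refine sSup_le fun T hT x hx => ?_
    rw [mem_conjBy, inv_inv]
    exact le_sSup hT (h T hT g hg x hx)
  have h1 := this ht
  rwa [mem_conjBy, inv_inv] at h1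

theorem ConjInvariant.inf {H T U : Subgroup Q} (h : ConjInvariant H T) (h' : ConjInvariant H U) :
    ConjInvariant H (T ⊓ U) := fun g hg t ht => ⟨h g hg t ht.1, h' g hg t ht.2⟩

theorem ConjInvariant.of_commute {H T : Subgroup Q} (h : ∀ x ∈ H, ∀ y ∈ T, x * y = y * x) :
    ConjInvariant H T := fun g hg t ht => by
  rw [h g hg t ht, mul_inv_cancel_right]; exact ht

theorem conjInvariant_sSup_left {T : Subgroup Q} {S : Set (Subgroup Q)}
    (h : ∀ H ∈ S, ConjInvariant H T) : ConjInvariant (sSup S) T := by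
  have : sSup S ≤ Subgroup.normalizer (T : Set Q) := by
    refine sSup_le fun H hH g hg => ?_
    rw [Subgroup.mem_normalizer_iff]
    intro x
    refine ⟨h H hH g hg x, fun hx => ?_⟩
    simpa [mul_assoc] using h H hH g⁻¹ (inv_mem hg) _ hx
  intro g hg t ht
  exact (Subgroup.mem_normalizer_iff.1 (this hg) t).1 ht

theorem exists_isMinInv [Finite Q] {H T : Subgroup Q} (hT : T ≠ ⊥) (hinv : ConjInvariant H T) :
    ∃ U ≤ T, IsMinInv H U := by
  obtain ⟨U, hU, hmin⟩ := exists_minimal_le_of_wellFoundedLT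
    (fun U : Subgroup Q => U ≠ ⊥ ∧ ConjInvariant H U) T ⟨hT, hinv⟩
  exact ⟨U, hU, hmin.1.1, hmin.1.2, fun W hW hWi hWb => le_antisymm hW (hmin.2 ⟨hWb, hWi⟩ hW)⟩

theorem IsMinInv.map {R : Type*} [Group R] {H T : Subgroup Q} (h : IsMinInv H T) (φ : Q ≃* R) :
    IsMinInv (H.map φ.toMonoidHom) (T.map φ.toMonoidHom) := by
  refine ⟨fun hb => h.ne_bot ?_, ?_, ?_⟩
  · exact (Subgroup.map_eq_bot_iff_of_injective _ φ.injective).1 hb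
  · rintro _ ⟨x, hx, rfl⟩ _ ⟨t, ht, rfl⟩
    exact ⟨_, h.inv x hx t ht, by simp⟩
  · intro U hU hUi hUb
    have h1 : U.comap φ.toMonoidHom = T := by
      refine h.eq_of_le _ ?_ ?_ ?_
      · intro x hx
        obtain ⟨t, ht, e⟩ := hU hx
        rwa [← φ.injective e]
      · intro g hg t ht
        have := hUi (φ g) ⟨g, hg, rfl⟩ (φ t) ht
        simpa using this
      · intro hb
        apply hUb
        rw [← Subgroup.map_comap_eq_self_of_surjective (f := φ.toMonoidHom) φ.surjective U, hb,
          Subgroup.map_bot]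
    rw [← h1, Subgroup.map_comap_eq_self_of_surjective (f := φ.toMonoidHom) φ.surjective]

theorem IsMinInv.conj {H T : Subgroup Q} (h : IsMinInv H T) {g : Q}
    (hg : conjBy g H = H) : IsMinInv H (conjBy g T) := by
  have := h.map (MulAut.conj g)
  rwa [show H.map (MulAut.conj g).toMonoidHom = H from hg] at this

/-- By minimality the intersection is trivial, and it contains all commutators because each subgroup
lies in `H` and so normalizes the other. -/
theorem IsMinInv.commute {H T U : Subgroup Q} (hT : IsMinInv H T) (hU : IsMinInv H U)
    (hTH : T ≤ H) (hUH : U ≤ H) (hne : T ≠ U) : ∀ x ∈ T, ∀ y ∈ U, x * y = y * x := by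
  have hb : T ⊓ U = ⊥ := by
    by_contra hb
    exact hne ((hT.eq_of_le _ inf_le_left (hT.inv.inf hU.inv) hb).symm.trans
      (hU.eq_of_le _ inf_le_right (hT.inv.inf hU.inv) hb))
  intro x hx y hy
  have h1 : x * y * x⁻¹ * y⁻¹ ∈ T ⊓ U := by
    refine ⟨?_, ?_⟩
    · have := mul_mem hx (hT.inv y (hUH hy) x⁻¹ (T.inv_mem hx))
      simpa [mul_assoc] using this
    · exact U.mul_mem (hU.inv x (hTH hx) y hy) (U.inv_mem hy)
  rw [hb, Subgroup.mem_bot, mul_inv_eq_one, mul_inv_eq_iff_eq_mul] at h1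
  exact h1

/-- The conjugates generate a nontrivial `L`-invariant subgroup of `Y`, so minimality applies. -/
theorem IsMinInv.eq_sSup_conjBy {L T Y : Subgroup Q} (hY : IsMinInv L Y) (hT : T ≠ ⊥)
    (hTY : T ≤ Y) : Y = sSup {U | ∃ g ∈ L, U = conjBy g T} := by
  symm
  refine hY.eq_of_le _ (sSup_le ?_) ?_ ?_
  · rintro _ ⟨g, hg, rfl⟩ x hx
    rw [← hY.inv.conjBy_eq hg]
    rw [mem_conjBy] at hx ⊢
    exact hTY hx
  · intro g hg t ht
    have : sSup {U | ∃ g ∈ L, U = conjBy g T} ≤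
        conjBy g⁻¹ (sSup {U | ∃ g ∈ L, U = conjBy g T}) := by
      refine sSup_le ?_
      rintro _ ⟨a, ha, rfl⟩ x hx
      rw [mem_conjBy, inv_inv]
      refine (le_sSup ⟨g * a, mul_mem hg ha, rfl⟩ :
        conjBy (g * a) T ≤ sSup {U | ∃ g ∈ L, U = conjBy g T}) ?_
      rw [conjBy_mul]
      exact conj_mem_conjBy hx
    have h1 := this ht
    rwa [mem_conjBy, inv_inv] at h1
  · intro hb
    apply hT
    rw [eq_bot_iff, ← hb]
    exact le_sSup ⟨1, one_mem _, (conjBy_one T).symm⟩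

/-- Clifford's theorem for minimal invariant subgroups. -/
theorem IsMinInv.le_sSup_of_normal [Finite Q] {L H Y : Subgroup Q} (hY : IsMinInv L Y)
    (hHL : H ≤ L) (hH : ConjInvariant L H) : Y ≤ sSup {T | T ≤ Y ∧ IsMinInv H T} := by
  obtain ⟨T, hTY, hT⟩ := exists_isMinInv hY.ne_bot (hY.inv.mono hHL)
  nth_rewrite 1 [hY.eq_sSup_conjBy hT.ne_bot hTY]
  apply sSup_le_sSup
  rintro _ ⟨g, hg, rfl⟩
  refine ⟨?_, hT.conj (hH.conjBy_eq hg)⟩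
  intro x hx
  rw [← hY.inv.conjBy_eq hg]
  rw [mem_conjBy] at hx ⊢
  exact hTY hx

/-- The product of the minimal normal subgroups. -/
def socle (Q : Type*) [Group Q] : Subgroup Q := sSup {Y | IsMinInv ⊤ Y}

/-- The product of the minimal normal subgroups that are commutative of exponent `r`. -/
def abelianSocle (Q : Type*) [Group Q] (r : ℕ) : Subgroup Q :=
  sSup {Y | IsMinInv ⊤ Y ∧ (∀ x ∈ Y, ∀ y ∈ Y, x * y = y * x) ∧ ∀ x ∈ Y, x ^ r = 1}

/-- The simple direct factors of the nonabelian minimal normal subgroups. -/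
def simpleFactors (Q : Type*) [Group Q] : Set (Subgroup Q) :=
  {T | (∃ Y, IsMinInv ⊤ Y ∧ T ≤ Y ∧ IsMinInv Y T) ∧ ∃ x ∈ T, ∃ y ∈ T, x * y ≠ y * x}

theorem socle_characteristic : (socle Q).Characteristic := by
  rw [Subgroup.characteristic_iff_map_le]
  intro φ
  rw [socle, Subgroup.map_le_iff_le_comap]
  refine sSup_le fun Y hY => ?_
  rw [← Subgroup.map_le_iff_le_comap]
  refine le_sSup ?_
  have := IsMinInv.map hY φ
  rwa [Subgroup.map_top_of_surjective φ.toMonoidHom φ.surjective] at this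

theorem abelianSocle_le_socle (r : ℕ) : abelianSocle Q r ≤ socle Q :=
  sSup_le_sSup fun _ hY => hY.1

theorem simpleFactors_le_socle {T : Subgroup Q} (hT : T ∈ simpleFactors Q) : T ≤ socle Q := by
  obtain ⟨⟨Y, hY, hTY, -⟩, -⟩ := hT
  exact hTY.trans (le_sSup hY)

theorem commute_of_mem_sSup {S S' : Set (Subgroup Q)}
    (h : ∀ A ∈ S, ∀ B ∈ S', ∀ x ∈ A, ∀ y ∈ B, x * y = y * x) :
    ∀ x ∈ sSup S, ∀ y ∈ sSup S', x * y = y * x := by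
  have h1 : sSup S ≤ Subgroup.centralizer (sSup S' : Subgroup Q) := by
    refine sSup_le fun A hA => ?_
    rw [Subgroup.le_centralizer_iff]
    refine sSup_le fun B hB y hy => ?_
    rw [Subgroup.mem_centralizer_iff]
    intro x hx
    exact h A hA B hB x hx y hy
  intro x hx y hy
  exact (Subgroup.mem_centralizer_iff.1 (h1 hx) y hy).symm

theorem abelianSocle_comm (r : ℕ) :
    ∀ x ∈ abelianSocle Q r, ∀ y ∈ abelianSocle Q r, x * y = y * x := by
  refine commute_of_mem_sSup ?_
  rintro A ⟨hA, hA', -⟩ B ⟨hB, -, -⟩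
  by_cases h : A = B
  · subst h; exact hA'
  · exact hA.commute hB le_top le_top h

theorem abelianSocle_pow (r : ℕ) : ∀ x ∈ abelianSocle Q r, x ^ r = 1 := by
  intro x hx
  let W : Subgroup Q := {
    carrier := {x | x ∈ abelianSocle Q r ∧ x ^ r = 1}
    one_mem' := ⟨one_mem _, one_pow _⟩
    mul_mem' := fun {a b} ha hb => ⟨mul_mem ha.1 hb.1, by
      rw [(show Commute a b from abelianSocle_comm r a ha.1 b hb.1).mul_pow, ha.2, hb.2, mul_one]⟩
    inv_mem' := fun {a} ha => ⟨inv_mem ha.1, by rw [inv_pow, ha.2, inv_one]⟩ }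
  have : abelianSocle Q r ≤ W := by
    refine sSup_le fun Y hY y hy => ⟨?_, hY.2.2 y hy⟩
    exact le_sSup hY hy
  exact (this hx).2

theorem abelianSocle_conjInvariant (r : ℕ) : ConjInvariant ⊤ (abelianSocle Q r) :=
  conjInvariant_sSup fun _ hY => hY.1.inv

/-- Clifford's theorem on each minimal normal subgroup. This is the source of complete reducibility
of the symplectic action of the smaller group `H`. -/
theorem abelianSocle_le_sSup [Finite Q] {H : Subgroup Q} [H.Normal] (r : ℕ) :
    abelianSocle Q r ≤ sSup {T | T ≤ abelianSocle Q r ∧ IsMinInv H T} := by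
  refine sSup_le fun Y hY => (hY.1.le_sSup_of_normal le_top (conjInvariant_of_normal _ H)).trans ?_
  refine sSup_le_sSup fun T hT => ⟨hT.1.trans (le_sSup hY), hT.2⟩

theorem abelianSocle_commute_simpleFactors (r : ℕ) {T : Subgroup Q} (hT : T ∈ simpleFactors Q) :
    ∀ x ∈ abelianSocle Q r, ∀ y ∈ T, x * y = y * x := by
  have := commute_of_mem_sSup
    (S := {Y | IsMinInv ⊤ Y ∧ (∀ x ∈ Y, ∀ y ∈ Y, x * y = y * x) ∧ ∀ x ∈ Y, x ^ r = 1})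
    (S' := {T}) ?_
  · rw [sSup_singleton] at this
    exact this
  · rintro A ⟨hA, hA', -⟩ T rfl x hx y hy
    obtain ⟨⟨Y, hY, hTY, -⟩, a, ha, b, hb, hab⟩ := hT
    refine hA.commute hY le_top le_top ?_ x hx y (hTY hy)
    rintro rfl
    exact hab (hA' a (hTY ha) b (hTY hb))

theorem simpleFactors_commute {T U : Subgroup Q} (hT : T ∈ simpleFactors Q)
    (hU : U ∈ simpleFactors Q) (hne : T ≠ U) : ∀ x ∈ T, ∀ y ∈ U, x * y = y * x := by
  obtain ⟨⟨Y, hY, hTY, hT'⟩, -⟩ := hT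
  obtain ⟨⟨Y', hY', hUY, hU'⟩, -⟩ := hU
  by_cases h : Y = Y'
  · subst h
    exact hT'.commute hU' hTY hUY hne
  · intro x hx y hy
    exact hY.commute hY' le_top le_top h x (hTY hx) y (hUY hy)

theorem conjBy_mem_simpleFactors {T : Subgroup Q} (hT : T ∈ simpleFactors Q) (g : Q) :
    conjBy g T ∈ simpleFactors Q := by
  obtain ⟨⟨Y, hY, hTY, hT'⟩, x, hx, y, hy, hxy⟩ := hT
  have hYg : conjBy g Y = Y := hY.inv.conjBy_eq trivial
  refine ⟨⟨Y, hY, ?_, hT'.conj hYg⟩, g * x * g⁻¹, conj_mem_conjBy hx, g * y * g⁻¹,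
    conj_mem_conjBy hy, fun h => hxy ?_⟩
  · rw [← hYg]; exact Subgroup.map_mono hTY
  · simpa only [← map_mul, (MulAut.conj g).injective.eq_iff] using
      (show MulAut.conj g x * MulAut.conj g y = MulAut.conj g y * MulAut.conj g x from h)

/-- `Y` is generated by the conjugates of `T`; one that differs from `T` commutes with it. So
normality in `T` implies normality in `Y`, which makes the factors simple. -/
theorem IsMinInv.conjInvariant_of_le {Y T U : Subgroup Q} (hY : IsMinInv ⊤ Y) (hTY : T ≤ Y)
    (hT : IsMinInv Y T) (hUT : U ≤ T) (hU : ConjInvariant T U) : ConjInvariant Y U := by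
  rw [hY.eq_sSup_conjBy hT.ne_bot hTY]
  refine conjInvariant_sSup_left ?_
  rintro _ ⟨g, -, rfl⟩
  have hYg : conjBy g Y = Y := hY.inv.conjBy_eq trivial
  by_cases h : conjBy g T = T
  · rwa [h]
  · refine ConjInvariant.of_commute fun x hx y hy => ?_
    refine (hT.conj hYg).commute hT ?_ hTY h x hx y (hUT hy)
    exact (Subgroup.map_mono hTY).trans hYg.le

theorem isSimpleGroup_of_mem_simpleFactors {T : Subgroup Q} (hT : T ∈ simpleFactors Q) :
    IsSimpleGroup T := by
  obtain ⟨⟨Y, hY, hTY, hT⟩, -⟩ := hT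
  have : Nontrivial T := (Subgroup.nontrivial_iff_ne_bot T).2 hT.ne_bot
  refine ⟨fun U hU => ?_⟩
  by_cases hb : U = ⊥
  · exact Or.inl hb
  right
  have hle : U.map T.subtype ≤ T := by rintro _ ⟨x, -, rfl⟩; exact x.2
  have h1 : U.map T.subtype = T := by
    refine hT.eq_of_le _ hle (hY.conjInvariant_of_le hTY hT hle ?_) ?_
    · rintro h hh _ ⟨x, hx, rfl⟩
      exact ⟨_, hU.conj_mem x hx ⟨h, hh⟩, rfl⟩
    · rwa [Ne, Subgroup.map_eq_bot_iff_of_injective _ T.subtype_injective]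
  rw [eq_top_iff]
  intro x _
  have : (x : Q) ∈ U.map T.subtype := by rw [h1]; exact x.2
  obtain ⟨y, hy, e⟩ := this
  rwa [← Subtype.ext e]

/-- A commutative minimal normal subgroup has prime exponent. -/
theorem IsMinInv.exists_prime_exponent [Finite Q] {Y : Subgroup Q} (hY : IsMinInv ⊤ Y)
    (hc : ∀ x ∈ Y, ∀ y ∈ Y, x * y = y * x) : ∃ r : ℕ, r.Prime ∧ ∀ x ∈ Y, x ^ r = 1 := by
  have hcard : Nat.card Y ≠ 1 := fun h => hY.ne_bot (Subgroup.card_eq_one.1 h)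
  obtain ⟨r, hr, hdvd⟩ := Nat.exists_prime_and_dvd hcard
  have : Fact r.Prime := ⟨hr⟩
  obtain ⟨y, hy⟩ := exists_prime_orderOf_dvd_card' r hdvd
  refine ⟨r, hr, ?_⟩
  let W : Subgroup Q := {
    carrier := {x | x ∈ Y ∧ x ^ r = 1}
    one_mem' := ⟨one_mem _, one_pow _⟩
    mul_mem' := fun {a b} ha hb => ⟨mul_mem ha.1 hb.1, by
      rw [(show Commute a b from hc a ha.1 b hb.1).mul_pow, ha.2, hb.2, mul_one]⟩
    inv_mem' := fun {a} ha => ⟨inv_mem ha.1, by rw [inv_pow, ha.2, inv_one]⟩ }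
  have hW : W = Y := by
    refine hY.eq_of_le W (fun x hx => hx.1) ?_ ?_
    · intro g hg t ht
      exact ⟨hY.inv g hg t ht.1, by rw [conj_pow, ht.2, mul_one, mul_inv_cancel]⟩
    · intro hb
      have h1 : (y : Q) ∈ W := ⟨y.2, by
        rw [← Subgroup.coe_pow, ← hy, pow_orderOf_eq_one, Subgroup.coe_one]⟩
      rw [hb, Subgroup.mem_bot] at h1
      have h2 : y = 1 := Subtype.ext h1
      rw [h2, orderOf_one] at hy
      exact hr.one_lt.ne hy
  intro x hx
  rw [← hW] at hx
  exact hx.2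

/-- A commutative minimal normal subgroup has prime exponent. Any other one is generated by
conjugates of a minimal invariant subgroup of itself; were that commutative, all conjugates would
commute and so would the whole subgroup. -/
theorem socle_le [Finite Q] : socle Q ≤
    sSup ({A | ∃ r : ℕ, r.Prime ∧ A = abelianSocle Q r} ∪ simpleFactors Q) := by
  refine sSup_le fun Y (hY : IsMinInv ⊤ Y) => ?_
  by_cases hc : ∀ x ∈ Y, ∀ y ∈ Y, x * y = y * x
  · obtain ⟨r, hr, hexp⟩ := hY.exists_prime_exponent hc
    have h1 : Y ≤ abelianSocle Q r := le_sSup ⟨hY, hc, hexp⟩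
    exact h1.trans (le_sSup (Or.inl ⟨r, hr, rfl⟩))
  · obtain ⟨T, hTY, hT⟩ := exists_isMinInv hY.ne_bot (conjInvariant_self Y)
    have heq := hY.eq_sSup_conjBy hT.ne_bot hTY
    have hconj : ∀ g : Q, IsMinInv Y (conjBy g T) := fun g =>
      hT.conj (hY.inv.conjBy_eq trivial)
    have hconjle : ∀ g : Q, conjBy g T ≤ Y := fun g => by
      rw [← hY.inv.conjBy_eq (g := g) trivial]
      exact Subgroup.map_mono hTY
    have hTn : ∃ x ∈ T, ∃ y ∈ T, x * y ≠ y * x := by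
      by_contra! hTc
      apply hc
      rw [heq]
      refine commute_of_mem_sSup ?_
      rintro _ ⟨g, -, rfl⟩ _ ⟨h, -, rfl⟩
      by_cases hgh : conjBy g T = conjBy h T
      · rw [← hgh]
        intro x hx y hy
        rw [mem_conjBy] at hx hy
        have := hTc _ hx _ hy
        have e : ∀ a b : Q, g⁻¹ * a * g * (g⁻¹ * b * g) = g⁻¹ * (a * b) * g := fun a b => by group
        rw [e, e] at this
        exact mul_left_cancel (mul_right_cancel this)
      · exact (hconj g).commute (hconj h) (hconjle g) (hconjle h) hgh
    rw [heq]
    refine sSup_le_sSup ?_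
    rintro _ ⟨g, -, rfl⟩
    exact Or.inr (conjBy_mem_simpleFactors ⟨⟨Y, hY, hTY, hT⟩, hTn⟩ g)

end Socle

/-! ### The socle modulo the center and its centralizer. -/

section CentralQuotient

variable {M : Type*} [Group M]

/-- The preimage of the socle of the central quotient. -/
def socleOverCenter (M : Type*) [Group M] : Subgroup M :=
  (socle (M ⧸ Subgroup.center M)).comap (QuotientGroup.mk' (Subgroup.center M))

theorem socleOverCenter_characteristic : (socleOverCenter M).Characteristic :=
  Subgroup.Characteristic.comap_quotient_mk socle_characteristic

theorem center_le_socleOverCenter : Subgroup.center M ≤ socleOverCenter M := by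
  intro z hz
  rw [socleOverCenter, Subgroup.mem_comap, QuotientGroup.mk'_apply,
    (QuotientGroup.eq_one_iff z).2 hz]
  exact one_mem _

/-- If all commutative characteristic subgroups of `M` are central, then the centralizer of
the preimage of the socle of `M ⧸ Z(M)` is `Z(M)`. -/
theorem centralizer_socleOverCenter [Finite M]
    (h : ∀ C : Subgroup M, C.Characteristic → (∀ x ∈ C, ∀ y ∈ C, x * y = y * x) →
      C ≤ Subgroup.center M) :
    Subgroup.centralizer (socleOverCenter M : Set M) ≤ Subgroup.center M := by
  have := socleOverCenter_characteristic (M := M)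
  set C := Subgroup.centralizer (socleOverCenter M : Set M) with hC
  -- The intersection is commutative since one side centralizes the other, and it is characteristic.
  have hCN : C ⊓ socleOverCenter M ≤ Subgroup.center M := by
    refine h _ inferInstance fun x hx y hy => ?_
    exact (Subgroup.mem_centralizer_iff.1 hx.1 y hy.2).symm
  by_contra hle
  have hCn : C.Normal := inferInstance
  -- A noncentral `C` would have an image containing a minimal normal subgroup of the quotient. That
  -- subgroup lies in the socle, so it lifts into the central intersection above and is trivial.
  have h1 : C.map (QuotientGroup.mk' (Subgroup.center M)) ≠ ⊥ := by
    intro hb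
    apply hle
    rw [Subgroup.map_eq_bot_iff, QuotientGroup.ker_mk'] at hb
    exact hb
  have h2 : (C.map (QuotientGroup.mk' (Subgroup.center M))).Normal :=
    hCn.map _ (QuotientGroup.mk'_surjective _)
  obtain ⟨Y, hYC, hY⟩ := exists_isMinInv h1 (conjInvariant_of_normal ⊤ _)
  apply hY.ne_bot
  rw [eq_bot_iff]
  intro y hy
  obtain ⟨c, hc, rfl⟩ := hYC hy
  rw [Subgroup.mem_bot, QuotientGroup.mk'_apply, QuotientGroup.eq_one_iff]
  refine hCN ⟨hc, ?_⟩
  exact (le_sSup hY : Y ≤ socle _) hy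

end CentralQuotient

end LinearGroups

namespace LinearGroups

/-! ### Artinian prime rings and central simple algebras over finite fields. -/

section SimpleRings

/-- An Artinian prime ring is simple. -/
theorem isSimpleRing_of_prime {R : Type*} [Ring R] [Nontrivial R] [IsArtinianRing R]
    (h : ∀ a b : R, (∀ x, a * x * b = 0) → a = 0 ∨ b = 0) : IsSimpleRing R := by
  have hJ : Ring.jacobson R = ⊥ := by
    by_contra hne
    obtain ⟨a, ha, ha0⟩ := Submodule.exists_mem_ne_zero_of_ne_bot hne
    obtain ⟨n, hn⟩ := IsSemiprimaryRing.isNilpotent (R := R)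
    -- Primeness yields a nonzero product `a * x * b` in the next power, against nilpotency of the
    -- radical.
    have hpow : ∀ k : ℕ, ∃ b ∈ (Ring.jacobson R) ^ k, b ≠ 0 := by
      intro k
      induction k with
      | zero => exact ⟨1, by rw [Submodule.pow_zero, Ideal.one_eq_top]; trivial, one_ne_zero⟩
      | succ k ih =>
        obtain ⟨b, hb, hb0⟩ := ih
        by_contra! hcon
        rcases h a b fun x => hcon _ (by
          rw [Ideal.IsTwoSided.pow_succ]
          exact Ideal.mul_mem_mul (Ideal.mul_mem_right x _ ha) hb) with h' | h'
        · exact ha0 h'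
        · exact hb0 h'
    obtain ⟨b, hb, hb0⟩ := hpow n
    rw [hn] at hb
    exact hb0 (by simpa using hb)
  have hss : IsSemisimpleRing R := IsArtinianRing.isSemisimpleRing_iff_jacobson.2 hJ
  refine IsSimpleRing.of_eq_bot_or_eq_top fun I => ?_
  by_cases hI : I = ⊥
  · exact Or.inl hI
  right
  obtain ⟨a, haI, ha0⟩ : ∃ a ∈ I, a ≠ 0 := by
    by_contra! hcon
    apply hI
    ext x
    rw [TwoSidedIdeal.mem_bot]
    exact ⟨hcon x, fun hx => hx ▸ I.zero_mem⟩
  -- Semisimplicity gives a left ideal complementing `I`. Since `a * R * J` lies in the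
  -- intersection, primeness forces `J = 0`.
  obtain ⟨J, hJ'⟩ := exists_isCompl (TwoSidedIdeal.asIdeal I)
  have hJb : J = ⊥ := by
    rw [eq_bot_iff]
    intro b hb
    have h0 : ∀ x, a * x * b = 0 := fun x => by
      have h1 : a * x * b ∈ TwoSidedIdeal.asIdeal I ⊓ J :=
        ⟨TwoSidedIdeal.mem_asIdeal.2 (I.mul_mem_right _ _ (I.mul_mem_right _ _ haI)),
          J.mul_mem_left _ hb⟩
      rw [hJ'.inf_eq_bot] at h1
      simpa using h1
    exact (h a b h0).resolve_left ha0
  have h1 : (1 : R) ∈ TwoSidedIdeal.asIdeal I := by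
    have := hJ'.sup_eq_top
    rw [hJb, sup_bot_eq] at this
    rw [this]
    trivial
  rw [TwoSidedIdeal.mem_asIdeal] at h1
  rw [eq_top_iff]
  intro x _
  simpa using I.mul_mem_left x 1 h1

/-- A simple algebra of finite dimension over a finite field, with no more center than the field,
is a matrix algebra. -/
theorem exists_algEquiv_matrix {E A : Type u} [Field E] [Finite E] [Ring A] [Algebra E A]
    [Module.Finite E A] [IsSimpleRing A]
    (hc : ∀ a : A, (∀ b, a * b = b * a) → ∃ c : E, a = algebraMap E A c) :
    ∃ (s : ℕ) (_ : NeZero s), Nonempty (A ≃ₐ[E] Matrix (Fin s) (Fin s) E) := by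
  have : IsArtinianRing A := IsArtinianRing.of_finite E A
  obtain ⟨s, hs, D, _, _, _, ⟨f⟩⟩ := IsSimpleRing.exists_algEquiv_matrix_divisionRing_finite E A
  have hfin : Finite D := Module.finite_of_finite E
  have hcomm : ∀ x y : D, x * y = y * x := fun x y => (littleWedderburn D).mul_comm x y
  -- By Wedderburn `D` is commutative, so its scalar matrices are central and thus come from `E`.
  have hbij : Function.Bijective (Algebra.ofId E D) := by
    refine ⟨(algebraMap E D).injective, fun d => ?_⟩
    obtain ⟨c, hc⟩ := hc (f.symm (Matrix.scalar (Fin s) d)) fun b => by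
      apply f.injective
      rw [map_mul, map_mul, f.apply_symm_apply]
      exact Matrix.scalar_commute d (hcomm d) _
    refine ⟨c, ?_⟩
    have h1 := congrArg f hc
    rw [f.apply_symm_apply, AlgEquiv.commutes] at h1
    have h2 := congrFun (congrFun h1 0) 0
    simpa [Matrix.algebraMap_matrix_apply] using h2.symm
  exact ⟨s, hs, ⟨f.trans (AlgEquiv.ofBijective (Algebra.ofId E D) hbij).symm.mapMatrix⟩⟩

end SimpleRings

/-! ### Commuting factors of homogeneous algebras. -/

section Homogeneous

variable {E V : Type u} [Field E] [AddCommGroup V] [Module E V]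

/-- An algebra of endomorphisms of `V` is homogeneous if no nonzero element of it vanishes on a
nonzero invariant subspace. -/
def IsHomogeneousAlg (𝓝 : Subalgebra E (Module.End E V)) : Prop :=
  ∀ U : Submodule E V, (∀ a ∈ 𝓝, ∀ u ∈ U, a u ∈ U) → U ≠ ⊥ →
    ∀ a ∈ 𝓝, (∀ u ∈ U, a u = 0) → a = 0

/-- Primeness of `A` is enough. If `a A b = 0` then `a` kills `U = A b V`, which is stable under `A`
and also under `C`, because `C` commutes with `A`. Hence `U` is `𝓝`-invariant, and homogeneity gives
`b = 0` or `a = 0`. -/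
theorem IsHomogeneousAlg.isSimpleRing [Module.Finite E V] [Nontrivial V]
    {𝓝 A C : Subalgebra E (Module.End E V)}
    (h : IsHomogeneousAlg 𝓝) (hA : A ≤ 𝓝) (hsup : 𝓝 ≤ A ⊔ C)
    (hcomm : ∀ a ∈ A, ∀ c ∈ C, a * c = c * a) : IsSimpleRing A := by
  have : IsArtinianRing A := IsArtinianRing.of_finite E A
  refine isSimpleRing_of_prime fun a b hab => ?_
  by_cases hb : b = 0
  · exact Or.inr hb
  left
  let U : Submodule E V := Submodule.span E {w | ∃ x ∈ A, ∃ v, w = x (b.1 v)}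
  let St : Subalgebra E (Module.End E V) :=
    { carrier := {a | ∀ u ∈ U, a u ∈ U}
      mul_mem' := fun {x y} hx hy u hu => hx _ (hy u hu)
      add_mem' := fun {x y} hx hy u hu => U.add_mem (hx u hu) (hy u hu)
      algebraMap_mem' := fun c u hu => U.smul_mem c hu }
  have hASt : A ≤ St := by
    intro y hy u hu
    induction hu using Submodule.span_induction with
    | mem w hw =>
      obtain ⟨x, hx, v, rfl⟩ := hw
      exact Submodule.subset_span ⟨y * x, mul_mem hy hx, v, rfl⟩
    | zero => simp
    | add u w _ _ hu hw => rw [map_add]; exact U.add_mem hu hw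
    | smul c u _ hu => rw [map_smul]; exact U.smul_mem c hu
  have hCSt : C ≤ St := by
    intro y hy u hu
    induction hu using Submodule.span_induction with
    | mem w hw =>
      obtain ⟨x, hx, v, rfl⟩ := hw
      refine Submodule.subset_span ⟨x, hx, y v, ?_⟩
      have h1 := LinearMap.congr_fun (hcomm (x * b.1) (mul_mem hx b.2) y hy) v
      simpa using h1.symm
    | zero => simp
    | add u w _ _ hu hw => rw [map_add]; exact U.add_mem hu hw
    | smul c u _ hu => rw [map_smul]; exact U.smul_mem c hu
  apply Subtype.ext
  refine h U (fun x hx => (hsup.trans (sup_le hASt hCSt)) hx) ?_ a.1 (hA a.2) ?_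
  · intro hU
    apply hb
    apply Subtype.ext
    ext v
    have : b.1 v ∈ U := Submodule.subset_span ⟨1, one_mem _, v, rfl⟩
    rw [hU] at this
    simpa using this
  · intro u hu
    induction hu using Submodule.span_induction with
    | mem w hw =>
      obtain ⟨x, hx, v, rfl⟩ := hw
      have h1 := congrArg Subtype.val (hab ⟨x, hx⟩)
      exact LinearMap.congr_fun h1 v
    | zero => simp
    | add u w _ _ hu hw => rw [map_add, hu, hw, add_zero]
    | smul c u _ hu => rw [map_smul, hu, smul_zero]

/-- A central element of `A` commutes with `A` and `C`, hence with `𝓝`, so it is a scalar;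
Wedderburn's structure theorem then applies to the simple algebra `A`. -/
theorem IsHomogeneousAlg.exists_algEquiv_matrix [Finite E] [Module.Finite E V] [Nontrivial V]
    {𝓝 A C : Subalgebra E (Module.End E V)}
    (h : IsHomogeneousAlg 𝓝) (hA : A ≤ 𝓝) (hsup : 𝓝 ≤ A ⊔ C)
    (hcomm : ∀ a ∈ A, ∀ c ∈ C, a * c = c * a)
    (hcent : ∀ a ∈ 𝓝, (∀ b ∈ 𝓝, a * b = b * a) → ∃ c : E, a = algebraMap E _ c) :
    ∃ (s : ℕ) (_ : NeZero s), Nonempty (A ≃ₐ[E] Matrix (Fin s) (Fin s) E) := by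
  have := h.isSimpleRing hA hsup hcomm
  refine LinearGroups.exists_algEquiv_matrix fun a ha => ?_
  obtain ⟨c, hc⟩ := hcent a (hA a.2) fun b hb => by
    have h1 : A ⊔ C ≤ Subalgebra.centralizer E {a.1} := by
      refine sup_le (fun x hx => ?_) fun x hx => ?_
      · rw [Subalgebra.mem_centralizer_iff]
        rintro _ rfl
        exact congrArg Subtype.val (ha ⟨x, hx⟩)
      · rw [Subalgebra.mem_centralizer_iff]
        rintro _ rfl
        exact hcomm a a.2 x hx
    exact Subalgebra.mem_centralizer_iff E |>.1 (h1 (hsup hb)) a.1 rfl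
  exact ⟨c, Subtype.ext hc⟩

end Homogeneous

/-! ### Divisibility of the dimension by degrees of commuting matrix algebras. -/

section Dimension

variable {E : Type u} [Field E]

/-- The restriction of a representation of an algebra to an invariant subspace. -/
def restrictAlgHom {V B : Type*} [AddCommGroup V] [Module E V] [Ring B] [Algebra E B]
    (h : B →ₐ[E] Module.End E V) (W : Submodule E V) (hW : ∀ b, ∀ w ∈ W, h b w ∈ W) :
    B →ₐ[E] Module.End E W :=
  AlgHom.ofLinearMap
    { toFun := fun b => (h b).restrict (hW b)
      map_add' := fun a b => by ext; simp
      map_smul' := fun a b => by ext; simp }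
    (by ext; simp) (fun a b => by ext; simp)

/-- The diagonal matrix units split `V` into `f` summands, and the units `E_{i0}`, `E_{0i}` identify
each of them with the image of `E_{00}`. -/
theorem finrank_eq_mul_of_matrix_algHom {V : Type*} [AddCommGroup V] [Module E V]
    [Module.Finite E V] {f : ℕ} [NeZero f]
    (h : Matrix (Fin f) (Fin f) E →ₐ[E] Module.End E V) :
    Module.finrank E V = f * Module.finrank E (LinearMap.range (h (Matrix.single 0 0 1))) := by
  have hmul : ∀ i j k : Fin f, ∀ v, h (Matrix.single i j 1) (h (Matrix.single j k 1) v) =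
      h (Matrix.single i k 1) v := fun i j k v => by
    rw [← Module.End.mul_apply, ← map_mul, Matrix.single_mul_single_same, one_mul]
  have hmul0 : ∀ i j k l : Fin f, j ≠ k → ∀ v,
      h (Matrix.single i j 1) (h (Matrix.single k l 1) v) = 0 := fun i j k l hjk v => by
    rw [← Module.End.mul_apply, ← map_mul, Matrix.single_mul_single_of_ne _ _ _ _ hjk]
    simp
  let e : V ≃ₗ[E] (Fin f → LinearMap.range (h (Matrix.single 0 0 1))) :=
    { toFun := fun v i => ⟨h (Matrix.single 0 i 1) v, h (Matrix.single 0 i 1) v, hmul 0 0 i v⟩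
      map_add' := fun v w => by ext; simp
      map_smul' := fun c w => by ext; simp
      invFun := fun w => ∑ i, h (Matrix.single i 0 1) (w i)
      left_inv := fun v => by
        simp only [hmul]
        rw [← LinearMap.sum_apply, ← map_sum, Matrix.sum_single_one, map_one,
          Module.End.one_apply]
      right_inv := fun w => by
        ext i
        change h (Matrix.single 0 i 1) (∑ i, h (Matrix.single i 0 1) (w i)) = w i
        rw [map_sum, Finset.sum_eq_single i]
        · rw [hmul]
          obtain ⟨v, hv⟩ := (w i).2
          rw [← hv, hmul]
        · intro j _ hj
          exact hmul0 _ _ _ _ hj.symm _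
        · simp }
  rw [e.finrank_eq, Module.finrank_pi_fintype]
  simp

/-- Induction peels off one algebra: the image of its idempotent `E_{00}` has dimension divided by
`f i` and is stable under the remaining algebras, which commute with it. -/
theorem prod_dvd_finrank {ι : Type*} [DecidableEq ι] (s : Finset ι) (f : ι → ℕ)
    [∀ i, NeZero (f i)] :
    ∀ (V : Type u) [AddCommGroup V] [Module E V] [Module.Finite E V]
    (h : ∀ i ∈ s, Matrix (Fin (f i)) (Fin (f i)) E →ₐ[E] Module.End E V)
    (_ : ∀ i j (hi : i ∈ s) (hj : j ∈ s), i ≠ j → ∀ a b, h i hi a * h j hj b = h j hj b * h i hi a),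
    ∏ i ∈ s, f i ∣ Module.finrank E V := by
  induction s using Finset.induction_on with
  | empty => intros; simp
  | insert i s his ih =>
    intro V _ _ _ h hc
    have hi := Finset.mem_insert_self i s
    have hmem : ∀ {j}, j ∈ s → j ∈ insert i s := Finset.mem_insert_of_mem
    rw [Finset.prod_insert his, finrank_eq_mul_of_matrix_algHom (h i hi)]
    refine mul_dvd_mul_left _ ?_
    refine ih _ (fun j hj => restrictAlgHom (h j (hmem hj)) _ ?_) ?_
    · rintro b _ ⟨v, rfl⟩
      refine ⟨h j (hmem hj) b v, ?_⟩
      exact LinearMap.congr_fun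
        (hc i j hi (hmem hj) (by rintro rfl; exact his hj) (Matrix.single 0 0 1) b) v
    · intro j k hj hk hjk a b
      ext v
      exact LinearMap.congr_fun (hc j k (hmem hj) (hmem hk) hjk a b) v

end Dimension

end LinearGroups

namespace LinearGroups

/-! ### Symplectic bases for alternating forms. -/

section SymplecticBasis

variable {k W : Type*} [Field k] [AddCommGroup W] [Module k W]

/-- Split off a hyperbolic plane and pass to its orthogonal complement in `U`, which is again
nondegenerate. Working with subspaces of a fixed `W` keeps the form unchanged in the induction. -/
theorem exists_hyperbolic_family (β : W →ₗ[k] W →ₗ[k] k) (halt : ∀ x, β x x = 0)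
    [Module.Finite k W] :
    ∀ (n : ℕ) (U : Submodule k W), Module.finrank k U = n →
      (∀ x ∈ U, (∀ y ∈ U, β x y = 0) → x = 0) →
      ∃ (m : ℕ) (b : Fin m ⊕ Fin m → W), (∀ i j, β (b i) (b j) = Matrix.J (Fin m) k i j) ∧ (∀ i, b i ∈ U) ∧
        U ≤ Submodule.span k (Set.range b) := by
  have hskew : ∀ x y, β x y = - β y x := fun x y => by
    have := halt (x + y)
    simp only [map_add, LinearMap.add_apply, halt, zero_add, add_zero] at this
    exact eq_neg_of_add_eq_zero_right this
  intro n
  induction n using Nat.strong_induction_on with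
  | _ n ih =>
  intro U hU hnd
  by_cases hUb : U = ⊥
  · refine ⟨0, fun _ => 0, fun i => ?_, by simp, by simp [hUb]⟩
    rcases i with i | i <;> exact i.elim0
  obtain ⟨f, hfU, hf0⟩ := Submodule.exists_mem_ne_zero_of_ne_bot hUb
  obtain ⟨e', heU', he'⟩ : ∃ y ∈ U, β f y ≠ 0 := by
    by_contra! hcon
    exact hf0 (hnd f hfU hcon)
  -- Normalized so that `β e f = -1`, the sign of the upper right block of `Matrix.J`.
  set e := (β f e')⁻¹ • e' with he
  have heU : e ∈ U := U.smul_mem _ heU'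
  have hfe : β f e = 1 := by rw [he, map_smul, smul_eq_mul, inv_mul_cancel₀ he']
  have hef : β e f = -1 := by rw [hskew, hfe]
  set U' : Submodule k W := U ⊓ LinearMap.ker (β e) ⊓ LinearMap.ker (β f) with hU'
  have hlt : Module.finrank k U' < n := by
    rw [← hU]
    refine Submodule.finrank_lt_finrank_of_lt (lt_of_le_of_ne (inf_le_left.trans inf_le_left) ?_)
    intro heq
    rw [← heq] at heU
    have h1 : β f e = 0 := heU.2
    rw [hfe] at h1
    exact one_ne_zero h1
  have hdec : ∀ x ∈ U, x - β f x • e + β e x • f ∈ U' := by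
    intro x hx
    refine ⟨⟨U.add_mem (U.sub_mem hx (U.smul_mem _ heU)) (U.smul_mem _ hfU), ?_⟩, ?_⟩
    · change _ = _
      simp [halt, hef]
    · change _ = _
      simp [halt, hfe]
  obtain ⟨m, b, hb, hbU, hspan⟩ := ih _ hlt U' rfl fun x hx hx0 => by
    refine hnd x hx.1.1 fun y hy => ?_
    have h1 := hx0 _ (hdec y hy)
    have h2 : β x e = 0 := by rw [hskew, show β e x = 0 from hx.1.2, neg_zero]
    have h3 : β x f = 0 := by rw [hskew, show β f x = 0 from hx.2, neg_zero]
    simpa [h2, h3] using h1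
  have heb : ∀ i, β e (b i) = 0 := fun i => (hbU i).1.2
  have hfb : ∀ i, β f (b i) = 0 := fun i => (hbU i).2
  have hbe : ∀ i, β (b i) e = 0 := fun i => by rw [hskew, heb, neg_zero]
  have hbf : ∀ i, β (b i) f = 0 := fun i => by rw [hskew, hfb, neg_zero]
  refine ⟨m + 1, Sum.elim (Fin.cons e fun i => b (Sum.inl i)) (Fin.cons f fun i => b (Sum.inr i)),
    ?_, ?_, ?_⟩
  · have h1 : ∀ a : Fin m, (0 : Fin (m + 1)) ≠ a.succ := fun a => (Fin.succ_ne_zero a).symm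
    rintro (i | i) (j | j) <;> refine Fin.cases ?_ (fun i => ?_) i <;>
      refine Fin.cases ?_ (fun j => ?_) j <;>
      simp [halt, hfe, hef, heb, hfb, hbe, hbf, hb, Matrix.J, Matrix.one_apply, h1]
  · rintro (i | i) <;> refine Fin.cases ?_ (fun i => ?_) i
    · exact heU
    · exact (hbU _).1.1
    · exact hfU
    · exact (hbU _).1.1
  · intro x hx
    set S := Submodule.span k (Set.range (Sum.elim (Fin.cons e fun i => b (Sum.inl i))
      (Fin.cons f fun i => b (Sum.inr i)) : Fin (m + 1) ⊕ Fin (m + 1) → W)) with hS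
    have he1 : e ∈ S := Submodule.subset_span ⟨Sum.inl 0, rfl⟩
    have hf1 : f ∈ S := Submodule.subset_span ⟨Sum.inr 0, rfl⟩
    have hb1 : Submodule.span k (Set.range b) ≤ S := by
      rw [Submodule.span_le]
      rintro _ ⟨i | i, rfl⟩
      · exact Submodule.subset_span ⟨Sum.inl i.succ, rfl⟩
      · exact Submodule.subset_span ⟨Sum.inr i.succ, rfl⟩
    have h2 := hb1 (hspan (hdec x hx))
    have h3 := S.add_mem (S.sub_mem h2 (S.smul_mem (β e x) hf1)) (S.smul_mem (β f x) he1)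
    convert h3 using 1
    abel

/-- A space with a nondegenerate alternating form has a symplectic basis. -/
theorem exists_symplectic_basis [Module.Finite k W] (β : W →ₗ[k] W →ₗ[k] k)
    (halt : ∀ x, β x x = 0) (hnd : ∀ x, (∀ y, β x y = 0) → x = 0) :
    ∃ (m : ℕ) (b : Module.Basis (Fin m ⊕ Fin m) k W),
      ∀ i j, β (b i) (b j) = Matrix.J (Fin m) k i j := by
  obtain ⟨m, b, hb, -, hspan⟩ := exists_hyperbolic_family β halt _ ⊤ rfl fun x _ h =>
    hnd x fun y => h y trivial
  have hli : LinearIndependent k b := by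
    rw [Fintype.linearIndependent_iff]
    intro c hc
    -- Pairing a linear relation with each basis vector gives `J c = 0`, and `J` is invertible as
    -- `J² = -1`.
    have h1 : Matrix.J (Fin m) k *ᵥ c = 0 := by
      ext i
      have := congrArg (β (b i)) hc
      simpa [Matrix.mulVec, dotProduct, hb, mul_comm] using this
    have h2 : (Matrix.J (Fin m) k * Matrix.J (Fin m) k) *ᵥ c = 0 := by
      rw [← Matrix.mulVec_mulVec, h1, Matrix.mulVec_zero]
    rw [Matrix.J_squared, Matrix.neg_mulVec, Matrix.one_mulVec, neg_eq_zero] at h2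
    exact fun i => congrFun h2 i
  refine ⟨m, Module.Basis.mk hli hspan, fun i j => ?_⟩
  rw [Module.Basis.mk_apply, Module.Basis.mk_apply, hb]

/-- Coordinates on an elementary abelian group which carry a nondegenerate alternating form
to the standard one. -/
theorem exists_symplectic_coordinates {W : Type*} [AddCommGroup W] [Finite W] {r : ℕ}
    [Fact r.Prime] [Module (ZMod r) W] (β : W → W → ZMod r)
    (hl : ∀ x y z, β (x + y) z = β x z + β y z) (hr : ∀ x y z, β x (y + z) = β x y + β x z)
    (halt : ∀ x, β x x = 0) (hnd : ∀ x, (∀ y, β x y = 0) → x = 0) :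
    ∃ (m : ℕ) (e : W ≃ₗ[ZMod r] (Fin m ⊕ Fin m → ZMod r)),
      ∀ x y, β x y = e x ⬝ᵥ (Matrix.J (Fin m) (ZMod r) *ᵥ e y) := by
  have : Module.Finite (ZMod r) W := Module.Finite.of_finite
  let β₂ : W →ₗ[ZMod r] W →ₗ[ZMod r] ZMod r := LinearMap.mk₂ (ZMod r) β hl
    (fun c x y => ZMod.map_smul (AddMonoidHom.mk' (fun x => β x y) fun x z => hl x z y) c x) hr
    (fun c x y => ZMod.map_smul (AddMonoidHom.mk' (β x) (hr x)) c y)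
  have hβ₂ : ∀ x y, β₂ x y = β x y := fun x y => rfl
  obtain ⟨m, b, hb⟩ := exists_symplectic_basis β₂ halt hnd
  refine ⟨m, b.equivFun, fun x y => ?_⟩
  have key : ∀ c d : Fin m ⊕ Fin m → ZMod r, β₂ (∑ i, c i • b i) (∑ i, d i • b i) =
      c ⬝ᵥ (Matrix.J (Fin m) (ZMod r) *ᵥ d) := fun c d => by
    simp only [map_sum, LinearMap.sum_apply, map_smul, LinearMap.smul_apply, hb, smul_eq_mul,
      dotProduct, Matrix.mulVec, Finset.mul_sum]
    rw [Finset.sum_comm]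
    refine Finset.sum_congr rfl fun i _ => Finset.sum_congr rfl fun j _ => by ring
  have := key (b.equivFun x) (b.equivFun y)
  rwa [b.sum_equivFun, b.sum_equivFun, hβ₂] at this

end SymplecticBasis

/-! ### Commutators with central values. -/

section Commutators

open scoped commutatorElement

variable {K : Type*} [Group K]

theorem commutatorElement_mul_left {x x' y : K} (h : ⁅x', y⁆ ∈ Subgroup.center K) :
    ⁅x * x', y⁆ = ⁅x, y⁆ * ⁅x', y⁆ := by
  have h1 := Subgroup.mem_center_iff.1 h
  calc ⁅x * x', y⁆ = x * ⁅x', y⁆ * y * x⁻¹ * y⁻¹ := by simp only [commutatorElement_def]; group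
    _ = ⁅x', y⁆ * ⁅x, y⁆ := by rw [h1 x, commutatorElement_def x y]; group
    _ = _ := (h1 _).symm

theorem commutatorElement_mul_right {x y y' : K} (h : ⁅x, y'⁆ ∈ Subgroup.center K) :
    ⁅x, y * y'⁆ = ⁅x, y⁆ * ⁅x, y'⁆ := by
  have h1 := Subgroup.mem_center_iff.1 h
  calc ⁅x, y * y'⁆ = ⁅x, y⁆ * (y * ⁅x, y'⁆) * y⁻¹ := by simp only [commutatorElement_def]; group
    _ = _ := by rw [h1 y]; group

theorem commutatorElement_eq_one_of_mem_center_left {z y : K} (h : z ∈ Subgroup.center K) :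
    ⁅z, y⁆ = 1 :=
  commutatorElement_eq_one_iff_mul_comm.2 (Subgroup.mem_center_iff.1 h y).symm

theorem commutatorElement_eq_one_of_mem_center_right {x z : K} (h : z ∈ Subgroup.center K) :
    ⁅x, z⁆ = 1 :=
  commutatorElement_eq_one_iff_mul_comm.2 (Subgroup.mem_center_iff.1 h x)

theorem commutatorElement_pow_right {x y : K} (h : ⁅x, y⁆ ∈ Subgroup.center K) (n : ℕ) :
    ⁅x, y ^ n⁆ = ⁅x, y⁆ ^ n := by
  induction n with
  | zero => simp
  | succ n ih => rw [pow_succ, commutatorElement_mul_right h, ih, pow_succ]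

/-- Changing an argument by a central element does not change a commutator. Thus commutators of
lifts are functions on the quotient. -/
theorem commutatorElement_congr {Q : Type*} [Group Q] {p : K →* Q}
    (hp : p.ker = Subgroup.center K) {x x' y y' : K} (hx : p x = p x') (hy : p y = p y') :
    ⁅x, y⁆ = ⁅x', y'⁆ := by
  have hz : ∀ {a b : K}, p a = p b → a⁻¹ * b ∈ Subgroup.center K := fun {a b} h => by
    rw [← hp, MonoidHom.mem_ker, map_mul, map_inv, h, inv_mul_cancel]
  have h1 : x' = x * (x⁻¹ * x') := by group
  have h2 : y' = y * (y⁻¹ * y') := by group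
  have h3 := hz hx
  have h4 := hz hy
  rw [h1, h2, commutatorElement_mul_left, commutatorElement_mul_right,
    commutatorElement_eq_one_of_mem_center_right h4,
    commutatorElement_eq_one_of_mem_center_left h3, mul_one, mul_one]
  · rw [commutatorElement_eq_one_of_mem_center_right h4]; exact one_mem _
  · rw [commutatorElement_eq_one_of_mem_center_left h3]; exact one_mem _

/-- A logarithm on the elements of order dividing `r` of a center that embeds into a field. -/
theorem exists_central_log {E : Type*} [Field E] (χ : Subgroup.center K →* E)
    (hχ : Function.Injective χ) {r : ℕ} (hr : r.Prime) {z₀ : K} (hz₀ : z₀ ∈ Subgroup.center K)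
    (hz₀r : z₀ ^ r = 1) (hz₀1 : z₀ ≠ 1) :
    ∃ L : K → ZMod r,
      (∀ z ∈ Subgroup.center K, ∀ w ∈ Subgroup.center K, z ^ r = 1 → w ^ r = 1 →
        L (z * w) = L z + L w) ∧
      ∀ z ∈ Subgroup.center K, z ^ r = 1 → L z = 0 → z = 1 := by
  have : Fact r.Prime := ⟨hr⟩
  have : NeZero r := ⟨hr.ne_zero⟩
  have hord : orderOf z₀ = r := orderOf_eq_prime hz₀r hz₀1
  have hprim : IsPrimitiveRoot (χ ⟨z₀, hz₀⟩) r := by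
    refine IsPrimitiveRoot.iff_orderOf.2 ?_
    rw [orderOf_injective χ hχ, Subgroup.orderOf_mk, hord]
  -- In a field the `r`-th roots of unity are the powers of one primitive root, here the image of
  -- `z₀`. The logarithm to base `z₀` is therefore defined on all `r`-torsion of the center; its
  -- value `0` elsewhere is arbitrary.
  have hex : ∀ z ∈ Subgroup.center K, z ^ r = 1 → ∃ n : ℕ, z₀ ^ n = z := by
    intro z hz hzr
    obtain ⟨n, -, hn⟩ := hprim.eq_pow_of_pow_eq_one (ξ := χ ⟨z, hz⟩) (by
      rw [← map_pow]
      exact (congrArg χ (Subtype.ext hzr)).trans (map_one χ))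
    rw [← map_pow] at hn
    exact ⟨n, congrArg Subtype.val (hχ hn)⟩
  classical
  let L : K → ZMod r := fun z => if h : ∃ n : ℕ, z₀ ^ n = z then (h.choose : ZMod r) else 0
  have hL : ∀ n : ℕ, L (z₀ ^ n) = n := by
    intro n
    have h : ∃ k : ℕ, z₀ ^ k = z₀ ^ n := ⟨n, rfl⟩
    simp only [L, dif_pos h]
    have h1 := pow_eq_pow_iff_modEq.1 h.choose_spec
    rw [hord] at h1
    exact (ZMod.natCast_eq_natCast_iff _ _ _).2 h1
  refine ⟨L, ?_, ?_⟩
  · intro z hz w hw hzr hwr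
    obtain ⟨a, rfl⟩ := hex z hz hzr
    obtain ⟨b, rfl⟩ := hex w hw hwr
    rw [← pow_add, hL, hL, hL, Nat.cast_add]
  · intro z hz hzr h0
    obtain ⟨a, rfl⟩ := hex z hz hzr
    rw [hL, ZMod.natCast_eq_zero_iff] at h0
    rwa [← orderOf_dvd_iff_pow_eq_one, hord]

end Commutators

/-! ### Complete reducibility from minimal invariant subgroups. -/

section CompletelyReducible

theorem isSemisimpleModule_asModule {k G W : Type*} [Field k] [Group G] [AddCommGroup W]
    [Module k W] (ρ : Representation k G W)
    (h : ∀ U : Subrepresentation ρ, (∀ σ : Subrepresentation ρ, IsAtom σ → σ ≤ U) → U = ⊤) :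
    IsSemisimpleModule (MonoidAlgebra k G) ρ.asModule := by
  apply IsSemisimpleModule.of_sSup_simples_eq_top
  set P := sSup {m : Submodule (MonoidAlgebra k G) ρ.asModule |
    IsSimpleModule (MonoidAlgebra k G) m}
  let e := Subrepresentation.subrepresentationSubmoduleOrderIso (ρ := ρ)
  have h1 : e.symm P = ⊤ := by
    refine h _ fun σ hσ => ?_
    rw [← e.le_symm_apply.symm]
    refine le_sSup ?_
    rw [Set.mem_ofPred_eq, isSimpleModule_iff_isAtom]
    exact (e.isAtom_iff σ).2 hσ
  have h2 := congrArg e h1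
  rw [e.apply_symm_apply] at h2
  rw [h2]
  exact map_top e

/-- Over the prime field, additive subgroups are subspaces. By `h₁` and `h₂`, matrices in `S` and
conjugations by `H` have the same invariant subgroups of `A`, so minimal `H`-invariant subgroups
become irreducible submodules, and these generate because `A` is generated by the former. -/
theorem isCompletelyReducible_of_le_sSup {Q W : Type*} [Group Q] [AddCommGroup W] {r m : ℕ}
    [Fact r.Prime] {A H : Subgroup Q} (hA : A ≤ sSup {T | T ≤ A ∧ IsMinInv H T})
    (ω : W → Q) (hω : ∀ x y, ω (x + y) = ω x * ω y) (hωi : Function.Injective ω)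
    (hωA : ∀ q, q ∈ A ↔ ∃ w, ω w = q)
    (e : W ≃+ (Fin m ⊕ Fin m → ZMod r)) (S : Subgroup (Matrix.symplecticGroup (Fin m) (ZMod r)))
    (h₁ : ∀ s ∈ S, ∃ h ∈ H, ∀ w w', ω w' = h * ω w * h⁻¹ → e w' = s.1 *ᵥ e w)
    (h₂ : ∀ h ∈ H, ∃ s ∈ S, ∀ w w', ω w' = h * ω w * h⁻¹ → e w' = s.1 *ᵥ e w) :
    IsCompletelyReducible S := by
  have hω0 : ω 0 = 1 := by simpa using hω 0 0
  have hωn : ∀ x, ω (-x) = (ω x)⁻¹ := fun x => by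
    rw [eq_inv_iff_mul_eq_one, ← hω, neg_add_cancel, hω0]
  let ρ := natRep ((Matrix.symplecticGroup (Fin m) (ZMod r)).subtype.comp S.subtype)
  refine isSemisimpleModule_asModule ρ fun U hU => ?_
  have hρa : ∀ (s : S) v, ρ s v = s.1.1 *ᵥ v := fun s v => rfl
  -- the subgroup of `Q` attached to a subrepresentation
  let Γ : Subrepresentation ρ → Subgroup Q := fun σ =>
    { carrier := {q | ∃ w, ω w = q ∧ e w ∈ σ.toSubmodule}
      one_mem' := ⟨0, hω0, by rw [map_zero]; exact zero_mem _⟩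
      mul_mem' := by
        rintro _ _ ⟨x, rfl, hx⟩ ⟨y, rfl, hy⟩
        exact ⟨x + y, hω x y, by rw [map_add]; exact add_mem hx hy⟩
      inv_mem' := by
        rintro _ ⟨x, rfl, hx⟩
        exact ⟨-x, hωn x, by rw [map_neg]; exact neg_mem hx⟩ }
  have hΓ : ∀ σ w, ω w ∈ Γ σ ↔ e w ∈ σ.toSubmodule := fun σ w =>
    ⟨fun ⟨w', h, h'⟩ => hωi h ▸ h', fun h => ⟨w, rfl, h⟩⟩
  have hAU : A ≤ Γ U := by
    refine hA.trans (sSup_le ?_)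
    rintro T ⟨hTA, hT⟩
    let B : AddSubgroup (Fin m ⊕ Fin m → ZMod r) :=
      { carrier := {v | ω (e.symm v) ∈ T}
        zero_mem' := by
          rw [Set.mem_ofPred_eq, map_zero, hω0]; exact one_mem _
        add_mem' := fun {x y} hx hy => by
          rw [Set.mem_ofPred_eq, map_add, hω]; exact mul_mem hx hy
        neg_mem' := fun {x} hx => by
          rw [Set.mem_ofPred_eq, map_neg, hωn]; exact inv_mem hx }
    have hB : ∀ v, v ∈ B ↔ ω (e.symm v) ∈ T := fun v => Iff.rfl
    let σ : Subrepresentation ρ := ⟨AddSubgroup.toZModSubmodule r B, by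
      intro s v hv
      rw [AddSubgroup.mem_toZModSubmodule, hB] at hv ⊢
      obtain ⟨h, hh, hs⟩ := h₁ s.1 s.2
      have hc := hT.inv h hh _ hv
      obtain ⟨w', hw'⟩ := (hωA _).1 (hTA hc)
      have h3 := hs _ _ hw'
      rw [e.apply_symm_apply] at h3
      rw [hρa, ← h3, e.symm_apply_apply, hw']
      exact hc⟩
    have hσ : ∀ v, v ∈ σ.toSubmodule ↔ ω (e.symm v) ∈ T := fun v => Iff.rfl
    have hΓσ : Γ σ = T := by
      ext q
      constructor
      · rintro ⟨w, rfl, hw⟩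
        rwa [hσ, e.symm_apply_apply] at hw
      · intro hq
        obtain ⟨w, rfl⟩ := (hωA q).1 (hTA hq)
        rw [hΓ, hσ, e.symm_apply_apply]
        exact hq
    have hatom : IsAtom σ := by
      refine ⟨?_, fun τ hτ => ?_⟩
      · intro hb
        apply hT.ne_bot
        rw [← hΓσ, hb, eq_bot_iff]
        rintro _ ⟨w, rfl, hw⟩
        have hw0 : e w = 0 := hw
        rw [Subgroup.mem_bot, (map_eq_zero_iff e e.injective).1 hw0, hω0]
      · by_contra hb
        have hΓτ : Γ τ = T := by
          refine hT.eq_of_le _ ?_ ?_ ?_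
          · rw [← hΓσ]
            rintro _ ⟨w, rfl, hw⟩
            exact ⟨w, rfl, hτ.le hw⟩
          · rintro h hh _ ⟨w, rfl, hw⟩
            have hwA : ω w ∈ T := by
              rw [← hΓσ]; exact ⟨w, rfl, hτ.le hw⟩
            obtain ⟨w', hw'⟩ := (hωA _).1 (hTA (hT.inv h hh _ hwA))
            obtain ⟨s, hs, hsw⟩ := h₂ h hh
            rw [← hw', hΓ, hsw _ _ hw']
            exact τ.apply_mem_toSubmodule ⟨s, hs⟩ hw
          · intro hbot
            apply hb
            rw [eq_bot_iff]
            intro v hv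
            have : ω (e.symm v) ∈ Γ τ := by
              rw [hΓ, e.apply_symm_apply]; exact hv
            rw [hbot, Subgroup.mem_bot, ← hω0] at this
            have h0 := hωi this
            rw [map_eq_zero_iff e.symm e.symm.injective] at h0
            rw [h0]
            exact zero_mem (⊥ : Submodule (ZMod r) (Fin m ⊕ Fin m → ZMod r))
        refine hτ.not_ge fun v hv => ?_
        have : ω (e.symm v) ∈ Γ τ := by rw [hΓτ]; exact hv
        rw [hΓ, e.apply_symm_apply] at this
        exact this
    rw [← hΓσ]
    rintro _ ⟨w, rfl, hw⟩
    exact ⟨w, rfl, hU σ hatom hw⟩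
  rw [eq_top_iff]
  intro v _
  have h1 := hAU ((hωA _).2 ⟨e.symm v, rfl⟩)
  rw [hΓ, e.apply_symm_apply] at h1
  exact h1

end CompletelyReducible
end LinearGroups

namespace LinearGroups

/-! ### The symplectic action on an elementary abelian section. -/

section SymplecticShape

open scoped commutatorElement

theorem matrix_eq_of_dotProduct_mulVec {ι R : Type*} [Fintype ι] [DecidableEq ι] [CommRing R]
    {A B : Matrix ι ι R} (h : ∀ v w, v ⬝ᵥ (A *ᵥ w) = v ⬝ᵥ (B *ᵥ w)) : A = B := by
  ext i j
  simpa using h (Pi.single i 1) (Pi.single j 1)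

theorem matrix_eq_of_mulVec {ι R : Type*} [Fintype ι] [DecidableEq ι] [CommRing R]
    {A B : Matrix ι ι R} (h : ∀ w, A *ᵥ w = B *ᵥ w) : A = B :=
  matrix_eq_of_dotProduct_mulVec fun v w => by rw [h]

variable {K Q H W E : Type*} [Group K] [Group Q] [Group H] [AddCommGroup W] [Finite W]
  [Nontrivial W] [Field E] {r : ℕ} [Fact r.Prime] [Module (ZMod r) W]

/-- The commutator of lifts is an alternating form on `W` with values in the `r`-torsion of the
center, identified with `ℤ/r` by a logarithm. It is nondegenerate by `hnd`, and conjugation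
preserves it because its values are central. So `H`, the quotient of `K` by the centralizer of the
preimage of `A`, maps to the symplectic group; the kernel is a copy of `A`, since every functional
is given by a commutator. -/
theorem exists_isSymplecticShape_of_coordinates (p : K →* Q) (hp : p.ker = Subgroup.center K)
    (χ : Subgroup.center K →* E) (hχ : Function.Injective χ)
    (A : Subgroup Q) (hAp : A ≤ p.range) (hAi : ConjInvariant p.range A)
    (hAs : A ≤ sSup {T | T ≤ A ∧ IsMinInv p.range T})
    (ω : W → Q) (hω : ∀ x y, ω (x + y) = ω x * ω y) (hωi : Function.Injective ω)
    (hωA : ∀ q, q ∈ A ↔ ∃ w, ω w = q)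
    (hnd : ∀ x, p x ∈ A → (∀ y, p y ∈ A → x * y = y * x) → x ∈ Subgroup.center K)
    (θ : K →* H) (hθ : Function.Surjective θ)
    (hker : ∀ k, θ k = 1 ↔ ∀ y, p y ∈ A → k * y = y * k) :
    ∃ m, IsSymplecticShape E H r m ∧ Nat.card W = r ^ (2 * m) := by
  have hr : r.Prime := Fact.out
  have hω0 : ω 0 = 1 := by simpa using hω 0 0
  have hωn : ∀ (n : ℕ) w, ω (n • w) = ω w ^ n := fun n w => by
    induction n with
    | zero => rw [zero_smul, hω0, pow_zero]
    | succ n ih => rw [succ_nsmul, hω, ih, pow_succ]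
  have hrw : ∀ w : W, r • w = 0 := fun w => by
    rw [← Nat.cast_smul_eq_nsmul (ZMod r), CharP.cast_eq_zero, zero_smul]
  have hωm : ∀ w, ω w ∈ A := fun w => (hωA _).2 ⟨w, rfl⟩
  have hωc : ∀ x y, ω x * ω y = ω y * ω x := fun x y => by rw [← hω, add_comm, hω]
  have hcen : ∀ k, k ∈ Subgroup.center K ↔ p k = 1 := fun k => by rw [← hp, MonoidHom.mem_ker]
  choose ℓ hℓ using fun w => hAp (hωm w)
  have hcomm : ∀ x y, p x * p y = p y * p x → ⁅x, y⁆ ∈ Subgroup.center K := fun x y h => by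
    rw [hcen, map_commutatorElement, commutatorElement_eq_one_iff_mul_comm]
    exact h
  have hℓc : ∀ x y, ⁅ℓ x, ℓ y⁆ ∈ Subgroup.center K := fun x y =>
    hcomm _ _ (by rw [hℓ, hℓ]; exact hωc x y)
  have hpow : ∀ k w, ⁅k, ℓ w⁆ ∈ Subgroup.center K → ⁅k, ℓ w⁆ ^ r = 1 := fun k w h => by
    rw [← commutatorElement_pow_right h]
    refine commutatorElement_eq_one_of_mem_center_right ?_
    rw [hcen, map_pow, hℓ, ← hωn, hrw, hω0]
  have hcentral : ∀ k, (∀ w, ⁅k, ℓ w⁆ = 1) → ∀ y, p y ∈ A → k * y = y * k := fun k h y hy => by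
    obtain ⟨w, hw⟩ := (hωA _).1 hy
    rw [← commutatorElement_eq_one_iff_mul_comm, ← h w]
    exact commutatorElement_congr hp rfl (by rw [hℓ, hw])
  have hnd' : ∀ x, (∀ y, ⁅ℓ x, ℓ y⁆ = 1) → x = 0 := fun x h => by
    have h1 := hnd (ℓ x) (by rw [hℓ]; exact hωm x) (hcentral _ h)
    rw [hcen, hℓ, ← hω0] at h1
    exact hωi h1
  -- This commutator is a central element of order `r`: it is the base of the logarithm and later
  -- shows that `r` divides `|E| - 1`.
  obtain ⟨w₀, w₁, hw₀⟩ : ∃ x y, ⁅ℓ x, ℓ y⁆ ≠ 1 := by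
    obtain ⟨w, hw⟩ := exists_ne (0 : W)
    by_contra! hcon
    exact hw (hnd' w (hcon w))
  obtain ⟨L, hLm, hL0⟩ := exists_central_log χ hχ hr (hℓc w₀ w₁) (hpow _ _ (hℓc w₀ w₁)) hw₀
  have hL1 : L 1 = 0 := by simpa using hLm 1 (one_mem _) 1 (one_mem _) (one_pow r) (one_pow r)
  have hLinj : ∀ z ∈ Subgroup.center K, ∀ w ∈ Subgroup.center K, z ^ r = 1 → w ^ r = 1 →
      L z = L w → z = w := by
    intro z hz w hw hzr hwr h
    have hwi : w⁻¹ ^ r = 1 := by rw [inv_pow, hwr, inv_one]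
    have hcz : z * w⁻¹ = w⁻¹ * z := (Subgroup.mem_center_iff.1 (inv_mem hw) z)
    have h1 := hLm w hw w⁻¹ (inv_mem hw) hwr hwi
    rw [mul_inv_cancel, hL1, ← h, ← hLm z hz _ (inv_mem hw) hzr hwi] at h1
    refine mul_inv_eq_one.1 (hL0 _ (mul_mem hz (inv_mem hw)) ?_ h1.symm)
    rw [Commute.mul_pow hcz, hzr, hwi, one_mul]
  -- the commutator form
  let β : W → W → ZMod r := fun x y => L ⁅ℓ x, ℓ y⁆
  have hβ : ∀ x y a b, p a = ω x → p b = ω y → L ⁅a, b⁆ = β x y := fun x y a b ha hb => by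
    rw [commutatorElement_congr hp (ha.trans (hℓ x).symm) (hb.trans (hℓ y).symm)]
  have hβl : ∀ x y z, β (x + y) z = β x z + β y z := fun x y z => by
    rw [← hβ (x + y) z (ℓ x * ℓ y) (ℓ z) (by rw [map_mul, hℓ, hℓ, hω]) (hℓ z),
      commutatorElement_mul_left (hℓc y z)]
    exact hLm _ (hℓc x z) _ (hℓc y z) (hpow _ _ (hℓc x z)) (hpow _ _ (hℓc y z))
  have hβr : ∀ x y z, β x (y + z) = β x y + β x z := fun x y z => by
    rw [← hβ x (y + z) (ℓ x) (ℓ y * ℓ z) (hℓ x) (by rw [map_mul, hℓ, hℓ, hω]),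
      commutatorElement_mul_right (hℓc x z)]
    exact hLm _ (hℓc x y) _ (hℓc x z) (hpow _ _ (hℓc x y)) (hpow _ _ (hℓc x z))
  have hβa : ∀ x, β x x = 0 := fun x => by
    simp only [β]
    rw [commutatorElement_self, hL1]
  have hβn : ∀ x, (∀ y, β x y = 0) → x = 0 := fun x h => hnd' x fun y =>
    hL0 _ (hℓc x y) (hpow _ _ (hℓc x y)) (h y)
  obtain ⟨m, e, he⟩ := exists_symplectic_coordinates β hβl hβr hβa hβn
  -- The functional with coordinate row `c` is represented by `-c J`, because `J² = -1`.
  have hrep : ∀ f : W →+ ZMod r, ∃ x, ∀ y, f y = β x y := by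
    intro f
    let g : (Fin m ⊕ Fin m → ZMod r) →ₗ[ZMod r] ZMod r := f.toZModLinearMap r ∘ₗ e.symm.toLinearMap
    let c : Fin m ⊕ Fin m → ZMod r := fun i =>
      g fun j => if i = j then 1 else 0
    have hg : ∀ v, g v = c ⬝ᵥ v := fun v => by
      rw [LinearMap.pi_apply_eq_sum_univ g v]
      simp [c, dotProduct, mul_comm]
    refine ⟨e.symm (-(c ᵥ* Matrix.J (Fin m) (ZMod r))), fun y => ?_⟩
    have h1 : f y = g (e y) := by simp [g]
    rw [h1, hg, he, e.apply_symm_apply, Matrix.dotProduct_mulVec, Matrix.neg_vecMul,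
      Matrix.vecMul_vecMul, Matrix.J_squared, Matrix.vecMul_neg, Matrix.vecMul_one, neg_neg]
  have hm : 1 ≤ m := by
    by_contra hm
    obtain rfl : m = 0 := by omega
    obtain ⟨w, hw⟩ := exists_ne (0 : W)
    exact hw (e.injective (Subsingleton.elim _ _))
  have hcard : Nat.card W = r ^ (2 * m) := by
    rw [Nat.card_congr e.toEquiv, Nat.card_fun, Nat.card_zmod, Nat.card_sum, Nat.card_fin, two_mul]
  -- the action
  choose T hT using fun k w => (hωA _).1 (hAi (p k) ⟨k, rfl⟩ (ω w) (hωm w))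
  have hTadd : ∀ k x y, T k (x + y) = T k x + T k y := fun k x y => hωi <| by
    rw [hT, hω, hω, hT, hT]; group
  have hTmul : ∀ k l x, T (k * l) x = T k (T l x) := fun k l x => hωi <| by
    rw [hT, hT, hT, map_mul]; group
  have hTβ : ∀ k x y, β (T k x) (T k y) = β x y := fun k x y => by
    rw [← hβ (T k x) (T k y) (k * ℓ x * k⁻¹) (k * ℓ y * k⁻¹) (by simp [hT, hℓ]) (by simp [hT, hℓ]),
      show ⁅k * ℓ x * k⁻¹, k * ℓ y * k⁻¹⁆ = k * ⁅ℓ x, ℓ y⁆ * k⁻¹ by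
        simp only [commutatorElement_def]; group,
      Subgroup.mem_center_iff.1 (hℓc x y) k, mul_inv_cancel_right]
  let M : K → Matrix (Fin m ⊕ Fin m) (Fin m ⊕ Fin m) (ZMod r) := fun k =>
    LinearMap.toMatrix' (e.toLinearMap ∘ₗ
      (AddMonoidHom.mk' (T k) (hTadd k)).toZModLinearMap r ∘ₗ e.symm.toLinearMap)
  have hM : ∀ k w, M k *ᵥ e w = e (T k w) := fun k w => by
    rw [LinearMap.toMatrix'_mulVec]
    simp
  have hMsp : ∀ k, M k ∈ Matrix.symplecticGroup (Fin m) (ZMod r) := fun k => by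
    rw [SymplecticGroup.mem_iff']
    refine matrix_eq_of_dotProduct_mulVec fun v w => ?_
    obtain ⟨x, rfl⟩ := e.surjective v
    obtain ⟨y, rfl⟩ := e.surjective w
    rw [← he, ← hTβ k, he, ← hM, ← hM, ← Matrix.mulVec_mulVec, ← Matrix.mulVec_mulVec,
      Matrix.dotProduct_mulVec, Matrix.vecMul_transpose]
  let μ : K →* Matrix.symplecticGroup (Fin m) (ZMod r) := MonoidHom.mk' (fun k => ⟨M k, hMsp k⟩)
    fun k l => Subtype.ext <| matrix_eq_of_mulVec fun v => by
      obtain ⟨x, rfl⟩ := e.surjective v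
      change M (k * l) *ᵥ e x = (M k * M l) *ᵥ e x
      rw [← Matrix.mulVec_mulVec, hM, hM, hM, hTmul]
  have hμ : ∀ k, (μ k).1 = M k := fun k => rfl
  have hμ1 : ∀ k, μ k = 1 ↔ ∀ w, T k w = w := fun k => by
    constructor
    · intro h w
      have h1 := hM k w
      rw [← hμ, h] at h1
      exact e.injective (h1.symm.trans (Matrix.one_mulVec _))
    · intro h
      refine Subtype.ext <| matrix_eq_of_mulVec fun v => ?_
      obtain ⟨x, rfl⟩ := e.surjective v
      rw [hμ, hM, h]
      exact (Matrix.one_mulVec _).symm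
  have hθμ : θ.ker ≤ μ.ker := fun k hk => by
    rw [MonoidHom.mem_ker] at hk ⊢
    rw [hμ1]
    intro w
    apply hωi
    rw [hT, ← hℓ, ← map_mul, ← map_inv, ← map_mul,
      (hker k).1 hk (ℓ w) (by rw [hℓ]; exact hωm w), mul_inv_cancel_right]
  let π₀ : H →* Matrix.symplecticGroup (Fin m) (ZMod r) := θ.liftOfSurjective hθ ⟨μ, hθμ⟩
  have hπ₀ : ∀ k, π₀ (θ k) = μ k := fun k =>
    MonoidHom.liftOfRightInverse_comp_apply θ _ _ ⟨μ, hθμ⟩ k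
  -- If `k` acts trivially, `w ↦ ⁅k, ℓ w⁆` is a functional, hence agrees with `⁅ℓ x, ·⁆` for some
  -- `x`. Then `(ℓ x)⁻¹ k` centralizes the preimage of `A`, so `k` and `ℓ x` agree in `H`.
  have hπker : ∀ x : H, x ∈ π₀.rangeRestrict.ker ↔ ∃ k w, θ k = x ∧ p k = ω w := fun x => by
    rw [MonoidHom.ker_rangeRestrict, MonoidHom.mem_ker]
    constructor
    · intro hx
      obtain ⟨k, rfl⟩ := hθ x
      rw [hπ₀, hμ1] at hx
      have hkc : ∀ w, ⁅k, ℓ w⁆ ∈ Subgroup.center K := fun w => hcomm _ _ <| by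
        have := hT k w
        rw [hx, eq_mul_inv_iff_mul_eq] at this
        rw [hℓ, this]
      obtain ⟨x, hx⟩ := hrep (AddMonoidHom.mk' (fun w => L ⁅k, ℓ w⁆) fun y z => by
        rw [commutatorElement_congr hp (rfl : p k = p k)
          (show p (ℓ (y + z)) = p (ℓ y * ℓ z) by rw [map_mul, hℓ, hℓ, hℓ, hω]),
          commutatorElement_mul_right (hkc z)]
        exact hLm _ (hkc y) _ (hkc z) (hpow _ _ (hkc y)) (hpow _ _ (hkc z)))
      refine ⟨ℓ x, x, ?_, hℓ x⟩
      rw [← inv_mul_eq_one, ← map_inv, ← map_mul, hker]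
      refine hcentral _ fun w => ?_
      have h1 : ⁅k, ℓ w⁆ = ⁅ℓ x, ℓ w⁆ := hLinj _ (hkc w) _ (hℓc x w) (hpow _ _ (hkc w))
        (hpow _ _ (hℓc x w)) (hx w)
      simp only [commutatorElement_def, mul_left_inj] at h1
      rw [commutatorElement_eq_one_iff_mul_comm]
      have h2 : k * ℓ w = ℓ x * ℓ w * (ℓ x)⁻¹ * k := by rw [← h1, inv_mul_cancel_right]
      rw [mul_assoc, h2]
      group
    · rintro ⟨k, w, rfl, hk⟩
      rw [hπ₀, hμ1]
      intro x
      apply hωi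
      rw [hT, hk, hωc, mul_inv_cancel_right]
  -- The quotient of `k` and `k'` lies over `A` and centralizes the preimage of `A`, so it is
  -- central by `hnd`. This makes the coordinate on the kernel well defined.
  have huniq : ∀ k k' w w', θ k = θ k' → p k = ω w → p k' = ω w' → w = w' := by
    intro k k' w w' h hk hk'
    apply hωi
    rw [← hk, ← hk', ← inv_mul_eq_one, ← map_inv, ← map_mul, ← hcen]
    rw [← inv_mul_eq_one, ← map_inv, ← map_mul, hker] at h
    refine hnd _ ?_ h
    rw [map_mul, map_inv, hk, hk']
    exact mul_mem (inv_mem (hωm w)) (hωm w')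
  choose κ wt hκ hwt using fun x : π₀.rangeRestrict.ker => (hπker x.1).1 x.2
  have hwt' : ∀ (x : π₀.rangeRestrict.ker) k w, θ k = x.1 → p k = ω w → wt x = w :=
    fun x k w hk hw => huniq (κ x) k _ _ ((hκ x).trans hk.symm) (hwt x) hw
  let ν₀ : Additive π₀.rangeRestrict.ker →+ (Fin m ⊕ Fin m → ZMod r) :=
    AddMonoidHom.mk' (fun x => e (wt x.toMul)) fun x y => by
      rw [← map_add]
      congr 1
      refine hwt' _ (κ x.toMul * κ y.toMul) _ ?_ ?_
      · rw [map_mul, hκ, hκ]; rfl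
      · rw [map_mul, hwt, hwt, hω]
  have hν₀ : Function.Bijective ν₀ := by
    constructor
    · intro x y h
      have h1 : wt x.toMul = wt y.toMul := e.injective h
      have h2 : p (κ x.toMul) = p (κ y.toMul) := by rw [hwt, hwt, h1]
      rw [← inv_mul_eq_one, ← map_inv, ← map_mul, ← hcen] at h2
      have h3 : θ (κ x.toMul) = θ (κ y.toMul) := by
        rw [← inv_mul_eq_one, ← map_inv, ← map_mul, hker]
        exact fun z _ => (Subgroup.mem_center_iff.1 h2 z).symm
      rw [hκ, hκ] at h3
      exact Subtype.ext h3
    · intro v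
      obtain ⟨w, rfl⟩ := e.surjective v
      have hx : θ (ℓ w) ∈ π₀.rangeRestrict.ker := (hπker _).2 ⟨ℓ w, w, rfl, hℓ w⟩
      exact ⟨Additive.ofMul ⟨_, hx⟩, congrArg e (hwt' ⟨_, hx⟩ (ℓ w) w rfl (hℓ w))⟩
  have hdvd : r ∣ Nat.card E - 1 := by
    have hord : orderOf ⁅ℓ w₀, ℓ w₁⁆ = r := orderOf_eq_prime (hpow _ _ (hℓc w₀ w₁)) hw₀
    let z : Subgroup.center K := ⟨_, hℓc w₀ w₁⟩
    have h1 : orderOf (χ.toHomUnits z) = r := by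
      rw [← orderOf_units, MonoidHom.coe_toHomUnits, orderOf_injective χ hχ, Subgroup.orderOf_mk,
        hord]
    rw [← Nat.card_units, ← h1]
    exact orderOf_dvd_natCard _
  refine ⟨m, ⟨hr, hdvd, hm, π₀.rangeRestrict.ker, inferInstance, π₀.range, π₀.rangeRestrict,
    AddEquiv.ofBijective ν₀ hν₀, ?_, π₀.rangeRestrict_surjective, rfl, ?_⟩, hcard⟩
  · have hS : ∀ k w w', ω w' = p k * ω w * (p k)⁻¹ → e w' = (μ k).1 *ᵥ e w := fun k w w' h => by
      rw [← hT] at h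
      rw [hμ, hM, hωi h]
    refine isCompletelyReducible_of_le_sSup hAs ω hω hωi hωA e.toAddEquiv _ ?_ ?_
    · rintro _ ⟨h, rfl⟩
      obtain ⟨k, rfl⟩ := hθ h
      exact ⟨p k, ⟨k, rfl⟩, fun w w' hw => by rw [hπ₀]; exact hS k w w' hw⟩
    · rintro _ ⟨k, rfl⟩
      exact ⟨μ k, ⟨θ k, hπ₀ k⟩, fun w w' hw => hS k w w' hw⟩
  · intro g x
    obtain ⟨k, rfl⟩ := hθ g
    have h1 : ((π₀.rangeRestrict (θ k) : Matrix.symplecticGroup (Fin m) (ZMod r)) :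
        Matrix _ _ (ZMod r)) = M k := by
      rw [MonoidHom.coe_rangeRestrict, hπ₀]; rfl
    rw [h1]
    change e (wt _) = M k *ᵥ e (wt x)
    rw [hM]
    congr 1
    refine hwt' _ (k * κ x * k⁻¹) _ ?_ ?_
    · rw [map_mul, map_mul, map_inv, hκ]; rfl
    · rw [map_mul, map_mul, map_inv, hwt, hT]

theorem exists_isSymplecticShape {K Q H E : Type*} [Group K] [Group Q] [Finite Q] [Group H]
    [Field E] (p : K →* Q) (hp : p.ker = Subgroup.center K)
    (χ : Subgroup.center K →* E) (hχ : Function.Injective χ) {r : ℕ} (hr : r.Prime)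
    (A : Subgroup Q) (hAp : A ≤ p.range) (hAi : ConjInvariant p.range A)
    (hAs : A ≤ sSup {T | T ≤ A ∧ IsMinInv p.range T})
    (hAc : ∀ x ∈ A, ∀ y ∈ A, x * y = y * x) (hAr : ∀ x ∈ A, x ^ r = 1) (hA : A ≠ ⊥)
    (hnd : ∀ x, p x ∈ A → (∀ y, p y ∈ A → x * y = y * x) → x ∈ Subgroup.center K)
    (θ : K →* H) (hθ : Function.Surjective θ)
    (hker : ∀ k, θ k = 1 ↔ ∀ y, p y ∈ A → k * y = y * k) :
    ∃ m, IsSymplecticShape E H r m ∧ Nat.card A = r ^ (2 * m) := by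
  have : Fact r.Prime := ⟨hr⟩
  let _ : CommGroup A :=
    { (inferInstance : Group A) with mul_comm := fun x y => Subtype.ext (hAc x x.2 y y.2) }
  let _ : Module (ZMod r) (Additive A) :=
    AddCommGroup.zmodModule fun w => Subtype.ext (hAr w.toMul w.toMul.2)
  have : Nontrivial A := (Subgroup.nontrivial_iff_ne_bot A).2 hA
  exact exists_isSymplecticShape_of_coordinates (W := Additive A) p hp χ hχ A hAp hAi hAs
    (fun w => (w.toMul : Q)) (fun _ _ => rfl) Subtype.val_injective
    (fun q => ⟨fun h => ⟨Additive.ofMul ⟨q, h⟩, rfl⟩, fun ⟨w, hw⟩ => hw ▸ w.toMul.2⟩) hnd θ hθ hker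

end SymplecticShape
end LinearGroups

namespace LinearGroups

/-! ### Enveloping algebras of subgroups. -/

section AlgSpan

variable {E V : Type u} [Field E] [AddCommGroup V] [Module E V] {K : Type*} [Group K]

/-- The enveloping algebra of a subgroup in a representation. -/
def algSpan (ρ : K →* Module.End E V) (X : Subgroup K) : Subalgebra E (Module.End E V) :=
  Algebra.adjoin E (ρ '' X)

theorem apply_mem_algSpan {ρ : K →* Module.End E V} {X : Subgroup K} {x : K} (hx : x ∈ X) :
    ρ x ∈ algSpan ρ X := Algebra.subset_adjoin ⟨x, hx, rfl⟩

theorem algSpan_le {ρ : K →* Module.End E V} {X : Subgroup K}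
    {S : Subalgebra E (Module.End E V)} : algSpan ρ X ≤ S ↔ ∀ x ∈ X, ρ x ∈ S :=
  Algebra.adjoin_le_iff.trans Set.image_subset_iff

theorem algSpan_mono (ρ : K →* Module.End E V) {X Y : Subgroup K} (h : X ≤ Y) :
    algSpan ρ X ≤ algSpan ρ Y := algSpan_le.2 fun _ hx => apply_mem_algSpan (h hx)

theorem algSpan_sup_le (ρ : K →* Module.End E V) (X Y : Subgroup K) :
    algSpan ρ (X ⊔ Y) ≤ algSpan ρ X ⊔ algSpan ρ Y := by
  -- A subalgebra need not contain inverses, so membership of the inverse is built into the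
  -- subgroup.
  let W : Subgroup K :=
    { carrier := {k | ρ k ∈ algSpan ρ X ⊔ algSpan ρ Y ∧ ρ k⁻¹ ∈ algSpan ρ X ⊔ algSpan ρ Y}
      one_mem' := by simp [one_mem]
      mul_mem' := fun {a b} ha hb => by
        refine ⟨?_, ?_⟩
        · rw [map_mul]; exact mul_mem ha.1 hb.1
        · rw [mul_inv_rev, map_mul]; exact mul_mem hb.2 ha.2
      inv_mem' := fun {a} ha => ⟨ha.2, by rw [inv_inv]; exact ha.1⟩ }
  have hW : X ⊔ Y ≤ W := sup_le
    (fun x hx => ⟨(le_sup_left : algSpan ρ X ≤ _) (apply_mem_algSpan hx),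
      (le_sup_left : algSpan ρ X ≤ _) (apply_mem_algSpan (inv_mem hx))⟩)
    (fun x hx => ⟨(le_sup_right : algSpan ρ Y ≤ _) (apply_mem_algSpan hx),
      (le_sup_right : algSpan ρ Y ≤ _) (apply_mem_algSpan (inv_mem hx))⟩)
  exact algSpan_le.2 fun x hx => (hW hx).1

theorem algSpan_commute_left {ρ : K →* Module.End E V} {X : Subgroup K} {b : Module.End E V}
    (h : ∀ x ∈ X, ρ x * b = b * ρ x) : ∀ a ∈ algSpan ρ X, a * b = b * a := by
  have : algSpan ρ X ≤ Subalgebra.centralizer E {b} := algSpan_le.2 fun x hx => by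
    rw [Subalgebra.mem_centralizer_iff]
    rintro _ rfl
    exact (h x hx).symm
  intro a ha
  exact (Subalgebra.mem_centralizer_iff E |>.1 (this ha) b rfl).symm

theorem algSpan_commute {ρ : K →* Module.End E V} {X Y : Subgroup K}
    (h : ∀ x ∈ X, ∀ y ∈ Y, x * y = y * x) :
    ∀ a ∈ algSpan ρ X, ∀ b ∈ algSpan ρ Y, a * b = b * a := fun a ha b hb =>
  algSpan_commute_left (fun x hx => (algSpan_commute_left (fun y hy => by
    rw [← map_mul, ← map_mul, h x hx y hy]) b hb).symm) a ha

theorem algSpan_toSubmodule (ρ : K →* Module.End E V) (X : Subgroup K) :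
    Subalgebra.toSubmodule (algSpan ρ X) = Submodule.span E (ρ '' X) := by
  have : (ρ '' X : Set (Module.End E V)) = (X.toSubmonoid.map ρ : Submonoid _) := rfl
  rw [algSpan, Algebra.adjoin_eq_span, this, Submonoid.closure_eq]

/-- A faithful representation of a group in which the centralizer of `N` is the center, such that
the enveloping algebra of `N` is homogeneous, with only scalars in its center. -/
structure IsCentralBase (ρ : K →* Module.End E V) (N : Subgroup K) : Prop where
  injective : Function.Injective ρ
  center_le : Subgroup.center K ≤ N
  centralizer_le : ∀ x, (∀ y ∈ N, x * y = y * x) → x ∈ Subgroup.center K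
  homogeneous : IsHomogeneousAlg (algSpan ρ N)
  scalar : ∀ a ∈ algSpan ρ N, (∀ b ∈ algSpan ρ N, a * b = b * a) →
    ∃ c : E, a = algebraMap E (Module.End E V) c

variable {ρ : K →* Module.End E V} {N : Subgroup K}

theorem IsCentralBase.exists_scalar (h : IsCentralBase ρ N) {z : K}
    (hz : z ∈ Subgroup.center K) : ∃ c : E, ρ z = algebraMap E (Module.End E V) c := by
  refine h.scalar _ (apply_mem_algSpan (h.center_le hz)) fun b hb => ?_
  refine (algSpan_commute_left (fun x _ => ?_) b hb).symm
  rw [← map_mul, ← map_mul, Subgroup.mem_center_iff.1 hz x]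

/-- Central elements act as scalars, and faithfulness embeds the center in the multiplicative group
of `E`. -/
theorem IsCentralBase.exists_centralChar [Nontrivial V] (h : IsCentralBase ρ N) :
    ∃ χ : Subgroup.center K →* E, Function.Injective χ ∧
      ∀ z : Subgroup.center K, ρ z = algebraMap E (Module.End E V) (χ z) := by
  choose c hc using fun z : Subgroup.center K => h.exists_scalar z.2
  have hinj : Function.Injective (algebraMap E (Module.End E V)) := FaithfulSMul.algebraMap_injective _ _
  refine ⟨⟨⟨c, ?_⟩, ?_⟩, ?_, hc⟩
  · apply hinj
    rw [← hc, map_one, Subgroup.coe_one, map_one]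
  · intro x y
    apply hinj
    rw [← hc, map_mul, ← hc, ← hc, Subgroup.coe_mul, map_mul]
  · intro x y hxy
    have hxy' : c x = c y := hxy
    apply Subtype.ext
    apply h.injective
    rw [hc, hc, hxy']

theorem IsCentralBase.exists_algEquiv_matrix [Finite E] [Module.Finite E V] [Nontrivial V]
    (h : IsCentralBase ρ N) {X Y : Subgroup K} (hX : X ≤ N) (hXY : N ≤ X ⊔ Y)
    (hcomm : ∀ x ∈ X, ∀ y ∈ Y, x * y = y * x) :
    ∃ (s : ℕ) (_ : NeZero s), Nonempty (algSpan ρ X ≃ₐ[E] Matrix (Fin s) (Fin s) E) :=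
  h.homogeneous.exists_algEquiv_matrix (algSpan_mono ρ hX)
    ((algSpan_mono ρ hXY).trans (algSpan_sup_le ρ X Y)) (algSpan_commute hcomm) h.scalar

open scoped commutatorElement in
/-- The enveloping algebra of a group with a nondegenerate commutator form has the cosets of the
center as a basis. -/
theorem IsCentralBase.finrank_algSpan [Nontrivial V] (h : IsCentralBase ρ N)
    {Q : Type*} [Group Q] [Finite Q] {p : K →* Q} (hp : p.ker = Subgroup.center K) {A : Subgroup Q}
    (hAp : A ≤ p.range) (hAc : ∀ x ∈ A, ∀ y ∈ A, x * y = y * x)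
    (hnd : ∀ x, p x ∈ A → (∀ y, p y ∈ A → x * y = y * x) → x ∈ Subgroup.center K) :
    Module.finrank E (algSpan ρ (A.comap p)) = Nat.card A := by
  obtain ⟨χ, hχ, hρχ⟩ := h.exists_centralChar
  have hcen : ∀ k, k ∈ Subgroup.center K ↔ p k = 1 := fun k => by rw [← hp, MonoidHom.mem_ker]
  choose ℓ hℓ using fun a : A => hAp a.2
  have hcomm : ∀ (y : A.comap p) (a : A), ⁅(y : K), ℓ a⁆ ∈ Subgroup.center K := fun y a => by
    rw [hcen, map_commutatorElement, commutatorElement_eq_one_iff_mul_comm, hℓ]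
    exact hAc _ y.2 _ a.2
  -- Conjugation by `y` multiplies `ρ (ℓ a)` by the scalar `ξ a y`. Nondegeneracy makes these
  -- characters distinct, so the operators are eigenvectors for different characters.
  let ξ : A → (A.comap p →* E) := fun a => χ.comp
    (MonoidHom.mk' (fun y => ⟨⁅(y : K), ℓ a⁆, hcomm y a⟩) fun x y =>
      Subtype.ext (commutatorElement_mul_left (hcomm y a)))
  have hξ : ∀ a y, ξ a y = χ ⟨⁅(y : K), ℓ a⁆, hcomm y a⟩ := fun a y => rfl
  have hconj : ∀ (y : A.comap p) a, ρ y * ρ (ℓ a) * ρ (y : K)⁻¹ = ξ a y • ρ (ℓ a) := fun y a => by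
    rw [hξ, Algebra.smul_def, ← hρχ, ← map_mul, ← map_mul, ← map_mul]
    congr 1
    simp [commutatorElement_def]
  have hξi : Function.Injective ξ := by
    intro a b hab
    have h1 : ∀ y : A.comap p, ⁅(y : K), ℓ a⁆ = ⁅(y : K), ℓ b⁆ := fun y =>
      congrArg Subtype.val (hχ (DFunLike.congr_fun hab y))
    have h2 : (ℓ b)⁻¹ * ℓ a ∈ Subgroup.center K := by
      refine hnd _ ?_ fun y hy => ?_
      · rw [map_mul, map_inv, hℓ, hℓ]; exact mul_mem (inv_mem b.2) a.2
      · have h3 := h1 ⟨y⁻¹, by rw [Subgroup.mem_comap, map_inv]; exact inv_mem hy⟩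
        simp only [commutatorElement_def, inv_inv] at h3
        have h4 : y⁻¹ * (ℓ a * y * (ℓ a)⁻¹) = y⁻¹ * (ℓ b * y * (ℓ b)⁻¹) := by
          simpa only [mul_assoc] using h3
        have h5 := mul_left_cancel h4
        calc (ℓ b)⁻¹ * ℓ a * y = (ℓ b)⁻¹ * (ℓ a * y * (ℓ a)⁻¹) * ℓ a := by group
          _ = y * ((ℓ b)⁻¹ * ℓ a) := by rw [h5]; group
    rw [hcen, map_mul, map_inv, hℓ, hℓ, inv_mul_eq_one] at h2
    exact Subtype.ext h2.symm
  have hli : LinearIndependent E fun a : A => ρ (ℓ a) := by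
    have hD := (linearIndependent_monoidHom (A.comap p) E).comp ξ hξi
    have : Fintype A := Fintype.ofFinite A
    rw [Fintype.linearIndependent_iff] at hD ⊢
    intro c hc a
    by_contra hca
    obtain ⟨v, hv⟩ : ∃ v, ρ (ℓ a) v ≠ 0 := by
      by_contra! hcon
      obtain ⟨v, hv⟩ := exists_ne (0 : V)
      apply hv
      have h1 : (ρ (ℓ a)⁻¹ * ρ (ℓ a)) v = v := by rw [← map_mul, inv_mul_cancel, map_one]; rfl
      rw [← h1, Module.End.mul_apply, hcon, map_zero]
    -- Conjugating a relation by `y` and evaluating at `v` and `f` gives a relation among the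
    -- characters, contrary to Dedekind's independence.
    obtain ⟨f, hf⟩ := Module.Projective.exists_dual_ne_zero E hv
    have h2 := hD (fun b => c b * f (ρ (ℓ b) v)) (by
      ext y
      have h3 := congrArg (fun T => ρ (y : K) * T * ρ (y : K)⁻¹) hc
      simp only [Finset.mul_sum, Finset.sum_mul, mul_zero, zero_mul, mul_smul_comm, smul_mul_assoc,
        hconj] at h3
      have h4 := congrArg f (LinearMap.congr_fun h3 v)
      simpa [LinearMap.sum_apply, mul_comm, mul_assoc, mul_left_comm] using h4) a
    rcases mul_eq_zero.1 h2 with h3 | h3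
    · exact hca h3
    · exact hf h3
  have hspan : Submodule.span E (Set.range fun a : A => ρ (ℓ a)) =
      Subalgebra.toSubmodule (algSpan ρ (A.comap p)) := by
    rw [algSpan_toSubmodule]
    apply le_antisymm
    · rw [Submodule.span_le]
      rintro _ ⟨a, rfl⟩
      exact Submodule.subset_span ⟨ℓ a, by
        change p (ℓ a) ∈ A
        rw [hℓ]; exact a.2, rfl⟩
    · rw [Submodule.span_le]
      rintro _ ⟨x, hx, rfl⟩
      let a : A := ⟨p x, hx⟩
      have hz : x * (ℓ a)⁻¹ ∈ Subgroup.center K := by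
        rw [hcen, map_mul, map_inv, hℓ, mul_inv_cancel]
      have h1 : ρ x = χ ⟨_, hz⟩ • ρ (ℓ a) := by
        rw [Algebra.smul_def, ← hρχ, ← map_mul, inv_mul_cancel_right]
      rw [SetLike.mem_coe, h1]
      exact Submodule.smul_mem _ _ (Submodule.subset_span ⟨a, rfl⟩)
  have : Fintype A := Fintype.ofFinite A
  have h1 := finrank_span_eq_card hli
  rw [hspan] at h1
  rw [Nat.card_eq_fintype_card, ← h1]
  rfl

end AlgSpan

/-! ### Lifting commutation from a central quotient. -/

section Lifting

variable {K Q : Type*} [Group K] [Group Q] {p : K →* Q}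

open scoped commutatorElement in
/-- An element that centralizes a nonabelian simple group modulo the center centralizes its
preimage. -/
theorem commute_of_commute_simple (hp : p.ker = Subgroup.center K) {T : Subgroup Q}
    [IsSimpleGroup T] (hTp : T ≤ p.range) (hT : ∃ x ∈ T, ∃ y ∈ T, x * y ≠ y * x) {x : K}
    (hx : ∀ t ∈ T, p x * t = t * p x) : ∀ y, p y ∈ T → x * y = y * x := by
  have hcen : ∀ k, k ∈ Subgroup.center K ↔ p k = 1 := fun k => by rw [← hp, MonoidHom.mem_ker]
  have hc : ∀ y, p y ∈ T → ⁅x, y⁆ ∈ Subgroup.center K := fun y hy => by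
    rw [hcen, map_commutatorElement, commutatorElement_eq_one_iff_mul_comm]
    exact hx _ hy
  have hmul : ∀ y z, p y ∈ T → p z ∈ T → ⁅x, y * z⁆ = ⁅x, y⁆ * ⁅x, z⁆ := fun y z _ hz =>
    commutatorElement_mul_right (hc z hz)
  have hinv : ∀ y, p y ∈ T → ⁅x, y⁻¹⁆ = ⁅x, y⁆⁻¹ := fun y hy => by
    have hy' : p y⁻¹ ∈ T := by rw [map_inv]; exact inv_mem hy
    rw [eq_inv_iff_mul_eq_one, ← hmul _ _ hy' hy, inv_mul_cancel, commutatorElement_one_right]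
  -- On the preimage of `T`, `y ↦ ⁅x, y⁆` is a homomorphism to a commutative group. So `D`, the
  -- image of its kernel, is normal and contains all commutators, whence `D = T`.
  let D : Subgroup T :=
    { carrier := {t | ∃ y, p y = t ∧ ⁅x, y⁆ = 1}
      one_mem' := ⟨1, by simp, by simp⟩
      mul_mem' := by
        rintro a b ⟨y, hy, hy1⟩ ⟨z, hz, hz1⟩
        refine ⟨y * z, by simp [hy, hz], ?_⟩
        rw [hmul _ _ (hy ▸ a.2) (hz ▸ b.2), hy1, hz1, one_mul]
      inv_mem' := by
        rintro a ⟨y, hy, hy1⟩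
        refine ⟨y⁻¹, by simp [hy], ?_⟩
        rw [hinv _ (hy ▸ a.2), hy1, inv_one] }
  have hcc : ∀ y z, p y ∈ T → p z ∈ T → ⁅x, y * z * y⁻¹⁆ = ⁅x, z⁆ := fun y z hy hz => by
    have hy' : p y⁻¹ ∈ T := by rw [map_inv]; exact inv_mem hy
    rw [hmul _ _ (by rw [map_mul]; exact mul_mem hy hz) hy', hmul _ _ hy hz, hinv _ hy,
      Subgroup.mem_center_iff.1 (hc z hz), mul_inv_cancel_right]
  have hDn : D.Normal := ⟨by
    rintro a ⟨z, hz, hz1⟩ g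
    obtain ⟨y, hy⟩ := hTp g.2
    refine ⟨y * z * y⁻¹, by simp [hy, hz], ?_⟩
    rw [hcc _ _ (hy ▸ g.2) (hz ▸ a.2), hz1]⟩
  obtain ⟨a, ha, b, hb, hab⟩ := hT
  have hD : D = ⊤ := by
    refine hDn.eq_bot_or_eq_top.resolve_left fun hbot => hab ?_
    obtain ⟨y, hy⟩ := hTp ha
    obtain ⟨z, hz⟩ := hTp hb
    have hz' : p z⁻¹ ∈ T := by rw [map_inv, hz]; exact inv_mem hb
    have h1 : (⟨a * b * a⁻¹ * b⁻¹, mul_mem (mul_mem (mul_mem ha hb) (inv_mem ha)) (inv_mem hb)⟩ : T)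
        ∈ D := by
      refine ⟨y * z * y⁻¹ * z⁻¹, by simp [hy, hz], ?_⟩
      rw [hmul _ _ _ hz', hcc _ _ (hy ▸ ha) (hz ▸ hb), hinv _ (hz ▸ hb), mul_inv_cancel]
      rw [map_mul, map_mul, map_inv, hy, hz]
      exact mul_mem (mul_mem ha hb) (inv_mem ha)
    rw [hbot, Subgroup.mem_bot] at h1
    have h2 := congrArg Subtype.val h1
    simpa [mul_inv_eq_iff_eq_mul] using h2
  intro y hy
  have h1 : (⟨p y, hy⟩ : T) ∈ D := by rw [hD]; trivial
  obtain ⟨z, hz, hz1⟩ := h1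
  rw [← commutatorElement_eq_one_iff_mul_comm, ← hz1]
  exact commutatorElement_congr hp rfl hz.symm

open scoped commutatorElement in
/-- Elements of coprime orders that commute modulo the center commute. -/
theorem commute_of_coprime (hp : p.ker = Subgroup.center K) {x y : K} {r s : ℕ}
    (hrs : r.Coprime s) (hx : p x ^ r = 1) (hy : p y ^ s = 1) (hxy : p x * p y = p y * p x) :
    x * y = y * x := by
  have hcen : ∀ k, k ∈ Subgroup.center K ↔ p k = 1 := fun k => by rw [← hp, MonoidHom.mem_ker]
  have h1 : ∀ a b : K, p a * p b = p b * p a → ⁅a, b⁆ ∈ Subgroup.center K := fun a b h => by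
    rw [hcen, map_commutatorElement, commutatorElement_eq_one_iff_mul_comm, h]
  have h2 : ∀ (a b : K) (n : ℕ), p a * p b = p b * p a → p b ^ n = 1 → ⁅a, b⁆ ^ n = 1 :=
    fun a b n hab hb => by
      rw [← commutatorElement_pow_right (h1 a b hab)]
      exact commutatorElement_eq_one_of_mem_center_right (by rw [hcen, map_pow, hb])
  -- The commutator is central, so its order divides both coprime exponents.
  have h3 := h2 x y s hxy hy
  have h4 := h2 y x r hxy.symm hx
  rw [← commutatorElement_inv, inv_pow, inv_eq_one] at h4
  rw [← commutatorElement_eq_one_iff_mul_comm, ← orderOf_eq_one_iff, ← Nat.dvd_one, ← hrs]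
  exact Nat.dvd_gcd (orderOf_dvd_of_pow_eq_one h4) (orderOf_dvd_of_pow_eq_one h3)

theorem comap_sup_le {A B : Subgroup Q} (hA : A ≤ p.range)
    (hB : B ≤ p.range) : (A ⊔ B).comap p ≤ A.comap p ⊔ B.comap p := by
  intro x hx
  have h1 : A ⊔ B ≤ (A.comap p ⊔ B.comap p).map p := by
    rw [Subgroup.map_sup, Subgroup.map_comap_eq, Subgroup.map_comap_eq, inf_eq_right.2 hA,
      inf_eq_right.2 hB]
  obtain ⟨y, hy, hyx⟩ := h1 hx
  have h2 : y⁻¹ * x ∈ A.comap p := by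
    rw [Subgroup.mem_comap, map_mul, map_inv, hyx, inv_mul_cancel]
    exact one_mem _
  have h3 := mul_mem hy ((le_sup_left : A.comap p ≤ A.comap p ⊔ B.comap p) h2)
  rwa [mul_inv_cancel_left] at h3

/-- The generated subgroup lies in the image of the centralizer of `X`, and two lifts of one element
differ only by a central factor. -/
theorem commute_comap_sSup (hp : p.ker = Subgroup.center K) {X : Subgroup K}
    {S : Set (Subgroup Q)} (hS : ∀ B ∈ S, B ≤ p.range)
    (h : ∀ B ∈ S, ∀ x ∈ X, ∀ y, p y ∈ B → x * y = y * x) :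
    ∀ x ∈ X, ∀ y, p y ∈ sSup S → x * y = y * x := by
  have h1 : sSup S ≤ (Subgroup.centralizer (X : Set K)).map p := by
    refine sSup_le fun B hB b hb => ?_
    obtain ⟨y, rfl⟩ := hS B hB hb
    exact ⟨y, Subgroup.mem_centralizer_iff.2 fun x hx => h B hB x hx y hb, rfl⟩
  intro x hx y hy
  obtain ⟨c, hc, hcy⟩ := h1 hy
  have hz : c⁻¹ * y ∈ Subgroup.center K := by
    rw [← hp, MonoidHom.mem_ker, map_mul, map_inv, hcy, inv_mul_cancel]
  have h2 := Subgroup.mem_center_iff.1 hz x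
  have h3 : x * c = c * x := Subgroup.mem_centralizer_iff.1 hc x hx
  calc x * y = x * c * (c⁻¹ * y) := by group
    _ = c * (x * (c⁻¹ * y)) := by rw [h3, mul_assoc]
    _ = y * x := by rw [h2]; group

end Lifting
end LinearGroups

namespace LinearGroups

/-! ### Automorphisms of matrix algebras and absolute irreducibility. -/

section MatrixAlgebra

variable {E : Type u} [Field E] {s : ℕ}

/-- The theorem of Skolem and Noether for a matrix algebra. -/
theorem exists_gl_conj (f : Matrix (Fin s) (Fin s) E ≃ₐ[E] Matrix (Fin s) (Fin s) E) :
    ∃ g : GL (Fin s) E, ∀ a, f a * g.val = g.val * a := by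
  let τ : Matrix (Fin s) (Fin s) E ≃ₐ[E] Module.End E (Fin s → E) := Matrix.toLinAlgEquiv'
  obtain ⟨T, hT⟩ := ((τ.symm.trans f).trans τ).eq_linearEquivConjAlgEquiv
  have h1 : (T.toLinearMap : Module.End E (Fin s → E)) * T.symm.toLinearMap = 1 :=
    LinearMap.ext fun v => T.apply_symm_apply v
  have h2 : (T.symm.toLinearMap : Module.End E (Fin s → E)) * T.toLinearMap = 1 :=
    LinearMap.ext fun v => T.symm_apply_apply v
  refine ⟨⟨τ.symm T.toLinearMap, τ.symm T.symm.toLinearMap, by rw [← map_mul, h1, map_one],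
    by rw [← map_mul, h2, map_one]⟩, fun a => ?_⟩
  change f a * τ.symm T.toLinearMap = τ.symm T.toLinearMap * a
  apply τ.injective
  rw [map_mul, map_mul]
  rw [AlgEquiv.apply_symm_apply]
  have h3 := DFunLike.congr_fun hT (τ a)
  rw [AlgEquiv.trans_apply, AlgEquiv.trans_apply, AlgEquiv.symm_apply_apply] at h3
  rw [h3]
  exact LinearMap.ext fun v => congrArg (fun w => T (τ a w)) (T.symm_apply_apply v)

/-- A group of matrices that spans the matrix algebra is irreducible over all extension fields. -/
theorem isIrreducible_map_of_forall_subalgebra [NeZero s] (X : Subgroup (GL (Fin s) E))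
    (hX : ∀ S : Subalgebra E (Matrix (Fin s) (Fin s) E), (∀ x ∈ X, x.val ∈ S) → S = ⊤)
    (L : Type u) [Field L] [Algebra E L] :
    (glRep (X.map (Matrix.GeneralLinearGroup.map (n := Fin s) (algebraMap E L)))).IsIrreducible := by
  set ρ := glRep (X.map (Matrix.GeneralLinearGroup.map (n := Fin s) (algebraMap E L))) with hρ
  have key : ∀ U : Subrepresentation ρ, ∀ M : Matrix (Fin s) (Fin s) E, ∀ u ∈ U.toSubmodule,
      M.map (algebraMap E L) *ᵥ u ∈ U.toSubmodule := by
    intro U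
    let S : Subalgebra E (Matrix (Fin s) (Fin s) E) :=
      { carrier := {M | ∀ u ∈ U.toSubmodule, M.map (algebraMap E L) *ᵥ u ∈ U.toSubmodule}
        mul_mem' := fun {a b} ha hb u hu => by
          rw [Matrix.map_mul, ← Matrix.mulVec_mulVec]
          exact ha _ (hb u hu)
        add_mem' := fun {a b} ha hb u hu => by
          rw [Matrix.map_add _ (map_add _), Matrix.add_mulVec]
          exact U.toSubmodule.add_mem (ha u hu) (hb u hu)
        algebraMap_mem' := fun c u hu => by
          have : (algebraMap E (Matrix (Fin s) (Fin s) E) c).map (algebraMap E L) *ᵥ u =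
              algebraMap E L c • u := by
            ext i
            simp [Matrix.mulVec, dotProduct, Matrix.algebraMap_matrix_apply, apply_ite]
          rw [this]
          exact U.toSubmodule.smul_mem _ hu }
    have hS : S = ⊤ := hX S fun x hx u hu =>
      U.apply_mem_toSubmodule ⟨_, Subgroup.mem_map_of_mem _ hx⟩ hu
    intro M
    have hM : M ∈ S := by rw [hS]; trivial
    exact hM
  have : Nontrivial (Subrepresentation ρ) := by
    refine ⟨⟨⊥, ⊤, fun h => ?_⟩⟩
    have h1 : (1 : Fin s → L) ∈ (⊤ : Subrepresentation ρ).toSubmodule := Submodule.mem_top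
    rw [← h] at h1
    have h2 : (1 : Fin s → L) = 0 := h1
    exact one_ne_zero (congrFun h2 0)
  refine IsSimpleOrder.mk fun U => ?_
  by_cases hU : ∀ u ∈ U.toSubmodule, u = 0
  · left
    rw [eq_bot_iff]
    exact fun u hu => hU u hu
  right
  push Not at hU
  obtain ⟨u, hu, hu0⟩ := hU
  obtain ⟨j, hj⟩ := Function.ne_iff.1 hu0
  -- A matrix unit, available over `E`, moves a nonzero coordinate of `u` to any position; scaling
  -- in `L` gives the standard basis.
  have h1 : ∀ i, Pi.single i 1 ∈ U.toSubmodule := fun i => by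
    have h2 := key U (Matrix.single i j 1) u hu
    have h3 : (Matrix.single i j (1 : E)).map (algebraMap E L) *ᵥ u =
        u j • (Pi.single i 1 : Fin s → L) := by
      ext k
      by_cases hk : i = k
      · subst hk
        simp [Matrix.mulVec, dotProduct, Matrix.single_apply, apply_ite]
      · simp [Matrix.mulVec, dotProduct, hk, Ne.symm hk]
    rw [h3] at h2
    have h4 := U.toSubmodule.smul_mem (u j)⁻¹ h2
    rwa [smul_smul, inv_mul_cancel₀ hj, one_smul] at h4
  rw [eq_top_iff]
  intro v _
  have h5 : v = ∑ i, v i • (Pi.single i 1 : Fin s → L) := by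
    ext k
    simp [Finset.sum_apply, Pi.single_apply]
  change v ∈ U.toSubmodule
  rw [h5]
  exact Submodule.sum_mem _ fun i _ => U.toSubmodule.smul_mem _ (h1 i)

end MatrixAlgebra

/-! ### The projective representation attached to a matrix envelope. -/

section ProjectiveRepresentation

variable {E V : Type u} [Field E] [AddCommGroup V] [Module E V] {K : Type*} {Q : Type u}
  [Group K] [Group Q] {ρ : K →* Module.End E V} {N : Subgroup K}

theorem conjBy_eq_iff_mem_normalizer {T : Subgroup Q} {q : Q} :
    conjBy q T = T ↔ q ∈ Subgroup.normalizer (T : Set Q) := by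
  rw [Subgroup.mem_normalizer_iff]
  constructor
  · intro h x
    refine ⟨fun hx => h ▸ conj_mem_conjBy hx, fun hx => ?_⟩
    rw [← h, mem_conjBy] at hx
    simpa [mul_assoc] using hx
  · intro h
    ext x
    rw [mem_conjBy, h]
    simp [mul_assoc]

/-- The projective representation of a section `T` of `K` on which the enveloping algebra is a
matrix algebra. -/
theorem IsCentralBase.exists_projRep (h : IsCentralBase ρ N) {p : K →* Q}
    (hp : p.ker = Subgroup.center K) {T : Subgroup Q} (hTp : T ≤ p.range) {s : ℕ} [NeZero s]
    (α : algSpan ρ (T.comap p) ≃ₐ[E] Matrix (Fin s) (Fin s) E) :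
    ∃ ρ₀ : T →* PGL(s, E), IsAbsIrreducibleProj ρ₀ ∧
      ∀ (k : K) (a : MulAut T), (∀ x, (a x : Q) = p k * x * (p k)⁻¹) → a ∈ projStabilizer ρ₀ := by
  let X := T.comap p
  let η : X →* GL (Fin s) E := MonoidHom.toHomUnits
    ⟨⟨fun x => α ⟨ρ x, apply_mem_algSpan x.2⟩, by
      rw [← map_one α]; congr 1; exact Subtype.ext (map_one ρ)⟩, fun x y => by
      change α _ = α _ * α _
      rw [← map_mul]; congr 1; exact Subtype.ext (map_mul ρ x.1 y.1)⟩
  have hη : ∀ x : X, (η x).val = α ⟨ρ x, apply_mem_algSpan x.2⟩ := fun x => rfl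
  let pT : X →* T := p.subgroupComap T
  have hpT : ∀ x : X, (pT x : Q) = p x := fun x => rfl
  have hs : Function.Surjective pT := fun t => by
    obtain ⟨x, hx⟩ := hTp t.2
    exact ⟨⟨x, by change p x ∈ T; rw [hx]; exact t.2⟩, Subtype.ext hx⟩
  -- The kernel is central in `K`, hence acts by scalars, which vanish in `PGL`.
  have hker : pT.ker ≤ (Matrix.ProjGenLinGroup.mk.comp η).ker := fun x hx => by
    have hx1 : p x = 1 := congrArg Subtype.val hx
    have hxc : (x : K) ∈ Subgroup.center K := by rw [← hp]; exact hx1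
    obtain ⟨c, hc⟩ := h.exists_scalar hxc
    have h1 : (η x).val = algebraMap E _ c := by
      rw [hη, ← AlgEquiv.commutes α]
      congr 1
      exact Subtype.ext hc
    rw [MonoidHom.mem_ker, MonoidHom.comp_apply, Matrix.ProjGenLinGroup.mk_eq_one,
      Subgroup.mem_center_iff]
    intro g
    apply Units.ext
    rw [Units.val_mul, Units.val_mul, h1]
    exact (Algebra.commutes c g.val).symm
  let ρ₀ : T →* PGL(s, E) := pT.liftOfSurjective hs ⟨_, hker⟩
  have hρ₀ : ∀ x, ρ₀ (pT x) = Matrix.ProjGenLinGroup.mk (η x) := fun x =>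
    MonoidHom.liftOfRightInverse_comp_apply pT _ _ ⟨_, hker⟩ x
  -- a subalgebra containing the image of `X` is everything
  have hspan : ∀ S : Subalgebra E (Matrix (Fin s) (Fin s) E), (∀ x, (η x).val ∈ S) → S = ⊤ := by
    intro S hS
    have h1 : algSpan ρ X ≤ (S.comap α.toAlgHom).map (algSpan ρ X).val :=
      algSpan_le.2 fun x hx => ⟨⟨ρ x, apply_mem_algSpan hx⟩, hS ⟨x, hx⟩, rfl⟩
    rw [eq_top_iff]
    intro M _
    obtain ⟨a, ha, hae⟩ := h1 (α.symm M).2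
    have h2 : a = α.symm M := Subtype.ext hae
    have h3 : α a ∈ S := ha
    rwa [h2, α.apply_symm_apply] at h3
  refine ⟨ρ₀, ?_, ?_⟩
  · intro L _ _
    refine isIrreducible_map_of_forall_subalgebra _ (fun S hS => hspan S fun x => hS _ ?_) L
    rw [Subgroup.mem_comap]
    exact ⟨pT x, hρ₀ x⟩
  · intro k a ha
    have hak : ∀ x : X, k * x * k⁻¹ ∈ X := fun x => by
      change p (k * x * k⁻¹) ∈ T
      rw [map_mul, map_mul, map_inv]
      have := ha (pT x)
      rw [hpT] at this
      rw [← this]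
      exact (a (pT x)).2
    have hak' : ∀ x : X, k⁻¹ * x * k ∈ X := fun x => by
      change p (k⁻¹ * x * k) ∈ T
      have h1 := ha (a⁻¹ (pT x))
      rw [MulAut.apply_inv_self, hpT] at h1
      rw [map_mul, map_mul, map_inv, h1]
      simp [mul_assoc]
    -- Conjugation by `ρ k` preserves the envelope of `X`. As an automorphism of a matrix algebra it
    -- is inner, and the conjugating matrix shows that `a` fixes the class of `ρ₀`.
    let c : Module.End E V ≃ₐ[E] Module.End E V :=
      MulSemiringAction.toAlgEquiv (G := ConjAct (Module.End E V)ˣ) E _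
        (ConjAct.toConjAct (ρ.toHomUnits k))
    have hc : ∀ b, c b = ρ k * b * ρ k⁻¹ := fun b => ConjAct.units_smul_def _ _
    have hmap : (algSpan ρ X).map c.toAlgHom = algSpan ρ X := by
      rw [algSpan, AlgHom.map_adjoin]
      congr 1
      ext b
      constructor
      · rintro ⟨_, ⟨x, hx, rfl⟩, rfl⟩
        refine ⟨k * x * k⁻¹, hak ⟨x, hx⟩, ?_⟩
        rw [map_mul, map_mul]
        exact (hc _).symm
      · rintro ⟨x, hx, rfl⟩
        refine ⟨_, ⟨k⁻¹ * x * k, hak' ⟨x, hx⟩, rfl⟩, ?_⟩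
        refine (hc _).trans ?_
        rw [← map_mul, ← map_mul]
        congr 1
        group
    let φ : algSpan ρ X ≃ₐ[E] algSpan ρ X :=
      (c.subalgebraMap (algSpan ρ X)).trans (Subalgebra.equivOfEq _ _ hmap)
    have hφ : ∀ b, (φ b : Module.End E V) = ρ k * b.1 * ρ k⁻¹ := fun b => hc b.1
    obtain ⟨g, hg⟩ := exists_gl_conj ((α.symm.trans φ).trans α)
    refine ⟨Matrix.ProjGenLinGroup.mk g, fun t => ?_⟩
    obtain ⟨x, rfl⟩ := hs t
    have h1 : a (pT x) = pT ⟨k * x * k⁻¹, hak x⟩ := Subtype.ext (by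
      rw [ha, hpT, hpT, map_mul, map_mul, map_inv])
    rw [h1, hρ₀, hρ₀, eq_mul_inv_iff_mul_eq, ← map_mul, ← map_mul]
    congr 1
    apply Units.ext
    rw [Units.val_mul, Units.val_mul, ← hg (η x).val]
    congr 1
    rw [AlgEquiv.trans_apply, AlgEquiv.trans_apply, hη, hη, α.symm_apply_apply]
    congr 1
    refine Subtype.ext ?_
    rw [hφ]
    change ρ (k * x * k⁻¹) = _
    rw [map_mul, map_mul]

end ProjectiveRepresentation
end LinearGroups

namespace LinearGroups

/-! ### The action on an orbit of simple factors. -/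

section WreathShape

variable {E V : Type u} [Field E] [AddCommGroup V] [Module E V] {K : Type*} {Q : Type u}
  [Group K] [Group Q] {ρ : K →* Module.End E V} {N : Subgroup K}

/-- Matrices of degree at most one commute, whereas `ρ` is faithful and `T` is not commutative. -/
theorem IsCentralBase.two_le_degree (h : IsCentralBase ρ N) {p : K →* Q} {T : Subgroup Q}
    (hTp : T ≤ p.range) (hT : ∃ x ∈ T, ∃ y ∈ T, x * y ≠ y * x) {s : ℕ}
    (α : algSpan ρ (T.comap p) ≃ₐ[E] Matrix (Fin s) (Fin s) E) : 2 ≤ s := by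
  by_contra hs
  obtain ⟨x, hx, y, hy, hxy⟩ := hT
  obtain ⟨a, rfl⟩ := hTp hx
  obtain ⟨b, rfl⟩ := hTp hy
  have hcomm : ∀ A B : Matrix (Fin s) (Fin s) E, A * B = B * A := by
    intro A B
    have : Subsingleton (Fin s) := Fin.subsingleton_iff_le_one.2 (by omega)
    ext i j
    rw [Matrix.mul_apply, Matrix.mul_apply]
    refine Finset.sum_congr rfl fun k _ => ?_
    rw [Subsingleton.elim k i, Subsingleton.elim j i, mul_comm]
  have h1 : (⟨ρ a, apply_mem_algSpan (X := T.comap p) hx⟩ : algSpan ρ (T.comap p)) *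
      ⟨ρ b, apply_mem_algSpan (X := T.comap p) hy⟩ =
      ⟨ρ b, apply_mem_algSpan (X := T.comap p) hy⟩ *
      ⟨ρ a, apply_mem_algSpan (X := T.comap p) hx⟩ := by
    apply α.injective
    rw [map_mul, map_mul, hcomm]
  have h2 := congrArg Subtype.val h1
  change ρ a * ρ b = ρ b * ρ a at h2
  rw [← map_mul, ← map_mul] at h2
  apply hxy
  rw [← map_mul, h.injective h2, map_mul]

/-- The action of `K` on an orbit of simple subgroups of `Q` gives a factor of wreath type. -/
theorem IsCentralBase.exists_isWreathShape [Finite Q] (h : IsCentralBase ρ N) {p : K →* Q}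
    (hp : p.ker = Subgroup.center K) {T : Subgroup Q} [IsSimpleGroup T] (hTp : T ≤ p.range)
    (hT : ∃ x ∈ T, ∃ y ∈ T, x * y ≠ y * x) {s : ℕ}
    (α : algSpan ρ (T.comap p) ≃ₐ[E] Matrix (Fin s) (Fin s) E) {t : ℕ} (ht : 1 ≤ t)
    (U : Fin t → Subgroup Q) (hUi : Function.Injective U) (g : Fin t → K)
    (hg : ∀ i, U i = conjBy (p (g i)) T) (hperm : ∀ k i, ∃ j, conjBy (p k) (U i) = U j)
    (hcomm : ∀ i j, i ≠ j → ∀ x ∈ U i, ∀ y ∈ U j, x * y = y * x) :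
    ∃ (H : Type u) (_ : Group H) (θ : K →* H), Function.Surjective θ ∧
      (∀ k, θ k = 1 ↔ ∀ i y, p y ∈ U i → k * y = y * k) ∧ IsWreathShape E H s t := by
  have hs2 : 2 ≤ s := h.two_le_degree hTp hT α
  have : NeZero s := ⟨by omega⟩
  obtain ⟨ρ₀, habs, hstab⟩ := h.exists_projRep hp hTp α
  choose τ hτ using hperm
  have hτmul : ∀ k l i, τ (k * l) i = τ k (τ l i) := fun k l i => hUi <| by
    rw [← hτ, ← hτ, ← hτ, map_mul, conjBy_mul]
  have hτone : ∀ i, τ 1 i = i := fun i => hUi <| by rw [← hτ, map_one, conjBy_one]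
  let σ : K →* Equiv.Perm (Fin t) :=
    { toFun := fun k => ⟨τ k, τ k⁻¹, fun i => by rw [← hτmul, inv_mul_cancel, hτone],
        fun i => by rw [← hτmul, mul_inv_cancel, hτone]⟩
      map_one' := Equiv.ext hτone
      map_mul' := fun k l => Equiv.ext (hτmul k l) }
  have hσ : ∀ k i, conjBy (p k) (U i) = U (σ k i) := hτ
  have hconjinv : ∀ (q : Q) (A B : Subgroup Q), A = conjBy q B → conjBy q⁻¹ A = B := by
    rintro q _ B rfl
    rw [← conjBy_mul, inv_mul_cancel, conjBy_one]
  -- The usual induced cocycle: `m k i` normalizes `T`, and `m (k * l) i = m k i * m l ((σ k)⁻¹ i)`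
  -- is the multiplication rule of the wreath product.
  let m : K → Fin t → K := fun k i => (g i)⁻¹ * k * g ((σ k)⁻¹ i)
  have hmT : ∀ k i, conjBy (p (m k i)) T = T := fun k i => by
    rw [map_mul, map_mul, map_inv, conjBy_mul, conjBy_mul, ← hg, hσ, ← Equiv.Perm.mul_apply, mul_inv_cancel,
      Equiv.Perm.one_apply]
    exact hconjinv _ _ _ (hg i)
  let f : K → Fin t → MulAut T := fun k i =>
    T.normalizerMonoidHom ⟨p (m k i), conjBy_eq_iff_mem_normalizer.1 (hmT k i)⟩
  have hf : ∀ k i x, (f k i x : Q) = p (m k i) * x * (p (m k i))⁻¹ := fun k i x => rfl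
  let A := projStabilizer ρ₀
  have hfA : ∀ k i, f k i ∈ A := fun k i => hstab (m k i) _ (hf k i)
  let ψ : K →* WreathSym A t := MonoidHom.mk' (fun k => ⟨fun i => ⟨f k i, hfA k i⟩, σ k⟩) (by
    intro k l
    refine SemidirectProduct.ext ?_ (map_mul σ k l)
    funext i
    apply Subtype.ext
    change f (k * l) i = f k i * f l ((σ k)⁻¹ i)
    ext x
    rw [MulAut.mul_apply, hf, hf, hf]
    have h1 : m (k * l) i = m k i * m l ((σ k)⁻¹ i) := by
      simp only [m, map_mul, mul_inv_rev, Equiv.Perm.mul_apply]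
      group
    rw [h1, map_mul]
    group)
  have hψl : ∀ k i, ((ψ k).left i : MulAut T) = f k i := fun k i => rfl
  have hψr : ∀ k, (ψ k).right = σ k := fun k => rfl
  have hσ1 : ∀ k, (∀ j, conjBy (p k) (U j) = U j) → σ k = 1 := fun k hk =>
    Equiv.ext fun j => hUi (by rw [← hσ, hk]; rfl)
  have hm1 : ∀ k i, σ k = 1 → m k i = (g i)⁻¹ * k * g i := fun k i hk => by
    simp only [m, hk, inv_one, Equiv.Perm.one_apply]
  have hUself : ∀ k i, p k ∈ U i → ∀ j, conjBy (p k) (U j) = U j := by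
    intro k i hk j
    by_cases hij : i = j
    · subst hij
      exact (conjInvariant_self (U i)).conjBy_eq hk
    · exact ConjInvariant.conjBy_eq (H := U i)
        (ConjInvariant.of_commute (hcomm i j hij)) hk
  have hker : ∀ k, ψ k = 1 ↔ ∀ i y, p y ∈ U i → k * y = y * k := by
    intro k
    constructor
    · intro hk i y hy
      have hσk : σ k = 1 := by rw [← hψr, hk]; rfl
      have hfk : f k i = 1 := by rw [← hψl, hk]; rfl
      have h1 : ∀ t ∈ T, p ((g i)⁻¹ * k * g i) * t = t * p ((g i)⁻¹ * k * g i) := by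
        intro t ht
        have h2 := hf k i ⟨t, ht⟩
        rw [hfk, hm1 k i hσk, eq_mul_inv_iff_mul_eq] at h2
        exact h2.symm
      have h3 := commute_of_commute_simple hp hTp hT h1 ((g i)⁻¹ * y * g i) (by
        rw [hg, mem_conjBy] at hy
        rwa [map_mul, map_mul, map_inv])
      calc k * y = g i * ((g i)⁻¹ * k * g i * ((g i)⁻¹ * y * g i)) * (g i)⁻¹ := by group
        _ = y * k := by rw [h3]; group
    · intro hk
      have hkc : ∀ i, ∀ u ∈ U i, p k * u = u * p k := by
        intro i u hu
        have hu' := hu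
        rw [hg, mem_conjBy] at hu'
        obtain ⟨y, hy⟩ := hTp hu'
        have h1 : p (g i * y * (g i)⁻¹) = u := by
          rw [map_mul, map_mul, map_inv, hy]; group
        rw [← h1, ← map_mul, hk i _ (by rw [h1]; exact hu), map_mul]
      have hσk : σ k = 1 := hσ1 k fun j => by
        ext x
        rw [mem_conjBy]
        constructor
        · intro hx
          have := hkc j _ hx
          have h2 : p k * ((p k)⁻¹ * x * p k) * (p k)⁻¹ = x := by group
          rw [← h2, this, mul_inv_cancel_right]
          exact hx
        · intro hx
          rw [mul_assoc, ← hkc j x hx, inv_mul_cancel_left]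
          exact hx
      refine SemidirectProduct.ext ?_ hσk
      funext i
      apply Subtype.ext
      ext x
      rw [hψl, hf, hm1 k i hσk, map_mul, map_mul, map_inv]
      have h1 : p (g i) * x * (p (g i))⁻¹ ∈ U i := by rw [hg]; exact conj_mem_conjBy x.2
      have h2 := hkc i _ h1
      change _ = (x : Q)
      calc (p (g i))⁻¹ * p k * p (g i) * x * ((p (g i))⁻¹ * p k * p (g i))⁻¹
          = (p (g i))⁻¹ * (p k * (p (g i) * x * (p (g i))⁻¹)) * (p k)⁻¹ * p (g i) := by group
        _ = x := by rw [h2]; group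
  refine ⟨ψ.range, inferInstance, ψ.rangeRestrict, ψ.rangeRestrict_surjective, fun k => ?_,
    hs2, ht, T, inferInstance, ρ₀, A, ψ.range, inferInstance, inferInstance, ?_, habs, le_rfl, ?_,
    ?_, ⟨MulEquiv.refl _⟩⟩
  · rw [← hker, ← MonoidHom.mem_ker, MonoidHom.ker_rangeRestrict, MonoidHom.mem_ker]
  · obtain ⟨x, hx, y, hy, hxy⟩ := hT
    exact ⟨⟨x, hx⟩, ⟨y, hy⟩, fun h => hxy (congrArg Subtype.val h)⟩
  · rintro _ ⟨x, rfl⟩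
    obtain ⟨k, hk⟩ := hTp x.2
    exact hstab k _ fun y => by rw [hk]; rfl
  · intro a ha
    suffices a ∈ ψ.range.comap SemidirectProduct.inl from this
    -- One coordinate at a time suffices: a lift of an element of `U i` acts as an inner
    -- automorphism there and trivially on the other factors.
    refine Subgroup.pi_mem_of_mulSingle_mem a fun i => ?_
    obtain ⟨x, hx⟩ := ha i
    obtain ⟨w, hw⟩ := hTp x.2
    have hk : p (g i * w * (g i)⁻¹) ∈ U i := by
      rw [map_mul, map_mul, map_inv, hg, hw]
      exact conj_mem_conjBy x.2
    have hσk := hσ1 _ (hUself _ i hk)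
    refine ⟨g i * w * (g i)⁻¹, SemidirectProduct.ext ?_ hσk⟩
    funext j
    apply Subtype.ext
    ext y
    rw [hψl, hf, hm1 _ j hσk]
    by_cases hij : j = i
    · subst hij
      rw [SemidirectProduct.left_inl, Pi.mulSingle_eq_same, ← hx]
      have h1 : (g j)⁻¹ * (g j * w * (g j)⁻¹) * g j = w := by group
      rw [h1, hw]
      rfl
    · rw [SemidirectProduct.left_inl, Pi.mulSingle_eq_of_ne hij]
      change _ = (y : Q)
      have h1 : p (g j) * y * (p (g j))⁻¹ ∈ U j := by rw [hg j]; exact conj_mem_conjBy y.2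
      have h2 := hcomm i j (Ne.symm hij) _ hk _ h1
      rw [map_mul, map_mul, map_inv]
      set q := p (g i * w * (g i)⁻¹)
      calc (p (g j))⁻¹ * q * p (g j) * y * ((p (g j))⁻¹ * q * p (g j))⁻¹
          = (p (g j))⁻¹ * (q * (p (g j) * y * (p (g j))⁻¹)) * q⁻¹ * p (g j) := by group
        _ = y := by rw [h2]; group

end WreathShape
end LinearGroups

namespace LinearGroups

/-! ### The blocks of the socle. -/

section SocleBlocks

variable {Q : Type*} [Group Q]

theorem disjoint_abelianSocle {r s : ℕ} (hrs : r.Coprime s) :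
    Disjoint (abelianSocle Q r) (abelianSocle Q s) := by
  rw [Subgroup.disjoint_def]
  intro x hx hy
  rw [← orderOf_eq_one_iff, ← Nat.dvd_one, ← hrs]
  exact Nat.dvd_gcd (orderOf_dvd_of_pow_eq_one (abelianSocle_pow r x hx))
    (orderOf_dvd_of_pow_eq_one (abelianSocle_pow s x hy))

/-- The nontrivial homogeneous abelian parts of the socle and its nonabelian simple factors. -/
def socleBlocks (Q : Type*) [Group Q] : Set (Subgroup Q) :=
  {A | ∃ r : ℕ, r.Prime ∧ A = abelianSocle Q r ∧ A ≠ ⊥} ∪ simpleFactors Q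

theorem le_socle_of_mem_socleBlocks {B : Subgroup Q} (hB : B ∈ socleBlocks Q) : B ≤ socle Q := by
  rcases hB with ⟨r, -, rfl, -⟩ | hB
  · exact abelianSocle_le_socle r
  · exact simpleFactors_le_socle hB

theorem socle_le_sSup_socleBlocks [Finite Q] : socle Q ≤ sSup (socleBlocks Q) := by
  refine socle_le.trans (sSup_le ?_)
  rintro _ (⟨r, hr, rfl⟩ | hB)
  · by_cases h : abelianSocle Q r = ⊥
    · rw [h]; exact bot_le
    · exact le_sSup (Or.inl ⟨r, hr, rfl, h⟩)
  · exact le_sSup (Or.inr hB)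

/-- Preimages of distinct blocks under a central extension commute. -/
theorem commute_comap_socleBlocks {K : Type*} [Group K] {p : K →* Q}
    (hp : p.ker = Subgroup.center K) (hsp : socle Q ≤ p.range) {B B' : Subgroup Q}
    (hB : B ∈ socleBlocks Q) (hB' : B' ∈ socleBlocks Q) (hne : B ≠ B') :
    ∀ x y, p x ∈ B → p y ∈ B' → x * y = y * x := by
  intro x y hx hy
  rcases hB with ⟨r, hr, rfl, -⟩ | hB
  · rcases hB' with ⟨s, hs, rfl, -⟩ | hB'
    · have hrs : r.Coprime s := (Nat.coprime_primes hr hs).2 fun h => hne (by rw [h])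
      exact commute_of_coprime hp hrs (abelianSocle_pow r _ hx) (abelianSocle_pow s _ hy)
        (Subgroup.commute_of_normal_of_disjoint _ _ (abelianSocle_conjInvariant r).normal
          (abelianSocle_conjInvariant s).normal (disjoint_abelianSocle hrs) _ _ hx hy)
    · have := isSimpleGroup_of_mem_simpleFactors hB'
      exact commute_of_commute_simple hp ((simpleFactors_le_socle hB').trans hsp) hB'.2
        (abelianSocle_commute_simpleFactors r hB' _ hx) y hy
  · have := isSimpleGroup_of_mem_simpleFactors hB
    refine (commute_of_commute_simple hp ((simpleFactors_le_socle hB).trans hsp) hB.2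
      (fun t ht => ?_) x hx).symm
    rcases hB' with ⟨s, hs, rfl, -⟩ | hB'
    · exact abelianSocle_commute_simpleFactors s hB _ hy _ ht
    · exact simpleFactors_commute hB' hB hne.symm _ hy _ ht

end SocleBlocks

/-! ### The factors and the subdirect embedding. -/

section Factors

variable {E V K Q : Type u} [Field E] [AddCommGroup V] [Module E V] [Group K] [Group Q] [Finite Q]
  {ρ : K →* Module.End E V} {p : K →* Q}

theorem IsCentralBase.mem_center_of_commute (h : IsCentralBase ρ ((socle Q).comap p))
    (hp : p.ker = Subgroup.center K) (hsp : socle Q ≤ p.range) {x : K}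
    (hx : ∀ B ∈ socleBlocks Q, ∀ y, p y ∈ B → x * y = y * x) : x ∈ Subgroup.center K := by
  refine h.centralizer_le x fun y hy => ?_
  refine commute_comap_sSup hp (X := Subgroup.centralizer {y | ∃ B ∈ socleBlocks Q, p y ∈ B})
    (fun B hB => (le_socle_of_mem_socleBlocks hB).trans hsp) (fun B hB z hz w hw => ?_) x ?_ y
    (socle_le_sSup_socleBlocks hy)
  · exact (Subgroup.mem_centralizer_iff.1 hz w ⟨B, hB, hw⟩).symm
  · rw [Subgroup.mem_centralizer_iff]
    rintro y ⟨B, hB, hy⟩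
    exact (hx B hB y hy).symm

/-- An element over one block commutes with the preimages of all other blocks anyway. This is the
nondegeneracy needed for the commutator form. -/
theorem IsCentralBase.mem_center_of_mem_socleBlocks (h : IsCentralBase ρ ((socle Q).comap p))
    (hp : p.ker = Subgroup.center K) (hsp : socle Q ≤ p.range) {B : Subgroup Q}
    (hB : B ∈ socleBlocks Q) {x : K} (hxB : p x ∈ B) (hx : ∀ y, p y ∈ B → x * y = y * x) :
    x ∈ Subgroup.center K := by
  refine h.mem_center_of_commute hp hsp fun B' hB' y hy => ?_
  by_cases hne : B = B'
  · exact hx y (hne ▸ hy)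
  · exact commute_comap_socleBlocks hp hsp hB hB' hne x y hxB hy

/-- The remaining blocks generate a commuting complement. -/
theorem IsCentralBase.exists_algEquiv_matrix_of_mem_socleBlocks [Finite E] [Module.Finite E V]
    [Nontrivial V] (h : IsCentralBase ρ ((socle Q).comap p)) (hp : p.ker = Subgroup.center K)
    (hsp : socle Q ≤ p.range) {B : Subgroup Q} (hB : B ∈ socleBlocks Q) :
    ∃ (s : ℕ) (_ : NeZero s), Nonempty (algSpan ρ (B.comap p) ≃ₐ[E] Matrix (Fin s) (Fin s) E) := by
  refine h.exists_algEquiv_matrix (Y := (sSup (socleBlocks Q \ {B})).comap p)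
    (Subgroup.comap_mono (le_socle_of_mem_socleBlocks hB)) ?_ ?_
  · refine (Subgroup.comap_mono ?_).trans
      (comap_sup_le ((le_socle_of_mem_socleBlocks hB).trans hsp)
        ((sSup_le fun B' hB' => le_socle_of_mem_socleBlocks hB'.1).trans hsp))
    refine socle_le_sSup_socleBlocks.trans (sSup_le fun B' hB' => ?_)
    by_cases hne : B' = B
    · rw [hne]; exact le_sup_left
    · exact (le_sSup (show B' ∈ socleBlocks Q \ {B} from ⟨hB', hne⟩)).trans le_sup_right
  · intro x hx y hy
    exact commute_comap_sSup hp (X := B.comap p)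
      (fun B' hB' => (le_socle_of_mem_socleBlocks hB'.1).trans hsp)
      (fun B' hB' x hx y hy => commute_comap_socleBlocks hp hsp hB hB'.1 (Ne.symm hB'.2) x y hx hy)
      x hx y hy

/-- The action of `K` on the abelian part of the socle for the prime `r` gives a factor of
symplectic type. -/
theorem IsCentralBase.exists_symplectic_factor [Finite E] [Module.Finite E V]
    [Nontrivial V] (h : IsCentralBase ρ ((socle Q).comap p)) (hp : p.ker = Subgroup.center K)
    (hpn : p.range.Normal) (hsp : socle Q ≤ p.range) {r : ℕ} (hr : r.Prime)
    (hA : abelianSocle Q r ≠ ⊥) :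
    ∃ (m : ℕ) (H : Type u) (_ : Group H) (θ : K →* H), Function.Surjective θ ∧
      (∀ k, θ k = 1 ↔ ∀ y, p y ∈ abelianSocle Q r → k * y = y * k) ∧ IsSymplecticShape E H r m ∧
      Nonempty (algSpan ρ ((abelianSocle Q r).comap p) ≃ₐ[E]
        Matrix (Fin (r ^ m)) (Fin (r ^ m)) E) := by
  obtain ⟨χ, hχ, -⟩ := h.exists_centralChar
  have hAn : (abelianSocle Q r).Normal := (abelianSocle_conjInvariant r).normal
  have hB : abelianSocle Q r ∈ socleBlocks Q := Or.inl ⟨r, hr, rfl, hA⟩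
  have hAp := (abelianSocle_le_socle r).trans hsp
  have hnd : ∀ x, p x ∈ abelianSocle Q r → (∀ y, p y ∈ abelianSocle Q r → x * y = y * x) →
      x ∈ Subgroup.center K := fun x hx hx' => h.mem_center_of_mem_socleBlocks hp hsp hB hx hx'
  let C := Subgroup.centralizer (((abelianSocle Q r).comap p : Subgroup K) : Set K)
  have hker : ∀ k, QuotientGroup.mk' C k = 1 ↔
      ∀ y, p y ∈ abelianSocle Q r → k * y = y * k := fun k => by
    rw [QuotientGroup.mk'_apply, QuotientGroup.eq_one_iff, Subgroup.mem_centralizer_iff]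
    exact forall_congr' fun y => imp_congr_right fun _ => eq_comm
  obtain ⟨m, hm, hcard⟩ := exists_isSymplecticShape p hp χ hχ hr _ hAp
    ((abelianSocle_conjInvariant r).mono le_top) (abelianSocle_le_sSup r) (abelianSocle_comm r)
    (abelianSocle_pow r) hA hnd (QuotientGroup.mk' C) (QuotientGroup.mk'_surjective C) hker
  obtain ⟨s, -, ⟨α⟩⟩ := h.exists_algEquiv_matrix_of_mem_socleBlocks hp hsp hB
  -- The envelope has dimension `s²` as a matrix algebra and `|A| = r ^ (2m)` by the coset basis.
  have hs : s = r ^ m := by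
    have h1 := h.finrank_algSpan hp hAp (abelianSocle_comm r) hnd
    rw [α.toLinearEquiv.finrank_eq, Module.finrank_matrix, hcard] at h1
    simp only [Fintype.card_fin, Module.finrank_self, mul_one] at h1
    rw [pow_mul'] at h1
    exact Nat.pow_left_injective (n := 2) (by norm_num) (by simpa [sq] using h1)
  subst hs
  exact ⟨m, K ⧸ C, inferInstance, _, QuotientGroup.mk'_surjective C, hker, hm, ⟨α⟩⟩

theorem conj_mem_algSpan {X Y : Subgroup K} {g : K} (hXY : ∀ x ∈ X, g * x * g⁻¹ ∈ Y)
    {a : Module.End E V} (ha : a ∈ algSpan ρ X) : ρ g * a * ρ g⁻¹ ∈ algSpan ρ Y := by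
  let c : Module.End E V ≃ₐ[E] Module.End E V :=
    MulSemiringAction.toAlgEquiv (G := ConjAct (Module.End E V)ˣ) E _
      (ConjAct.toConjAct (ρ.toHomUnits g))
  have hc : ∀ b, c b = ρ g * b * ρ g⁻¹ := fun b => ConjAct.units_smul_def _ _
  have h1 : algSpan ρ X ≤ (algSpan ρ Y).comap c.toAlgHom := algSpan_le.2 fun x hx => by
    change c (ρ x) ∈ algSpan ρ Y
    rw [hc, ← map_mul, ← map_mul]
    exact apply_mem_algSpan (hXY x hx)
  have h2 : c a ∈ algSpan ρ Y := h1 ha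
  rwa [hc] at h2

/-- Matrix algebra homomorphisms can be transported by conjugation. -/
theorem exists_algHom_conj {s : ℕ} {X Y : Subgroup K} {g : K} (hXY : ∀ x ∈ X, g * x * g⁻¹ ∈ Y)
    (α : algSpan ρ X ≃ₐ[E] Matrix (Fin s) (Fin s) E) :
    ∃ β : Matrix (Fin s) (Fin s) E →ₐ[E] Module.End E V, ∀ a, β a ∈ algSpan ρ Y := by
  let c : Module.End E V ≃ₐ[E] Module.End E V :=
    MulSemiringAction.toAlgEquiv (G := ConjAct (Module.End E V)ˣ) E _
      (ConjAct.toConjAct (ρ.toHomUnits g))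
  have hc : ∀ b, c b = ρ g * b * ρ g⁻¹ := fun b => ConjAct.units_smul_def _ _
  refine ⟨(c.toAlgHom.comp (algSpan ρ X).val).comp α.symm.toAlgHom, fun a => ?_⟩
  change c (α.symm a) ∈ algSpan ρ Y
  rw [hc]
  exact conj_mem_algSpan hXY (α.symm a).2

/-- The action of `K` on an orbit of nonabelian simple factors of the socle gives a factor of
wreath type. -/
theorem IsCentralBase.exists_wreath_factor [Finite E] [Module.Finite E V]
    [Nontrivial V] (h : IsCentralBase ρ ((socle Q).comap p)) (hp : p.ker = Subgroup.center K)
    (hsp : socle Q ≤ p.range) {T : Subgroup Q} (hT : T ∈ simpleFactors Q) :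
    ∃ (s t : ℕ) (U : Fin t → Subgroup Q) (H : Type u) (_ : Group H) (θ : K →* H), s ≠ 0 ∧
      Function.Injective U ∧ Set.range U = Set.range (fun k => conjBy (p k) T) ∧
      Function.Surjective θ ∧ (∀ k, θ k = 1 ↔ ∀ i y, p y ∈ U i → k * y = y * k) ∧
      IsWreathShape E H s t ∧
      ∀ i, ∃ β : Matrix (Fin s) (Fin s) E →ₐ[E] Module.End E V,
        ∀ a, β a ∈ algSpan ρ ((U i).comap p) := by
  have hTs := isSimpleGroup_of_mem_simpleFactors hT
  obtain ⟨s, hs, ⟨α⟩⟩ := h.exists_algEquiv_matrix_of_mem_socleBlocks hp hsp (Or.inr hT)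
  let Ω := Set.range fun k => conjBy (p k) T
  let t := Nat.card Ω
  let U' : Fin t ≃ Ω := (Finite.equivFin Ω).symm
  let U : Fin t → Subgroup Q := fun i => U' i
  have hUi : Function.Injective U := Subtype.val_injective.comp U'.injective
  have hUr : Set.range U = Ω := by
    rw [show U = Subtype.val ∘ U' from rfl, U'.surjective.range_comp, Subtype.range_coe]
  have hg : ∀ i, ∃ g : K, U i = conjBy (p g) T := fun i => by
    obtain ⟨g, hg⟩ := (U' i).2
    exact ⟨g, hg.symm⟩
  choose g hg using hg
  have hUs : ∀ i, U i ∈ simpleFactors Q := fun i => by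
    rw [hg]; exact conjBy_mem_simpleFactors hT _
  have ht : 1 ≤ t := by
    have : Nonempty Ω := ⟨⟨_, 1, rfl⟩⟩
    exact Nat.card_pos
  obtain ⟨H, _, θ, hθ, hker, hshape⟩ := h.exists_isWreathShape hp
    ((simpleFactors_le_socle hT).trans hsp) hT.2 α ht U hUi g hg (fun k i => by
      have : conjBy (p k) (U i) ∈ Set.range U := by
        rw [hUr, hg, ← conjBy_mul, ← map_mul]
        exact ⟨_, rfl⟩
      obtain ⟨j, hj⟩ := this
      exact ⟨j, hj.symm⟩)
    (fun i j hij => simpleFactors_commute (hUs i) (hUs j) fun h => hij (hUi h))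
  refine ⟨s, t, U, H, _, θ, hs.out, hUi, hUr, hθ, hker, hshape, fun i => ?_⟩
  refine exists_algHom_conj (g := g i) (fun x hx => ?_) α
  rw [Subgroup.mem_comap, hg, map_mul, map_mul, map_inv]
  exact conj_mem_conjBy hx

/-- A family of surjections whose common kernel is the center makes the central quotient a
subdirect product. -/
theorem exists_subdirect_of_family {ι : Type*} [Fintype ι] (H : ι → Type u) [∀ i, Group (H i)]
    (θ : ∀ i, K →* H i) (hθ : ∀ i, Function.Surjective (θ i))
    (hker : ∀ k, (∀ i, θ i k = 1) ↔ k ∈ Subgroup.center K) (κ : ι → FactorKind)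
    (hκ : ∀ i, IsFactorOfKind E (H i) (κ i)) {d : ℕ} (hd : ∏ i, (κ i).degree ∣ d)
    (huniq : ∀ (r m m' : ℕ) (i j : ι), κ i = .symplectic r m → κ j = .symplectic r m' → i = j) :
    ∃ (k : ℕ) (H : Fin k → Type u) (_ : ∀ i, Group (H i)) (κ : Fin k → FactorKind)
      (D : Subgroup (∀ i, H i)),
      (∀ i (x : H i), ∃ y ∈ D, y i = x) ∧
      Nonempty ((K ⧸ Subgroup.center K) ≃* D) ∧
      (∀ i, IsFactorOfKind E (H i) (κ i)) ∧
      (∏ i, (κ i).degree) ∣ d ∧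
      ∀ (r m m' : ℕ) (i j : Fin k),
        κ i = .symplectic r m → κ j = .symplectic r m' → i = j := by
  let e : ι ≃ Fin (Fintype.card ι) := Fintype.equivFin ι
  let Θ : K →* ∀ i, H (e.symm i) := MonoidHom.pi fun i => θ (e.symm i)
  have hΘ : Θ.ker = Subgroup.center K := by
    ext k
    rw [MonoidHom.mem_ker, ← hker, funext_iff]
    exact ⟨fun h i => by
      obtain ⟨j, rfl⟩ := e.symm.surjective i
      exact h j, fun h i => h _⟩
  refine ⟨_, fun i => H (e.symm i), fun i => inferInstance, fun i => κ (e.symm i), Θ.range, ?_, ?_,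
    fun i => hκ _, ?_, ?_⟩
  · intro i x
    obtain ⟨k, hk⟩ := hθ _ x
    exact ⟨Θ k, ⟨k, rfl⟩, hk⟩
  · exact ⟨(QuotientGroup.quotientMulEquivOfEq hΘ.symm).trans
      (QuotientGroup.quotientKerEquivRange Θ)⟩
  · rwa [e.symm.prod_comp fun i => (κ i).degree]
  · intro r m m' i j hi hj
    exact e.symm.injective (huniq r m m' _ _ hi hj)

/-- The structure of a group modulo its center, in terms of the socle of a group in which it
embeds modulo its center. -/
theorem IsCentralBase.exists_subdirect [Finite E] [Module.Finite E V]
    [Nontrivial V] (h : IsCentralBase ρ ((socle Q).comap p)) (hp : p.ker = Subgroup.center K)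
    (hpn : p.range.Normal) (hsp : socle Q ≤ p.range) :
    ∃ (k : ℕ) (H : Fin k → Type u) (_ : ∀ i, Group (H i)) (κ : Fin k → FactorKind)
      (D : Subgroup (∀ i, H i)),
      (∀ i (x : H i), ∃ y ∈ D, y i = x) ∧
      Nonempty ((K ⧸ Subgroup.center K) ≃* D) ∧
      (∀ i, IsFactorOfKind E (H i) (κ i)) ∧
      (∏ i, (κ i).degree) ∣ Module.finrank E V ∧
      ∀ (r m m' : ℕ) (i j : Fin k),
        κ i = .symplectic r m → κ j = .symplectic r m' → i = j := by
  classical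
  -- One factor for each prime, so a prime occurs at most once, and one for each `K`-orbit of simple
  -- factors.
  let ι₁ := {r : ℕ // r.Prime ∧ abelianSocle Q r ≠ ⊥}
  let orb : Subgroup Q → Set (Subgroup Q) := fun T => Set.range fun k : K => conjBy (p k) T
  let ι₂ := {Ω : Set (Subgroup Q) // ∃ T ∈ simpleFactors Q, Ω = orb T}
  have horb : ∀ T, ∀ U ∈ orb T, orb U = orb T := by
    rintro T _ ⟨k, rfl⟩
    ext W
    constructor
    · rintro ⟨l, rfl⟩
      exact ⟨l * k, by simp only [map_mul, conjBy_mul]⟩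
    · rintro ⟨l, rfl⟩
      exact ⟨l * k⁻¹, by simp only [← conjBy_mul, ← map_mul, inv_mul_cancel_right]⟩
  have hι₁ : Function.Injective fun r : ι₁ => abelianSocle Q r := by
    intro r s hrs
    by_contra hne
    have h1 := disjoint_abelianSocle (Q := Q)
      ((Nat.coprime_primes r.2.1 s.2.1).2 fun h => hne (Subtype.ext h))
    have hrs' : abelianSocle Q r = abelianSocle Q s := hrs
    rw [← hrs', disjoint_self] at h1
    exact r.2.2 h1
  have : Finite ι₁ := Finite.of_injective _ hι₁
  have : Fintype ι₁ := Fintype.ofFinite _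
  have : Fintype ι₂ := Fintype.ofFinite _
  choose m H₁ G₁ θ₁ hθ₁ hker₁ hsh₁ α using fun r : ι₁ =>
    h.exists_symplectic_factor hp hpn hsp r.2.1 r.2.2
  choose T hT hΩT using fun Ω : ι₂ => Ω.2
  choose s t U H₂ G₂ θ₂ hs hUi hUr hθ₂ hker₂ hsh₂ β hβ using fun Ω : ι₂ =>
    h.exists_wreath_factor hp hsp (hT Ω)
  have hUorb : ∀ Ω i, U Ω i ∈ orb (T Ω) := fun Ω i => by
    have : U Ω i ∈ Set.range (U Ω) := ⟨i, rfl⟩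
    rwa [hUr] at this
  have hUs : ∀ Ω i, U Ω i ∈ simpleFactors Q := fun Ω i => by
    obtain ⟨k, hk⟩ := hUorb Ω i
    rw [← hk]
    exact conjBy_mem_simpleFactors (hT Ω) _
  let κ : ι₁ ⊕ ι₂ → FactorKind :=
    Sum.elim (fun r => .symplectic r (m r)) fun Ω => .wreath (s Ω) (t Ω)
  -- the indices of all blocks
  let J := ι₁ ⊕ Σ Ω : ι₂, Fin (t Ω)
  let B : J → Subgroup Q := Sum.elim (fun r => abelianSocle Q r) fun Ωi => U Ωi.1 Ωi.2
  have hB : ∀ j, B j ∈ socleBlocks Q := by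
    rintro (r | Ωi)
    · exact Or.inl ⟨r, r.2.1, rfl, r.2.2⟩
    · exact Or.inr (hUs _ _)
  have hBi : Function.Injective B := by
    have hnc : ∀ (r : ι₁) Ωi, B (.inl r) ≠ B (.inr Ωi) := by
      intro r Ωi heq
      obtain ⟨x, hx, y, hy, hxy⟩ := (hUs Ωi.1 Ωi.2).2
      have heq' : abelianSocle Q r = U Ωi.1 Ωi.2 := heq
      rw [← heq'] at hx hy
      exact hxy (abelianSocle_comm _ x hx y hy)
    rintro (r | ⟨Ω, i⟩) (r' | ⟨Ω', i'⟩) heq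
    · rw [hι₁ heq]
    · exact absurd heq (hnc _ _)
    · exact absurd heq.symm (hnc _ _)
    · have heq' : U Ω i = U Ω' i' := heq
      have h1 : Ω = Ω' := Subtype.ext (by
        rw [hΩT Ω, hΩT Ω', ← horb _ _ (hUorb Ω i), heq', horb _ _ (hUorb Ω' i')])
      subst h1
      rw [hUi Ω heq']
  let f : J → ℕ := Sum.elim (fun r => (r : ℕ) ^ m r) fun Ωi => s Ωi.1
  have hf : ∀ j, NeZero (f j) := by
    rintro (r | Ωi)
    · exact ⟨pow_ne_zero _ r.2.1.ne_zero⟩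
    · exact ⟨hs Ωi.1⟩
  have hγ : ∀ j, ∃ γ : Matrix (Fin (f j)) (Fin (f j)) E →ₐ[E] Module.End E V,
      ∀ a, γ a ∈ algSpan ρ ((B j).comap p) := by
    rintro (r | Ωi)
    · obtain ⟨a⟩ := α r
      exact ⟨(algSpan ρ _).val.comp a.symm.toAlgHom, fun x => (a.symm x).2⟩
    · exact ⟨β Ωi.1 Ωi.2, hβ Ωi.1 Ωi.2⟩
  choose γ hγ using hγ
  have hdvd := prod_dvd_finrank (E := E) (Finset.univ : Finset J) f V (fun j _ => γ j)
    (fun i j _ _ hij a b => algSpan_commute (fun x hx y hy =>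
      commute_comap_socleBlocks hp hsp (hB i) (hB j) (fun h => hij (hBi h)) x y hx hy)
      _ (hγ i a) _ (hγ j b))
  let HH : ι₁ ⊕ ι₂ → Type u := Sum.elim H₁ H₂
  let _ : ∀ i, Group (HH i) := fun i => match i with
    | .inl r => G₁ r
    | .inr Ω => G₂ Ω
  let θ : ∀ i, K →* HH i := fun i => match i with
    | .inl r => θ₁ r
    | .inr Ω => θ₂ Ω
  refine exists_subdirect_of_family HH θ ?_ (fun k => ?_) κ ?_ ?_ ?_
  · rintro (r | Ω)
    · exact hθ₁ r
    · exact hθ₂ Ω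
  · constructor
    · intro hk
      refine h.mem_center_of_commute hp hsp ?_
      intro W hW y hy
      rcases hW with ⟨r, hr, hWr, hA⟩ | hW
      · rw [hWr] at hy hA
        exact (hker₁ ⟨r, hr, hA⟩ k).1 (hk (.inl ⟨r, hr, hA⟩)) y hy
      · let Ω : ι₂ := ⟨orb W, W, hW, rfl⟩
        have h1 : W ∈ Set.range (U Ω) := by
          rw [hUr]
          change W ∈ orb (T Ω)
          rw [← hΩT Ω]
          exact ⟨1, by simp only [map_one, conjBy_one]⟩
        obtain ⟨i, hi⟩ := h1
        exact (hker₂ Ω k).1 (hk (.inr Ω)) i y (hi ▸ hy)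
    · intro hk
      have hk' : ∀ y, k * y = y * k := fun y => (Subgroup.mem_center_iff.1 hk y).symm
      rintro (r | Ω)
      · exact (hker₁ r k).2 fun y _ => hk' y
      · exact (hker₂ Ω k).2 fun _ y _ => hk' y
  · rintro (r | Ω)
    · exact hsh₁ r
    · exact hsh₂ Ω
  · refine (Eq.dvd ?_).trans hdvd
    -- The blocks of an orbit each contribute `s`, which multiplies to `s ^ t`.
    rw [Fintype.prod_sum_type, Fintype.prod_sum_type, Fintype.prod_sigma]
    congr 1
    refine Finset.prod_congr rfl fun Ω _ => ?_
    simp [f, κ, FactorKind.degree]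
  · rintro r n n' (i | i) (j | j) hi hj
    · simp only [κ, Sum.elim_inl, FactorKind.symplectic.injEq] at hi hj
      rw [Subtype.ext (hi.1.trans hj.1.symm)]
    · simp [κ] at hj
    · simp [κ] at hi
    · simp [κ] at hi

end Factors
end LinearGroups

namespace LinearGroups

/-! ### From homogeneous modules to homogeneous algebras. -/

section HomogeneousGroups

/-- A nonzero submodule contains a simple one; what kills it kills all its isomorphic copies, and
these span. -/
theorem smul_eq_zero_of_isIsotypic {R M : Type*} [Ring R] [AddCommGroup M] [Module R M]
    [IsSemisimpleModule R M] (h : IsIsotypic R M) {U : Submodule R M} (hU : U ≠ ⊥) {a : R}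
    (ha : ∀ u ∈ U, a • u = 0) : ∀ v : M, a • v = 0 := by
  obtain ⟨S, hSU, hS⟩ := (IsSemisimpleModule.eq_bot_or_exists_simple_le U).resolve_left hU
  have h1 : ∀ S' : Submodule R M, IsSimpleModule R S' → ∀ v ∈ S', a • v = 0 := by
    intro S' hS' v hv
    obtain ⟨f⟩ := h S S'
    have h2 : f (a • ⟨v, hv⟩) = 0 := by
      rw [map_smul]
      exact Subtype.ext (ha _ (hSU (f ⟨v, hv⟩).2))
    exact congrArg Subtype.val ((LinearEquiv.map_eq_zero_iff f).1 h2)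
  intro v
  have hv : v ∈ sSup {m : Submodule R M | IsSimpleModule R m} := by
    rw [IsSemisimpleModule.sSup_simples_eq_top]; trivial
  rw [sSup_eq_iSup'] at hv
  refine Submodule.iSup_induction _ (motive := fun v => a • v = 0) hv
    (fun S' x hx => h1 S' S'.2 x hx) (smul_zero a) fun x y hx hy => ?_
  rw [smul_add, hx, hy, add_zero]

/-- The enveloping algebra of a homogeneous linear group is homogeneous. -/
theorem IsHomogeneous.isHomogeneousAlg {ι : Type} [Fintype ι] [DecidableEq ι] {F : Type u} [Field F]
    {G : Subgroup (GL ι F)} {C : Subgroup G} (h : IsHomogeneous (C.map G.subtype)) :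
    IsHomogeneousAlg (algSpan (glRep G) C) := by
  obtain ⟨hss, hiso⟩ := h
  let σ := glRep (C.map G.subtype)
  have hσ : ∀ (g : G) (hg : g ∈ C), σ ⟨g, Subgroup.mem_map_of_mem _ hg⟩ = glRep G g :=
    fun g hg => rfl
  intro U hU hUb a ha haU
  have hle : algSpan (glRep G) C ≤ σ.asAlgebraHom.range := algSpan_le.2 fun g hg =>
    ⟨MonoidAlgebra.of F _ ⟨g, Subgroup.mem_map_of_mem _ hg⟩, by
      change σ.asAlgebraHom _ = _
      rw [Representation.asAlgebraHom_of, hσ g hg]⟩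
  have hge : ∀ x, σ.asAlgebraHom x ∈ algSpan (glRep G) C := by
    intro x
    induction x using MonoidAlgebra.induction_on with
    | of g =>
      rw [Representation.asAlgebraHom_of]
      obtain ⟨_, g, hg, rfl⟩ := g
      rw [show (⟨G.subtype g, g, hg, rfl⟩ : C.map G.subtype) =
        ⟨g, Subgroup.mem_map_of_mem _ hg⟩ from rfl, hσ g hg]
      exact apply_mem_algSpan hg
    | add x y hx hy => rw [map_add]; exact add_mem hx hy
    | smul r x hx => rw [map_smul]; exact Subalgebra.smul_mem _ hx r
  obtain ⟨x, hx⟩ := hle ha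
  have hx : σ.asAlgebraHom x = a := hx
  let U' : Submodule (MonoidAlgebra F (C.map G.subtype)) σ.asModule :=
    { carrier := {v | σ.asModuleEquiv v ∈ U}
      add_mem' := fun {v w} hv hw => by
        rw [Set.mem_ofPred_eq, map_add]; exact U.add_mem hv hw
      zero_mem' := by rw [Set.mem_ofPred_eq, map_zero]; exact U.zero_mem
      smul_mem' := fun y v hv => by
        rw [Set.mem_ofPred_eq, Representation.asModuleEquiv_map_smul]
        exact hU _ (hge y) _ hv }
  have hU' : U' ≠ ⊥ := by
    obtain ⟨u, hu, hu0⟩ := (Submodule.ne_bot_iff U).1 hUb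
    refine (Submodule.ne_bot_iff U').2 ⟨σ.asModuleEquiv.symm u, ?_, ?_⟩
    · change σ.asModuleEquiv (σ.asModuleEquiv.symm u) ∈ U
      rwa [LinearEquiv.apply_symm_apply]
    · rwa [Ne, LinearEquiv.map_eq_zero_iff]
  have key := smul_eq_zero_of_isIsotypic hiso hU' (a := x) fun u hu => by
    apply σ.asModuleEquiv.injective
    rw [Representation.asModuleEquiv_map_smul, hx, map_zero]
    exact haU _ hu
  refine LinearMap.ext fun v => ?_
  have h1 := congrArg σ.asModuleEquiv (key (σ.asModuleEquiv.symm v))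
  rwa [Representation.asModuleEquiv_map_smul, hx, map_zero, LinearEquiv.apply_symm_apply] at h1

end HomogeneousGroups

/-! ### The center of the envelope as a field of scalars. -/

section CenterField

variable {F V : Type u} [Field F] [AddCommGroup V] [Module F V]

/-- The center of a homogeneous algebra of endomorphisms is a field. -/
theorem IsHomogeneousAlg.exists_field [Finite F] [Module.Finite F V] [Nontrivial V]
    {𝓝 : Subalgebra F (Module.End F V)} (h : IsHomogeneousAlg 𝓝) :
    ∃ (E : Type u) (_ : Field E) (_ : Algebra F E) (_ : Module E V) (_ : IsScalarTower F E V)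
      (_ : Finite E), ∀ a : Module.End F V, (a ∈ 𝓝 ∧ ∀ b ∈ 𝓝, a * b = b * a) ↔
        ∃ c : E, ∀ v, a v = c • v := by
  let 𝓒 : Subalgebra F (Module.End F V) :=
    𝓝 ⊓ Subalgebra.centralizer F (𝓝 : Set (Module.End F V))
  have h𝓒 : ∀ a, a ∈ 𝓒 ↔ a ∈ 𝓝 ∧ ∀ b ∈ 𝓝, a * b = b * a := fun a => by
    rw [Algebra.mem_inf, Subalgebra.mem_centralizer_iff]
    exact and_congr_right fun _ => forall_congr' fun b => imp_congr_right fun _ => eq_comm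
  -- The kernel of a central element is invariant, so homogeneity leaves only injective or zero. The
  -- center is then a finite domain, hence a field.
  have hinj : ∀ a ∈ 𝓒, a ≠ 0 → ∀ v, a v = 0 → v = 0 := by
    intro a ha ha0 v hv
    by_contra hv0
    apply ha0
    rw [h𝓒] at ha
    refine h (LinearMap.ker a) (fun b hb u hu => ?_) (fun hb => hv0 ?_) a ha.1 fun u hu => hu
    · rw [LinearMap.mem_ker] at hu ⊢
      rw [← Module.End.mul_apply, ha.2 b hb, Module.End.mul_apply, hu, map_zero]
    · have : v ∈ LinearMap.ker a := hv
      rwa [hb, Submodule.mem_bot] at this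
  have : Finite V := Module.finite_of_finite F
  have : Finite (Module.End F V) := Module.finite_of_finite F
  let inst : CommRing 𝓒 :=
    { (inferInstance : Ring 𝓒) with
      mul_comm := fun a b => Subtype.ext (((h𝓒 _).1 a.2).2 b ((h𝓒 _).1 b.2).1) }
  have hd : NoZeroDivisors 𝓒 := ⟨fun {a b} hab => by
    by_contra! hne
    apply hne.2
    refine Subtype.ext (LinearMap.ext fun v => ?_)
    refine hinj a a.2 (fun h => hne.1 (Subtype.ext h)) _ ?_
    exact LinearMap.congr_fun (congrArg Subtype.val hab) v⟩
  have : IsDomain 𝓒 := NoZeroDivisors.to_isDomain 𝓒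
  have hF := Finite.isField_of_domain 𝓒
  let fld : Field 𝓒 := hF.toField
  refine ⟨𝓒, fld, (inferInstance : Algebra F 𝓒), (inferInstance : Module 𝓒 V),
    (inferInstance : IsScalarTower F 𝓒 V), inferInstance, fun a => ?_⟩
  rw [← h𝓒]
  constructor
  · exact fun ha => ⟨⟨a, ha⟩, fun v => rfl⟩
  · rintro ⟨c, hc⟩
    have hac : a = c.1 := LinearMap.ext hc
    rw [hac]
    exact c.2

variable {E : Type u} [Field E] [Algebra F E] [Module E V] [IsScalarTower F E V]

/-- An `𝓐`-invariant `E`-subspace is also invariant under the `F`-algebra generated by `S`, so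
homogeneity passes to the larger field. -/
theorem IsHomogeneousAlg.of_restrictScalars {S : Set (Module.End F V)}
    (h : IsHomogeneousAlg (Algebra.adjoin F S)) {𝓐 : Subalgebra E (Module.End E V)}
    (h1 : ∀ a ∈ 𝓐, a.restrictScalars F ∈ Algebra.adjoin F S)
    (h2 : ∀ s ∈ S, ∃ a ∈ 𝓐, a.restrictScalars F = s) : IsHomogeneousAlg 𝓐 := by
  intro U hU hUb a ha haU
  let W : Subalgebra F (Module.End F V) :=
    { carrier := {b | ∀ u ∈ U, b u ∈ U}
      mul_mem' := fun {a b} ha hb u hu => ha _ (hb u hu)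
      add_mem' := fun {a b} ha hb u hu => U.add_mem (ha u hu) (hb u hu)
      algebraMap_mem' := fun c u hu => by
        rw [Module.algebraMap_end_apply, ← algebraMap_smul E]
        exact U.smul_mem _ hu }
  have hle : Algebra.adjoin F S ≤ W := by
    rw [Algebra.adjoin_le_iff]
    intro s hs u hu
    obtain ⟨b, hb, rfl⟩ := h2 s hs
    exact hU b hb u hu
  have := h (U.restrictScalars F) (fun b hb u hu => hle hb u hu)
    (fun hb => hUb (by simpa using hb)) _ (h1 a ha) haU
  exact LinearMap.ext fun v => LinearMap.congr_fun this v

/-- A group of endomorphisms that normalizes the scalars acts on them by automorphisms. -/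
theorem exists_hom_algEquiv [Nontrivial V] {G : Type*} [Group G] (ρ : G →* Module.End F V)
    (h : ∀ g (c : E), ∃ c' : E, ∀ v, ρ g (c • v) = c' • ρ g v) :
    ∃ Ψ : G →* (E ≃ₐ[F] E), ∀ g c v, ρ g (c • v) = Ψ g c • ρ g v := by
  choose σ hσ using h
  have hinv : ∀ g v, ρ g (ρ g⁻¹ v) = v := fun g v => by
    rw [← Module.End.mul_apply, ← map_mul, mul_inv_cancel, map_one]; rfl
  have huniq : ∀ g (c c' : E), (∀ v, ρ g (c • v) = c' • ρ g v) → σ g c = c' := fun g c c' hc => by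
    refine FaithfulSMul.eq_of_smul_eq_smul (α := V) fun v => ?_
    rw [← hinv g v, ← hσ, hc]
  have hσmul : ∀ g g' c, σ (g * g') c = σ g (σ g' c) := fun g g' c => huniq _ _ _ fun v => by
    rw [map_mul, Module.End.mul_apply, hσ, hσ, Module.End.mul_apply]
  have hσone : ∀ c, σ 1 c = c := fun c => huniq _ _ _ fun v => by rw [map_one]; rfl
  let Ψ : G → (E ≃ₐ[F] E) := fun g =>
    { toFun := σ g
      invFun := σ g⁻¹
      left_inv := fun c => by rw [← hσmul, inv_mul_cancel, hσone]
      right_inv := fun c => by rw [← hσmul, mul_inv_cancel, hσone]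
      map_mul' := fun c c' => huniq _ _ _ fun v => by rw [mul_smul, hσ, hσ, mul_smul]
      map_add' := fun c c' => huniq _ _ _ fun v => by rw [add_smul, map_add, hσ, hσ, add_smul]
      commutes' := fun c => huniq _ _ _ fun v => by
        rw [algebraMap_smul, algebraMap_smul, map_smul] }
  exact ⟨MonoidHom.mk' Ψ fun g g' => AlgEquiv.ext (hσmul g g'), hσ⟩

end CenterField

/-! ### The centralizer of a maximal commutative characteristic subgroup. -/

section CharacteristicSubgroups

/-- A finite group has a characteristic subgroup `M` all of whose commutative characteristic
subgroups are central, and which is the centralizer of its center. -/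
theorem exists_characteristic_centralizer (G : Type*) [Group G] [Finite G] :
    ∃ M : Subgroup G, M.Characteristic ∧
      (∀ C : Subgroup M, C.Characteristic → (∀ x ∈ C, ∀ y ∈ C, x * y = y * x) →
        C ≤ Subgroup.center M) ∧
      ∀ x : G, (∀ z : M, z ∈ Subgroup.center M → x * z = z * x) → x ∈ M := by
  let S : Set (Subgroup G) := {Z | Z.Characteristic ∧ ∀ x ∈ Z, ∀ y ∈ Z, x * y = y * x}
  obtain ⟨Z, hZ⟩ := (Set.toFinite S).exists_maximal ⟨⊥, inferInstance, by
    intro x hx y hy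
    rw [Subgroup.mem_bot] at hx hy
    rw [hx, hy]⟩
  have hZc : Z.Characteristic := hZ.prop.1
  have hM : ∀ x, x ∈ Subgroup.centralizer (Z : Set G) ↔ ∀ z ∈ Z, z * x = x * z := fun x =>
    Subgroup.mem_centralizer_iff
  refine ⟨Subgroup.centralizer (Z : Set G), inferInstance, ?_, ?_⟩
  · intro C hC hCc
    let C' := C.map (Subgroup.centralizer (Z : Set G)).subtype
    -- `C'` centralizes `Z`, so the join is again commutative and characteristic; maximality puts
    -- `C'` inside `Z`, which is central in the centralizer.
    have hsup : Z ⊔ C' ∈ S := by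
      refine ⟨inferInstance, ?_⟩
      rw [← sSup_pair]
      refine commute_of_mem_sSup ?_
      rintro A (rfl | rfl) B (rfl | rfl)
      · exact hZ.prop.2
      · rintro x hx _ ⟨y, hy, rfl⟩
        exact (hM _).1 y.2 x hx
      · rintro _ ⟨y, hy, rfl⟩ x hx
        exact ((hM _).1 y.2 x hx).symm
      · rintro _ ⟨x, hx, rfl⟩ _ ⟨y, hy, rfl⟩
        exact congrArg Subtype.val (hCc x hx y hy)
    have hle : C' ≤ Z := le_sup_right.trans (hZ.le_of_ge hsup le_sup_left)
    intro x hx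
    rw [Subgroup.mem_center_iff]
    intro y
    exact Subtype.ext ((hM _).1 y.2 x (hle (Subgroup.mem_map_of_mem _ hx))).symm
  · intro x hx
    rw [hM]
    intro z hz
    refine (hx ⟨z, (hM z).2 fun y hy => hZ.prop.2 y hy z hz⟩ ?_).symm
    rw [Subgroup.mem_center_iff]
    intro y
    exact Subtype.ext ((hM _).1 y.2 z hz).symm

end CharacteristicSubgroups

/-! ### Passing from `M` to `K`. -/

section CentralBase

/-- The structure of a normal subgroup `K` of a group `M` without noncentral commutative
characteristic subgroups, provided that `K` contains the preimage of the socle of `M ⧸ Z(M)`. -/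
theorem isCentralBase_of_socleOverCenter_le {E V K M : Type u} [Field E] [AddCommGroup V]
    [Module E V] [Group K] [Group M] [Finite M]
    (hM : ∀ C : Subgroup M, C.Characteristic → (∀ x ∈ C, ∀ y ∈ C, x * y = y * x) →
      C ≤ Subgroup.center M) {ι : K →* M} (hι : Function.Injective ι)
    (hN : socleOverCenter M ≤ ι.range) {ρ : K →* Module.End E V} (hρ : Function.Injective ρ)
    (hhom : IsHomogeneousAlg (algSpan ρ ((socleOverCenter M).comap ι)))
    (hsc : ∀ a ∈ algSpan ρ ((socleOverCenter M).comap ι),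
      (∀ b ∈ algSpan ρ ((socleOverCenter M).comap ι), a * b = b * a) →
      ∃ c : E, a = algebraMap E (Module.End E V) c) :
    ((QuotientGroup.mk' (Subgroup.center M)).comp ι).ker = Subgroup.center K ∧
      IsCentralBase ρ ((socleOverCenter M).comap ι) := by
  have h1 : ∀ x, (∀ y, ι y ∈ socleOverCenter M → x * y = y * x) → ι x ∈ Subgroup.center M := by
    intro x hx
    refine centralizer_socleOverCenter hM (Subgroup.mem_centralizer_iff.2 fun m hm => ?_)
    obtain ⟨y, rfl⟩ := hN hm
    rw [← map_mul, ← map_mul, hx y hm]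
  have h2 : ∀ x, ι x ∈ Subgroup.center M → x ∈ Subgroup.center K := by
    intro x hx
    rw [Subgroup.mem_center_iff] at hx ⊢
    intro y
    apply hι
    rw [map_mul, map_mul, hx]
  have h3 : ∀ x ∈ Subgroup.center K, ι x ∈ Subgroup.center M := fun x hx =>
    h1 x fun y _ => (Subgroup.mem_center_iff.1 hx y).symm
  refine ⟨?_, hρ, fun x hx => center_le_socleOverCenter (h3 x hx), fun x hx => h2 x (h1 x hx),
    hhom, hsc⟩
  ext x
  rw [MonoidHom.mem_ker, MonoidHom.comp_apply, QuotientGroup.mk'_apply,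
    QuotientGroup.eq_one_iff]
  exact ⟨h2 x, h3 x⟩

end CentralBase
end LinearGroups

namespace LinearGroups

/-! ### Linear groups over the extension field. -/

section FieldExtensionSubgroups

variable {F E : Type u} [Field F] [Field E] [Algebra F E] {n d : ℕ} [Module E (Fin n → F)]

/-- The image of `GL(d, E)` consists of the elements that commute with the scalars from `E`. -/
theorem mem_range_glEmb {φ : (Fin n → F) ≃ₗ[F] (Fin d → E)}
    (hφ : ∀ (c : E) v, φ (c • v) = c • φ v) {g : GL (Fin n) F} :
    g ∈ (glEmb φ).range ↔ ∀ (c : E) v, g.val *ᵥ (c • v) = c • (g.val *ᵥ v) := by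
  constructor
  · rintro ⟨x, rfl⟩ c v
    apply φ.injective
    rw [glEmb_mulVec, hφ, hφ, Matrix.mulVec_smul, glEmb_mulVec]
  · intro h
    have hφ' : ∀ (c : E) w, φ.symm (c • w) = c • φ.symm w := fun c w => by
      rw [LinearEquiv.symm_apply_eq, hφ, LinearEquiv.apply_symm_apply]
    have hg : ∀ v, g.val *ᵥ (g⁻¹.val *ᵥ v) = v := fun v => by
      rw [Matrix.mulVec_mulVec, ← Units.val_mul, mul_inv_cancel, Units.val_one, Matrix.one_mulVec]
    have hg' : ∀ v, g⁻¹.val *ᵥ (g.val *ᵥ v) = v := fun v => by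
      rw [Matrix.mulVec_mulVec, ← Units.val_mul, inv_mul_cancel, Units.val_one, Matrix.one_mulVec]
    have h' : ∀ (c : E) v, g⁻¹.val *ᵥ (c • v) = c • (g⁻¹.val *ᵥ v) := fun c v => by
      rw [← hg' (c • (g⁻¹.val *ᵥ v)), h, hg]
    let L : (Fin d → E) →ₗ[E] (Fin d → E) :=
      { toFun := fun w => φ (g.val *ᵥ φ.symm w)
        map_add' := fun v w => by rw [map_add, Matrix.mulVec_add, map_add]
        map_smul' := fun c w => by rw [hφ', h, hφ]; rfl }
    let L' : (Fin d → E) →ₗ[E] (Fin d → E) :=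
      { toFun := fun w => φ (g⁻¹.val *ᵥ φ.symm w)
        map_add' := fun v w => by rw [map_add, Matrix.mulVec_add, map_add]
        map_smul' := fun c w => by rw [hφ', h', hφ]; rfl }
    have hLL' : L.comp L' = LinearMap.id := LinearMap.ext fun w => by
      change φ (g.val *ᵥ φ.symm (φ (g⁻¹.val *ᵥ φ.symm w))) = w
      rw [LinearEquiv.symm_apply_apply, hg, LinearEquiv.apply_symm_apply]
    have hL'L : L'.comp L = LinearMap.id := LinearMap.ext fun w => by
      change φ (g⁻¹.val *ᵥ φ.symm (φ (g.val *ᵥ φ.symm w))) = w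
      rw [LinearEquiv.symm_apply_apply, hg', LinearEquiv.apply_symm_apply]
    refine ⟨⟨LinearMap.toMatrix' L, LinearMap.toMatrix' L', ?_, ?_⟩, ?_⟩
    · rw [← LinearMap.toMatrix'_comp, hLL', LinearMap.toMatrix'_id]
    · rw [← LinearMap.toMatrix'_comp, hL'L, LinearMap.toMatrix'_id]
    · apply Units.ext
      refine Matrix.ext_of_mulVec_single fun i => φ.injective ?_
      rw [glEmb_mulVec]
      change LinearMap.toMatrix' L *ᵥ _ = _
      rw [LinearMap.toMatrix'_mulVec]
      change φ (g.val *ᵥ φ.symm (φ _)) = _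
      rw [LinearEquiv.symm_apply_apply]

/-- The center of `K` consists of scalars if its elements act as scalars. -/
theorem map_center_eq_inf {φ : (Fin n → F) ≃ₗ[F] (Fin d → E)}
    (hφ : ∀ (c : E) v, φ (c • v) = c • φ v) {K : Subgroup (GL (Fin n) F)}
    (hK : K ≤ (glEmb φ).range)
    (hc : ∀ z ∈ Subgroup.center K, ∃ c : E, ∀ v, (z : GL (Fin n) F).val *ᵥ v = c • v) :
    (Subgroup.center K).map K.subtype =
      K ⊓ (Subgroup.center (GL (Fin d) E)).map (glEmb φ) := by
  apply le_antisymm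
  · rintro _ ⟨z, hz, rfl⟩
    refine ⟨z.2, ?_⟩
    obtain ⟨y, hy⟩ := hK z.2
    obtain ⟨c, hc⟩ := hc z hz
    refine ⟨y, Subgroup.mem_center_iff.2 fun g => ?_, hy⟩
    have hyc : ∀ w, y.val *ᵥ w = c • w := fun w => by
      obtain ⟨v, rfl⟩ := φ.surjective w
      rw [← glEmb_mulVec, hy, ← hφ]
      exact congrArg φ (hc v)
    apply Units.ext
    refine Matrix.ext_of_mulVec_single fun i => ?_
    rw [Units.val_mul, Units.val_mul, ← Matrix.mulVec_mulVec, ← Matrix.mulVec_mulVec, hyc, hyc,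
      Matrix.mulVec_smul]
  · rintro _ ⟨hzK, y, hy, rfl⟩
    refine ⟨⟨_, hzK⟩, Subgroup.mem_center_iff.2 fun k => Subtype.ext ?_, rfl⟩
    obtain ⟨x, hx⟩ := hK k.2
    rw [Subgroup.coe_mul, Subgroup.coe_mul, ← hx, ← map_mul, ← map_mul,
      Subgroup.mem_center_iff.1 hy]

end FieldExtensionSubgroups

theorem glRep_injective {ι F : Type*} [Fintype ι] [DecidableEq ι] [Field F]
    (G : Subgroup (GL ι F)) : Function.Injective (glRep G) := fun _ _ hgh =>
  Subtype.ext (Units.ext (Matrix.ext_of_mulVec_single fun _ => LinearMap.congr_fun hgh _))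

end LinearGroups

/-! ### The main theorem. -/

open LinearGroups in
theorem lemma2p4 {F : Type u} [Field F] [Finite F] (n : ℕ) (hn : 1 ≤ n)
    (G : Subgroup (GL (Fin n) F)) (hG : IsWeaklyQuasiprimitive G) :
    ∃ e : ℕ, 1 ≤ e ∧ e ∣ n ∧
    ∃ (E : Type u) (_ : Field E) (_ : Algebra F E) (φ : (Fin n → F) ≃ₗ[F] (Fin (n / e) → E)),
      Module.finrank F E = e ∧
      G ≤ gammaL φ ∧
      ∃ K : Subgroup (GL (Fin n) F), K = G ⊓ (glEmb φ).range ∧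
        K.relIndex G ∣ e ∧
        (∃ M : Subgroup (GL (Fin n) F), K ≤ M ∧ M ≤ G ∧
          ∃ (_ : (M.subgroupOf G).Normal) (_ : (K.subgroupOf M).Normal),
            IsCyclic (G ⧸ M.subgroupOf G) ∧ IsCyclic (M ⧸ K.subgroupOf M)) ∧
        (Subgroup.center K).map K.subtype =
          K ⊓ (Subgroup.center (GL (Fin (n / e)) E)).map (glEmb φ) ∧
        ∃ (k : ℕ) (H : Fin k → Type u) (_ : ∀ i, Group (H i)) (κ : Fin k → FactorKind)
          (D : Subgroup (∀ i, H i)),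
          (∀ i (x : H i), ∃ y ∈ D, y i = x) ∧
          Nonempty ((K ⧸ Subgroup.center K) ≃* D) ∧
          (∀ i, IsFactorOfKind E (H i) (κ i)) ∧
          (∏ i, (κ i).degree) ∣ n / e ∧
          ∀ (r m m' : ℕ) (i j : Fin k),
            κ i = .symplectic r m → κ j = .symplectic r m' → i = j := by
  have : Nonempty (Fin n) := ⟨⟨0, hn⟩⟩
  obtain ⟨M, hMchar, hMc, hMcen⟩ := exists_characteristic_centralizer G
  have hNM : (socleOverCenter M).Characteristic := socleOverCenter_characteristic
  let NG : Subgroup G := (socleOverCenter M).map M.subtype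
  have hNG : NG.Characteristic := inferInstance
  have h𝓝 : IsHomogeneousAlg (algSpan (glRep G) NG) := (hG NG hNG).isHomogeneousAlg
  obtain ⟨E, _, _, _, _, _, hE⟩ := h𝓝.exists_field
  -- the scalars from `E` form the center of the enveloping algebra
  have hsc : ∀ c : E, ∃ a ∈ algSpan (glRep G) NG,
      (∀ b ∈ algSpan (glRep G) NG, a * b = b * a) ∧ ∀ v, a v = c • v := fun c =>
    let a : Module.End F (Fin n → F) :=
      { toFun := fun v => c • v
        map_add' := smul_add c
        map_smul' := fun r v => smul_comm c r v }
    have ha := (hE a).2 ⟨c, fun v => rfl⟩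
    ⟨a, ha.1, ha.2, fun v => rfl⟩
  have hinv : ∀ (g : G) v, glRep G g⁻¹ (glRep G g v) = v := fun g v => by
    rw [← Module.End.mul_apply, ← map_mul, inv_mul_cancel, map_one]; rfl
  have hconj : ∀ (g : G), ∀ a ∈ algSpan (glRep G) NG,
      glRep G g * a * glRep G g⁻¹ ∈ algSpan (glRep G) NG := fun g a ha =>
    conj_mem_algSpan (fun x hx => (inferInstance : NG.Normal).conj_mem x hx g) ha
  have hnorm : ∀ (g : G) (c : E), ∃ c' : E, ∀ v, glRep G g (c • v) = c' • glRep G g v := by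
    intro g c
    obtain ⟨a, ha, hac, hav⟩ := hsc c
    -- Conjugation by `g` preserves the envelope, hence its center.
    obtain ⟨c', hc'⟩ := (hE (glRep G g * a * glRep G g⁻¹)).1 ⟨hconj g a ha, fun b hb => by
      have h1 := hac _ (hconj g⁻¹ b hb)
      rw [inv_inv] at h1
      have h2 : glRep G g * glRep G g⁻¹ = 1 := by rw [← map_mul, mul_inv_cancel, map_one]
      calc glRep G g * a * glRep G g⁻¹ * b
          = glRep G g * (a * (glRep G g⁻¹ * b * glRep G g)) * glRep G g⁻¹ := by
            simp only [mul_assoc, h2, mul_one]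
        _ = b * (glRep G g * a * glRep G g⁻¹) := by
            rw [h1]
            simp only [← mul_assoc, h2, one_mul]⟩
    refine ⟨c', fun v => ?_⟩
    rw [← hc' (glRep G g v), Module.End.mul_apply, Module.End.mul_apply, hinv, hav]
  obtain ⟨Ψ, hΨ⟩ := exists_hom_algEquiv (glRep G) hnorm
  have : Module.Finite E (Fin n → F) := Module.Finite.of_restrictScalars_finite F E _
  have : Module.Finite F E := inferInstance
  have hmul : Module.finrank F E * Module.finrank E (Fin n → F) = n := by
    rw [Module.finrank_mul_finrank, Module.finrank_fin_fun]
  have he : 0 < Module.finrank F E := Module.finrank_pos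
  have hd : Module.finrank E (Fin n → F) = n / Module.finrank F E :=
    (Nat.div_eq_of_eq_mul_right he hmul.symm).symm
  -- Coordinates linear over `E`, so that the central scalars become ordinary scalars on `E ^ (n /
  -- e)`.
  let φE := (Module.finBasisOfFinrankEq E (Fin n → F) hd).equivFun
  let φ : (Fin n → F) ≃ₗ[F] (Fin (n / Module.finrank F E) → E) := φE.restrictScalars F
  have hφ : ∀ (c : E) v, φ (c • v) = c • φ v := fun c v => map_smul φE c v
  have hφ' : ∀ (c : E) w, φ.symm (c • w) = c • φ.symm w := fun c w => map_smul φE.symm c w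
  let K : Subgroup (GL (Fin n) F) := G ⊓ (glEmb φ).range
  have hK : ∀ g : G, (g : GL (Fin n) F) ∈ K ↔ Ψ g = 1 := by
    intro g
    have h1 : (g : GL (Fin n) F) ∈ K ↔ (g : GL (Fin n) F) ∈ (glEmb φ).range :=
      and_iff_right g.2
    rw [h1, mem_range_glEmb hφ]
    constructor
    · intro h
      refine AlgEquiv.ext fun c => FaithfulSMul.eq_of_smul_eq_smul (α := Fin n → F) fun v => ?_
      have h2 := hΨ g c (glRep G g⁻¹ v)
      have h3 : glRep G g (glRep G g⁻¹ v) = v := by simp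
      rw [h3] at h2
      rw [← h2]
      refine (h c _).trans ?_
      exact congrArg (fun w => c • w) h3
    · intro h c v
      have h2 := hΨ g c v
      rw [h] at h2
      exact h2
  have hKsc : ∀ k ∈ K, ∀ (c : E) v, k.val *ᵥ (c • v) = c • (k.val *ᵥ v) := fun k hk =>
    (mem_range_glEmb hφ).1 hk.2
  have hKΨ : K.subgroupOf G = Ψ.ker := Subgroup.ext hK
  have hGn : (G.subgroupOf G).Normal := by
    rw [Subgroup.subgroupOf_self]
    infer_instance
  have hKn : (K.subgroupOf G).Normal := by
    rw [hKΨ]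
    infer_instance
  -- `Z(M)` lies in the center of the envelope, so it acts by scalars of `E`, with which `K`
  -- commutes.
  have hKM : ∀ k (hk : k ∈ K), (⟨k, hk.1⟩ : G) ∈ M := by
    intro k hk
    refine hMcen _ fun z hz => ?_
    obtain ⟨c, hc⟩ := (hE (glRep G z)).1 ⟨apply_mem_algSpan
      ⟨z, center_le_socleOverCenter hz, rfl⟩, fun b hb => by
        refine (algSpan_commute_left ?_ b hb).symm
        rintro _ ⟨y, -, rfl⟩
        rw [← map_mul, ← map_mul]
        exact congrArg (glRep G) (congrArg Subtype.val (Subgroup.mem_center_iff.1 hz y))⟩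
    refine glRep_injective G ?_
    rw [map_mul, map_mul]
    refine LinearMap.ext fun v => ?_
    rw [Module.End.mul_apply, Module.End.mul_apply, hc, hc]
    exact hKsc k hk c v
  let ι : K →* M := MonoidHom.mk' (fun k => ⟨⟨k, k.2.1⟩, hKM k k.2⟩) fun _ _ => rfl
  have hι : Function.Injective ι := fun k l h => by
    have h1 : (ι k : G) = ι l := congrArg Subtype.val h
    exact Subtype.ext (congrArg (Subtype.val : G → GL (Fin n) F) h1)
  have hιr : ι.range = (Ψ.comp M.subtype).ker := by
    ext x
    rw [MonoidHom.mem_ker, MonoidHom.comp_apply]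
    refine Iff.trans ?_ (hK _)
    constructor
    · rintro ⟨k, rfl⟩
      exact k.2
    · exact fun h => ⟨⟨_, h⟩, rfl⟩
  have hN : socleOverCenter M ≤ ι.range := by
    intro x hx
    rw [hιr, MonoidHom.mem_ker, MonoidHom.comp_apply, ← hK]
    refine ⟨(x : G).2, (mem_range_glEmb hφ).2 fun c v => ?_⟩
    obtain ⟨a, -, hac, hav⟩ := hsc c
    have h1 := LinearMap.congr_fun (hac (glRep G x) (apply_mem_algSpan ⟨x, hx, rfl⟩)) v
    rw [Module.End.mul_apply, Module.End.mul_apply, hav, hav] at h1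
    exact h1.symm
  let ρ : K →* Module.End E (Fin n → F) :=
    { toFun := fun k =>
        { toFun := fun v => (k : GL (Fin n) F).val *ᵥ v
          map_add' := Matrix.mulVec_add _
          map_smul' := hKsc k k.2 }
      map_one' := LinearMap.ext fun v => Matrix.one_mulVec v
      map_mul' := fun k l => LinearMap.ext fun v => (Matrix.mulVec_mulVec v _ _).symm }
  have hρι : ∀ k, (ρ k).restrictScalars F = glRep G (ι k) := fun k => rfl
  have hρ : Function.Injective ρ := fun k l h => hι <| Subtype.ext <| glRep_injective G <| by
    rw [← hρι, ← hρι, h]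
  have hres : ∀ a ∈ algSpan ρ ((socleOverCenter M).comap ι),
      a.restrictScalars F ∈ algSpan (glRep G) NG := by
    let W : Subalgebra E (Module.End E (Fin n → F)) :=
      { carrier := {a | a.restrictScalars F ∈ algSpan (glRep G) NG}
        mul_mem' := fun {a b} ha hb => (algSpan (glRep G) NG).mul_mem ha hb
        add_mem' := fun {a b} ha hb => (algSpan (glRep G) NG).add_mem ha hb
        algebraMap_mem' := fun c => ((hE _).2 ⟨c, fun v => rfl⟩).1 }
    have hW : algSpan ρ ((socleOverCenter M).comap ι) ≤ W := algSpan_le.2 fun k hk => by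
      have h1 : (ι k : G) ∈ NG := ⟨ι k, hk, rfl⟩
      exact apply_mem_algSpan (ρ := glRep G) h1
    exact fun a ha => hW ha
  have hhom : IsHomogeneousAlg (algSpan ρ ((socleOverCenter M).comap ι)) := by
    refine h𝓝.of_restrictScalars hres ?_
    rintro _ ⟨_, ⟨x, hx, rfl⟩, rfl⟩
    obtain ⟨k, rfl⟩ := hN hx
    exact ⟨ρ k, apply_mem_algSpan hx, hρι k⟩
  obtain ⟨hp, hbase⟩ := isCentralBase_of_socleOverCenter_le hMc hι hN hρ hhom (by
    intro a ha hac
    obtain ⟨c, hc⟩ := (hE (a.restrictScalars F)).1 ⟨hres a ha, fun b hb => by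
      refine (algSpan_commute_left ?_ b hb).symm
      rintro _ ⟨x, hx, rfl⟩
      obtain ⟨k, rfl⟩ := hN hx
      refine LinearMap.ext fun v => ?_
      exact (LinearMap.congr_fun (hac (ρ k) (apply_mem_algSpan hx)) v).symm⟩
    exact ⟨c, LinearMap.ext hc⟩)
  -- The intermediate group is taken to be `G` itself: `K` is already normal in `G`, with quotient
  -- embedded in the cyclic group `Gal(E/F)`.
  refine ⟨_, he, ⟨_, hmul.symm⟩, E, inferInstance, inferInstance, φ, rfl, ?_, K, rfl, ?_,
    ⟨G, inf_le_left, le_rfl, hGn, hKn, ?_, ?_⟩, ?_, ?_⟩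
  · intro g hg
    refine ⟨Ψ ⟨g, hg⟩, fun c w => ?_⟩
    rw [hφ', ← hφ]
    exact congrArg φ (hΨ ⟨g, hg⟩ c (φ.symm w))
  · rw [Subgroup.relIndex, hKΨ, Subgroup.index_ker, ← IsGalois.card_aut_eq_finrank F E]
    exact Subgroup.card_subgroup_dvd_card _
  · have : Subsingleton (G ⧸ G.subgroupOf G) := by
      rw [Subgroup.subgroupOf_self]
      exact QuotientGroup.subsingleton_quotient_top
    infer_instance
  · have h1 := isCyclic_of_injective _ (QuotientGroup.kerLift_injective Ψ)
    exact isCyclic_of_injective (QuotientGroup.quotientMulEquivOfEq hKΨ).toMonoidHom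
      (MulEquiv.injective _)
  · refine map_center_eq_inf hφ inf_le_right fun z hz => ?_
    obtain ⟨c, hc⟩ := hbase.exists_scalar hz
    exact ⟨c, fun v => LinearMap.congr_fun hc v⟩
  · rw [← hd]
    refine hbase.exists_subdirect hp ?_ ?_
    · rw [MonoidHom.range_comp]
      refine Subgroup.Normal.map ?_ _ (QuotientGroup.mk'_surjective _)
      rw [hιr]
      infer_instance
    · intro q hq
      obtain ⟨x, rfl⟩ := QuotientGroup.mk'_surjective _ q
      obtain ⟨k, rfl⟩ := hN hq
      exact ⟨k, rfl⟩
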